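/- Let $p$ be a prime, $n\ge 1$ and $k\ge 0$, let $G=C_{np^k}$ be cyclic of order $np^k$ with a chosen generator $g$, and let $C_n\subset G$ be the subgroup of order $n$. Mackey functors for a finite group are product-preserving functors from the Burnside category of finite sets with group action (morphisms: isomorphism classes of spans) to sets whose values are abelian groups; commutative Green functors are the commutative monoids among them for the box product $\Box$. For a commutative $C_n$-Green functor $\underline R$, let $N_{C_n}^{G}\underline R$ be its norm, i.e. the left Kan extension of $\underline R$ along the coinduction functor $T\mapsto F_{C_n}(G,T)$ between Burnside categories. The length-$(k+1)$ $p$-typical Green Witt vectors of $\underline R$ are the zeroth $G$-twisted Hochschild homology of $N_{C_n}^{G}\underline R$, $$\underline{\mathbb W}_{G}(\underline R)=\underline{\mathrm{HH}}^{G}_{C_n}(\underline R)_0=\operatorname{coeq}\bigl(d_0,d_1\colon N_{C_n}^{G}\underline R\,\Box\,N_{C_n}^{G}\underline R\rightrightarrows N_{C_n}^{G}\underline R\bigr),\qquad d_0(x\otimes y)=xy,\quad d_1(x\otimes y)=(gy)\,x .$$ Let $\mathcal O_n$ be the indexing system for $G$ in which, for each subgroup $H\subset G$, the admissible $H$-sets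 are the finite $H$-sets on which $C_n\cap H$ acts trivially, and let $\mathcal O_n\text{-}\mathrm{Tamb}^{G}_{tr}$ be the category of $\mathcal O_n$-Tambara functors $\underline S$ for which the Weyl action on $\underline S(G/H)$ is trivial for every $H\subset G$. Theorem. The functor $$\mathcal O_n\text{-}\mathrm{Tamb}^{G}_{tr}\longrightarrow \mathrm{Green}^{C_n},\qquad \underline S\longmapsto i_{C_n}^*\underline S,$$ sending $\underline S$ to its underlying commutative $C_n$-Green functor $T\mapsto \underline S(G\times_{C_n}T)$, has a left adjoint, and this left adjoint is the Green Witt vectors functor: its composite with the functor taking an $\mathcal O_n$-Tambara functor to its underlying commutative $G$-Green functor is naturally isomorphic to $\underline R\mapsto\underline{\mathbb W}_{G}(\underline R)$. -/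

import Mathlib

open CategoryTheory

universe v

/-! ### Finite `G`-sets -/

/-- A finite (left) `G`-set. -/
structure FinGSet (G : Type) [Group G] where
  carrier : Type
  [action : MulAction G carrier]
  [finite : Finite carrier]

namespace FinGSet

section

variable {G : Type} [Group G]

instance : CoeSort (FinGSet G) Type := ⟨FinGSet.carrier⟩

attribute [instance] FinGSet.action FinGSet.finite

/-- The one-point `G`-set. -/
def pt (G : Type) [Group G] : FinGSet G where
  carrier := PUnit
  action := { smul := fun _ x => x, one_smul := fun _ => rfl, mul_smul := fun _ _ _ => rfl }

/-- The empty `G`-set. -/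
def empty (G : Type) [Group G] : FinGSet G where
  carrier := PEmpty
  action :=
    { smul := fun _ x => x, one_smul := fun _ => rfl, mul_smul := fun _ _ _ => rfl }

/-- The product of two `G`-sets, with the diagonal action. -/
def prod (X Y : FinGSet G) : FinGSet G := ⟨X × Y⟩

/-- The disjoint union of two `G`-sets. -/
def sum (X Y : FinGSet G) : FinGSet G := ⟨X ⊕ Y⟩

/-- The transitive `G`-set `G/H`. -/
def orbit [Finite G] (H : Subgroup G) : FinGSet G := ⟨G ⧸ H⟩

/-- The fibre product `X ×_Z Y`. -/
def pb {X Y Z : FinGSet G} (f : X →[G] Z) (g : Y →[G] Z) : FinGSet G where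
  carrier := {w : X × Y // f w.1 = g w.2}
  action :=
    { smul := fun c w => ⟨(c • w.1.1, c • w.1.2), by simp [map_smul, w.2]⟩
      one_smul := fun w => Subtype.ext (by
        change ((1 : G) • w.1.1, (1 : G) • w.1.2) = w.1
        simp)
      mul_smul := fun c d w => Subtype.ext (by
        change ((c * d) • w.1.1, (c * d) • w.1.2) = (c • d • w.1.1, c • d • w.1.2)
        simp [mul_smul]) }

def pbFst {X Y Z : FinGSet G} (f : X →[G] Z) (g : Y →[G] Z) : pb f g →[G] X :=
  ⟨fun w => w.1.1, fun _ _ => rfl⟩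

def pbSnd {X Y Z : FinGSet G} (f : X →[G] Z) (g : Y →[G] Z) : pb f g →[G] Y :=
  ⟨fun w => w.1.2, fun _ _ => rfl⟩

def inl (X Y : FinGSet G) : X →[G] sum X Y := ⟨Sum.inl, fun _ _ => rfl⟩

def inr (X Y : FinGSet G) : Y →[G] sum X Y := ⟨Sum.inr, fun _ _ => rfl⟩

/-- The fold map `X ⨿ X → X`. -/
def fold (X : FinGSet G) : sum X X →[G] X :=
  ⟨Sum.elim id id, fun c x => by rcases x with x | x <;> rfl⟩

def fst (X Y : FinGSet G) : prod X Y →[G] X := ⟨Prod.fst, fun _ _ => rfl⟩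

def snd (X Y : FinGSet G) : prod X Y →[G] Y := ⟨Prod.snd, fun _ _ => rfl⟩

/-- The map `W → X × Y` with components `a` and `b`. -/
def pair {W X Y : FinGSet G} (a : W →[G] X) (b : W →[G] Y) : W →[G] prod X Y :=
  ⟨fun w => (a w, b w), fun c w => Prod.ext (map_smul a c w) (map_smul b c w)⟩

/-- The product `f × g : X × Y → X' × Y'` of two maps. -/
def prodMap {X Y X' Y' : FinGSet G} (f : X →[G] X') (g : Y →[G] Y') : prod X Y →[G] prod X' Y' :=
  ⟨fun w => (f w.1, g w.2), fun c w => Prod.ext (map_smul f c w.1) (map_smul g c w.2)⟩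

/-- The map to the point. -/
def toPt (X : FinGSet G) : X →[G] pt G := ⟨fun _ => PUnit.unit, fun _ _ => rfl⟩

/-- The square with `p : P → X`, `q : P → Y`, `f : X → Z`, `g : Y → Z` is a pullback square. -/
def IsPB {P X Y Z : FinGSet G} (p : P →[G] X) (q : P →[G] Y) (f : X →[G] Z) (g : Y →[G] Z) :
    Prop :=
  (∀ w, f (p w) = g (q w)) ∧ ∀ x y, f x = g y → ∃! w, p w = x ∧ q w = y

/-- The maps `i` and `j` exhibit `Z` as the disjoint union of `X` and `Y`. -/
def IsCoprod {X Y Z : FinGSet G} (i : X →[G] Z) (j : Y →[G] Z) : Prop :=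
  Function.Bijective (Sum.elim (i : X → Z) (j : Y → Z))

/-- `A —q→ X —f→ Y` together with `A ←e— E —f'→ P —π→ Y` and `r : E → X` is an exponential diagram:
`E = X ×_Y P`, `q ∘ e = r`, and the points of `P` over `y` are, through `e`, exactly the sections
of `q` over the fibre `f⁻¹(y)`. In other words `P` is the dependent product `Π_f A` and `e` is
the evaluation map. -/
structure IsExponential {X Y A P E : FinGSet G} (f : X →[G] Y) (q : A →[G] X) (π : P →[G] Y)
    (f' : E →[G] P) (r : E →[G] X) (e : E →[G] A) : Prop where
  isPB : IsPB r f' f π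
  proj_eval : ∀ t, q (e t) = r t
  exists_unique_section : ∀ (y : Y) (s : {x : X // f x = y} → A), (∀ x, q (s x) = x.1) →
    ∃! w : P, π w = y ∧ ∀ t : E, f' t = w → ∀ h : f (r t) = y, e t = s ⟨r t, h⟩

lemma isPB_pb {X Y Z : FinGSet G} (f : X →[G] Z) (g : Y →[G] Z) :
    IsPB (pbFst f g) (pbSnd f g) f g :=
  ⟨fun w => w.2, fun x y h => ⟨⟨(x, y), h⟩, ⟨rfl, rfl⟩, fun _ hw =>
    Subtype.ext (Prod.ext hw.1 hw.2)⟩⟩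

lemma IsPB.ext {P X Y Z : FinGSet G} {p : P →[G] X} {q : P →[G] Y} {f : X →[G] Z} {g : Y →[G] Z}
    (h : IsPB p q f g) {w w' : P} (h1 : p w = p w') (h2 : q w = q w') : w = w' := by
  obtain ⟨u, -, hu⟩ := h.2 (p w') (q w') (h.1 w')
  rw [hu w ⟨h1, h2⟩, hu w' ⟨rfl, rfl⟩]

lemma isPB_of {P X Y Z : FinGSet G} {p : P →[G] X} {q : P →[G] Y} {f : X →[G] Z} {g : Y →[G] Z}
    (h : ∀ w, f (p w) = g (q w)) (hex : ∀ x y, f x = g y → ∃ w, p w = x ∧ q w = y)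
    (hun : ∀ w w', p w = p w' → q w = q w' → w = w') : IsPB p q f g :=
  ⟨h, fun x y hxy => by
    obtain ⟨w, hw⟩ := hex x y hxy
    exact ⟨w, hw, fun w' hw' => hun _ _ (hw'.1.trans hw.1.symm) (hw'.2.trans hw.2.symm)⟩⟩

end

end FinGSet

open FinGSet

/-! ### Mackey functors and commutative Green functors -/

/-- A functor from the Burnside category of isomorphism classes of spans of finite `G`-sets to
sets, given on the two generating families of spans: `res f` is the value on `Y ←f— X = X`
and `tr f` is the value on `X = X —f→ Y`; composition of spans by pullback is `base_change`. -/
structure BurnsideFunctor (G : Type) [Group G] where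
  obj : FinGSet G → Type v
  res : ∀ {X Y : FinGSet G}, (X →[G] Y) → obj Y → obj X
  tr : ∀ {X Y : FinGSet G}, (X →[G] Y) → obj X → obj Y
  res_id : ∀ {X : FinGSet G} (x : obj X), res (MulActionHom.id G) x = x
  res_comp : ∀ {X Y Z : FinGSet G} (f : X →[G] Y) (g : Y →[G] Z) (z : obj Z),
    res (g.comp f) z = res f (res g z)
  tr_id : ∀ {X : FinGSet G} (x : obj X), tr (MulActionHom.id G) x = x
  tr_comp : ∀ {X Y Z : FinGSet G} (f : X →[G] Y) (g : Y →[G] Z) (x : obj X),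
    tr (g.comp f) x = tr g (tr f x)
  base_change : ∀ {P X Y Z : FinGSet G} (p : P →[G] X) (q : P →[G] Y) (f : X →[G] Z)
    (g : Y →[G] Z), IsPB p q f g → ∀ x : obj X, res g (tr f x) = tr q (res p x)

namespace BurnsideFunctor

section

variable {G : Type} [Group G]

/-- Natural transformations. -/
@[ext]
structure Hom (M N : BurnsideFunctor.{v} G) where
  app : ∀ X, M.obj X → N.obj X
  app_res : ∀ {X Y : FinGSet G} (f : X →[G] Y) (y : M.obj Y),
    app X (M.res f y) = N.res f (app Y y)
  app_tr : ∀ {X Y : FinGSet G} (f : X →[G] Y) (x : M.obj X),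
    app Y (M.tr f x) = N.tr f (app X x)

instance : Category (BurnsideFunctor.{v} G) where
  Hom := Hom
  id M := ⟨fun _ x => x, fun _ _ => rfl, fun _ _ => rfl⟩
  comp φ ψ := ⟨fun X x => ψ.app X (φ.app X x), fun f y => by rw [φ.app_res, ψ.app_res],
    fun f x => by rw [φ.app_tr, ψ.app_tr]⟩

/-- `M` is a semi-Mackey functor: it takes disjoint unions of finite `G`-sets, which are the
products of the Burnside category, to products of sets. -/
structure IsSemiMackey (M : BurnsideFunctor.{v} G) : Prop where
  empty : ∀ (X : FinGSet G), IsEmpty X → ∃! _x : M.obj X, True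
  coprod : ∀ {X Y Z : FinGSet G} (i : X →[G] Z) (j : Y →[G] Z), IsCoprod i j →
    Function.Bijective (fun z : M.obj Z => (M.res i z, M.res j z))

/-- The zero elements of the commutative monoids `M(X)`, `M` a semi-Mackey functor. -/
def IsZero (M : BurnsideFunctor.{v} G) {X : FinGSet G} (s : M.obj X) : Prop :=
  ∃ (E : FinGSet G) (_ : IsEmpty E) (u : E →[G] X) (e : M.obj E), s = M.tr u e

/-- `s = x + y` in the commutative monoid `M(X)`, `M` a semi-Mackey functor: the sum is the transfer
along the fold map of the element of `M(X ⨿ X) = M(X) × M(X)` with components `x`, `y`. -/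
def IsSum (M : BurnsideFunctor.{v} G) {X : FinGSet G} (x y s : M.obj X) : Prop :=
  ∃ z : M.obj (sum X X), M.res (inl X X) z = x ∧ M.res (inr X X) z = y ∧ M.tr (fold X) z = s

/-- `M` is a Mackey functor: a semi-Mackey functor such that the commutative monoids `M(X)` are
groups. -/
structure IsMackey (M : BurnsideFunctor.{v} G) : Prop extends IsSemiMackey M where
  exists_neg : ∀ (X : FinGSet G) (x : M.obj X), ∃ y s : M.obj X, M.IsSum x y s ∧ M.IsZero s

end

end BurnsideFunctor

/-- A commutative monoid in functors from the Burnside category of `G` to sets with respect to the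
box product (Day convolution along the product of `G`-sets): commutative monoid structures
on the sets `M(X)` such that restrictions are homomorphisms and Frobenius reciprocity holds. -/
structure PreGreen (G : Type) [Group G] extends BurnsideFunctor.{v} G where
  [commMonoid : ∀ X, CommMonoid (obj X)]
  res_one : ∀ {X Y : FinGSet G} (f : X →[G] Y), res f (1 : obj Y) = 1
  res_mul : ∀ {X Y : FinGSet G} (f : X →[G] Y) (x y : obj Y), res f (x * y) = res f x * res f y
  frobenius : ∀ {X Y : FinGSet G} (f : X →[G] Y) (x : obj X) (y : obj Y),
    tr f (x * res f y) = tr f x * y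

namespace PreGreen

section

variable {G : Type} [Group G]

attribute [instance] PreGreen.commMonoid

/-- Morphisms of commutative monoids: multiplicative unital natural transformations. -/
@[ext]
structure Hom (M N : PreGreen.{v} G) extends
    BurnsideFunctor.Hom M.toBurnsideFunctor N.toBurnsideFunctor where
  app_one : ∀ X, app X 1 = 1
  app_mul : ∀ X (x y : M.obj X), app X (x * y) = app X x * app X y

instance : Category (PreGreen.{v} G) where
  Hom := Hom
  id M := ⟨⟨fun _ x => x, fun _ _ => rfl, fun _ _ => rfl⟩, fun _ => rfl, fun _ _ _ => rfl⟩
  comp φ ψ := ⟨⟨fun X x => ψ.app X (φ.app X x), fun f y => by rw [φ.app_res, ψ.app_res],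
    fun f x => by rw [φ.app_tr, ψ.app_tr]⟩, fun X => by dsimp only; rw [φ.app_one, ψ.app_one],
    fun X x y => by dsimp only; rw [φ.app_mul, ψ.app_mul]⟩

end

end PreGreen

/-- A commutative monoid is a commutative Green functor if its underlying functor is a Mackey
functor. -/
def isGreen (G : Type) [Group G] : ObjectProperty (PreGreen.{v} G) :=
  fun M => M.toBurnsideFunctor.IsMackey

/-- The category of commutative Green functors for `G`. -/
abbrev Green (G : Type) [Group G] := (isGreen.{v} G).FullSubcategory

/-! ### Restriction to a subgroup -/

section Restriction

variable {G : Type} [Group G] (C : Subgroup G)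

/-- The equivalence relation `(x c, t) ∼ (x, c t)` on `G × T`. -/
def indSetoid (T : FinGSet C) : Setoid (G × T) where
  r a b := ∃ c : C, b = (a.1 * (c : G)⁻¹, c • a.2)
  iseqv :=
    { refl := fun a => ⟨1, by simp⟩
      symm := by
        rintro ⟨x, t⟩ _ ⟨c, rfl⟩
        exact ⟨c⁻¹, by simp⟩
      trans := by
        rintro ⟨x, t⟩ _ _ ⟨c, rfl⟩ ⟨d, rfl⟩
        exact ⟨d * c, by simp [mul_smul, mul_assoc]⟩ }

/-- The induced `G`-set `G ×_C T`. -/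
def ind [Finite G] (T : FinGSet C) : FinGSet G where
  carrier := Quotient (indSetoid C T)
  action :=
    { smul := fun g => Quotient.map (fun a => (g * a.1, a.2)) (by
        rintro ⟨x, t⟩ _ ⟨c, rfl⟩
        exact ⟨c, by simp [mul_assoc]⟩)
      one_smul := by
        rintro ⟨x, t⟩
        change Quotient.mk _ ((1 : G) * x, t) = _
        rw [one_mul]
        rfl
      mul_smul := by
        rintro g h ⟨x, t⟩
        change Quotient.mk _ ((g * h) * x, t) = Quotient.mk _ (g * (h * x), t)
        rw [mul_assoc] }

variable {C} [Finite G]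

def ind.mk {T : FinGSet C} (x : G) (t : T) : ind C T := Quotient.mk (indSetoid C T) (x, t)

lemma ind.mk_eq_iff {T : FinGSet C} {x y : G} {t u : T} :
    ind.mk x t = ind.mk y u ↔ ∃ c : C, y = x * (c : G)⁻¹ ∧ u = c • t :=
  (Quotient.eq (r := indSetoid C T)).trans ⟨fun ⟨c, h⟩ => ⟨c, congrArg Prod.fst h,
    congrArg Prod.snd h⟩, fun ⟨c, h, h'⟩ => ⟨c, Prod.ext h h'⟩⟩

lemma ind.mk_mul {T : FinGSet C} (x : G) (c : C) (t : T) :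
    ind.mk (x * c) t = ind.mk x (c • t) :=
  ind.mk_eq_iff.2 ⟨c, by simp, rfl⟩

lemma ind.exists_rep {T : FinGSet C} (a : ind C T) : ∃ x t, a = ind.mk x t := by
  obtain ⟨⟨x, t⟩, rfl⟩ := Quotient.exists_rep a
  exact ⟨x, t, rfl⟩

/-- The map `G ×_C f`. -/
def ind.map {T U : FinGSet C} (f : T →[C] U) : ind C T →[G] ind C U where
  toFun := Quotient.map (fun a => (a.1, f a.2)) (by
    rintro ⟨x, t⟩ _ ⟨c, rfl⟩
    exact ⟨c, by simp [map_smul]⟩)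
  map_smul' := by
    rintro g ⟨x, t⟩
    rfl

@[simp] lemma ind.map_mk {T U : FinGSet C} (f : T →[C] U) (x : G) (t : T) :
    ind.map f (ind.mk x t) = ind.mk x (f t) := rfl

lemma ind.map_id {T : FinGSet C} :
    ind.map (MulActionHom.id C : T →[C] T) = MulActionHom.id G := by
  ext a
  obtain ⟨x, t, rfl⟩ := ind.exists_rep a
  rfl

lemma ind.map_comp {T U V : FinGSet C} (f : T →[C] U) (g : U →[C] V) :
    ind.map (g.comp f) = (ind.map g).comp (ind.map f) := by
  ext a
  obtain ⟨x, t, rfl⟩ := ind.exists_rep a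
  rfl

lemma ind.isPB {P X Y Z : FinGSet C} {p : P →[C] X} {q : P →[C] Y} {f : X →[C] Z} {g : Y →[C] Z}
    (h : IsPB p q f g) : IsPB (ind.map p) (ind.map q) (ind.map f) (ind.map g) := by
  refine isPB_of ?_ ?_ ?_
  · intro a
    obtain ⟨x, t, rfl⟩ := ind.exists_rep a
    simp [h.1]
  · intro a b hab
    obtain ⟨x, s, rfl⟩ := ind.exists_rep a
    obtain ⟨y, t, rfl⟩ := ind.exists_rep b
    obtain ⟨c, rfl, hc⟩ := ind.mk_eq_iff.1 hab
    rw [← map_smul] at hc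
    obtain ⟨w, ⟨h1, h2⟩, -⟩ := h.2 (c • s) t hc.symm
    refine ⟨ind.mk (x * (c : G)⁻¹) w, ?_, by simp [h2]⟩
    rw [ind.map_mk, h1, ← ind.mk_mul]
    simp
  · intro a b h1 h2
    obtain ⟨x, s, rfl⟩ := ind.exists_rep a
    obtain ⟨y, t, rfl⟩ := ind.exists_rep b
    obtain ⟨c, rfl, hc⟩ := ind.mk_eq_iff.1 h1
    obtain ⟨d, hd, hd'⟩ := ind.mk_eq_iff.1 h2
    obtain rfl : c = d := by simpa using hd
    rw [← map_smul] at hc hd'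
    have ht : t = c • s := h.ext hc hd'
    rw [ht, ← ind.mk_mul]
    simp

lemma ind.isCoprod {X Y Z : FinGSet C} {i : X →[C] Z} {j : Y →[C] Z} (h : IsCoprod i j) :
    IsCoprod (ind.map i) (ind.map j) := by
  constructor
  · rintro (a | a) (b | b) hab
    all_goals
      obtain ⟨x, s, rfl⟩ := ind.exists_rep a
      obtain ⟨y, t, rfl⟩ := ind.exists_rep b
      obtain ⟨c, rfl, hc⟩ := ind.mk_eq_iff.1 hab
      rw [← map_smul] at hc
    · have := @h.1 (Sum.inl t) (Sum.inl (c • s)) hc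
      obtain rfl := Sum.inl.inj this
      rw [← ind.mk_mul]
      simp
    · exact absurd (@h.1 (Sum.inr t) (Sum.inl (c • s)) hc) (by simp)
    · exact absurd (@h.1 (Sum.inl t) (Sum.inr (c • s)) hc) (by simp)
    · have := @h.1 (Sum.inr t) (Sum.inr (c • s)) hc
      obtain rfl := Sum.inr.inj this
      rw [← ind.mk_mul]
      simp
  · intro a
    obtain ⟨x, z, rfl⟩ := ind.exists_rep a
    obtain ⟨s | s, hs⟩ := h.2 z
    · exact ⟨Sum.inl (ind.mk x s), congrArg (ind.mk x) hs⟩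
    · exact ⟨Sum.inr (ind.mk x s), congrArg (ind.mk x) hs⟩

/-- The restriction `i_C^* M = M(G ×_C -)` of a commutative monoid `M` to the subgroup `C`. -/
def PreGreen.restrict (C : Subgroup G) (M : PreGreen.{v} G) : PreGreen.{v} C where
  obj T := M.obj (ind C T)
  res f := M.res (ind.map f)
  tr f := M.tr (ind.map f)
  res_id x := by rw [ind.map_id, M.res_id]
  res_comp f g z := by rw [ind.map_comp, M.res_comp]
  tr_id x := by rw [ind.map_id, M.tr_id]
  tr_comp f g x := by rw [ind.map_comp, M.tr_comp]
  base_change p q f g h x := M.base_change _ _ _ _ (ind.isPB h) x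
  commMonoid T := M.commMonoid (ind C T)
  res_one f := M.res_one _
  res_mul f x y := M.res_mul _ x y
  frobenius f x y := M.frobenius _ x y

lemma PreGreen.restrict_isGreen (C : Subgroup G) (M : PreGreen.{v} G) (hM : isGreen G M) :
    isGreen C (M.restrict C) where
  empty X hX := hM.empty (ind C X) ⟨fun a => by
    obtain ⟨_, t, _⟩ := ind.exists_rep a
    exact hX.false t⟩
  coprod i j h := hM.coprod _ _ (ind.isCoprod h)
  exists_neg X x := by
    obtain ⟨y, s, ⟨z, rfl, rfl, rfl⟩, E, hE, u, e, hs⟩ := hM.exists_neg (ind C X) x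
    let k : sum (ind C X) (ind C X) →[G] ind C (sum X X) :=
      ⟨Sum.elim (ind.map (inl X X)) (ind.map (inr X X)), fun c a => by
        rcases a with a | a
        · exact map_smul (ind.map (inl X X)) c a
        · exact map_smul (ind.map (inr X X)) c a⟩
    have hk : Function.Bijective k := ind.isCoprod (i := inl X X) (j := inr X X)
      ⟨by rintro (a | a) (b | b) hab
          · exact congrArg _ (Sum.inl.inj hab)
          · cases hab
          · cases hab
          · exact congrArg _ (Sum.inr.inj hab),
       fun a => ⟨a, by rcases a with a | a <;> rfl⟩⟩
    have h1 : IsPB (inl (ind C X) (ind C X)) (MulActionHom.id G) k (ind.map (inl X X)) :=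
      isPB_of (fun _ => rfl) (fun a b h => ⟨b, hk.1 h.symm, rfl⟩) (fun _ _ _ h => h)
    have h2 : IsPB (inr (ind C X) (ind C X)) (MulActionHom.id G) k (ind.map (inr X X)) :=
      isPB_of (fun _ => rfl) (fun a b h => ⟨b, hk.1 h.symm, rfl⟩) (fun _ _ _ h => h)
    have h3 : (ind.map (fold X)).comp k = fold (ind C X) := by
      ext a
      rcases a with a | a <;>
      · obtain ⟨x, t, rfl⟩ := ind.exists_rep a
        rfl
    refine ⟨M.res (inr (ind C X) (ind C X)) z, M.tr (fold (ind C X)) z,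
      ⟨M.tr k z, (M.base_change _ _ _ _ h1 z).trans (M.tr_id _),
        (M.base_change _ _ _ _ h2 z).trans (M.tr_id _), ?_⟩, ?_⟩
    · change M.tr (ind.map (fold X)) (M.tr k z) = _
      rw [← M.tr_comp, h3]
    · let E' : FinGSet C := FinGSet.empty C
      let j : E →[G] ind C E' := ⟨fun a => (hE.false a).elim, fun _ a => (hE.false a).elim⟩
      let l : E' →[C] X := ⟨fun a => PEmpty.elim a, fun _ a => PEmpty.elim a⟩
      refine ⟨E', inferInstanceAs (IsEmpty PEmpty), l, M.tr j e, ?_⟩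
      change _ = M.tr (ind.map l) (M.tr j e)
      rw [hs, ← M.tr_comp]
      congr 1
      ext a
      exact (hE.false a).elim

/-- The restriction functor `i_C^*` from commutative Green functors for `G` to commutative Green
functors for `C`. -/
def restrictGreen (C : Subgroup G) : Green.{v} G ⥤ Green.{v} C where
  obj M := ⟨M.obj.restrict C, M.obj.restrict_isGreen C M.property⟩
  map {M N} φ := ObjectProperty.homMk (P := isGreen C)
    (⟨⟨fun T => φ.hom.app (ind C T), fun f => φ.hom.app_res (ind.map f),
      fun f => φ.hom.app_tr (ind.map f)⟩, fun T => φ.hom.app_one (ind C T),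
      fun T => φ.hom.app_mul (ind C T)⟩ : PreGreen.Hom (M.obj.restrict C) (N.obj.restrict C))

end Restriction

/-! ### Incomplete Tambara functors -/

section Tambara

variable {G : Type} [CommGroup G]

/-- The maps of finite `G`-sets along which there are norms for the indexing system attached to the
subgroup `C`: each fibre `f⁻¹(y)` is an admissible set for the stabilizer `K` of `y`, where a
`K`-set is admissible if `C ∩ K` acts trivially on it. -/
def HasNorm (C : Subgroup G) {X Y : FinGSet G} (f : X →[G] Y) : Prop :=
  ∀ y : Y, ∀ c ∈ C ⊓ MulAction.stabilizer G y, ∀ x : X, f x = y → c • x = x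

/-- An incomplete Tambara functor for `G` with norms along the maps in `HasNorm C`: restrictions,
transfers and norms, where norms are functorial, compatible with base change, given along fold
maps by the multiplication, and distribute over transfers along exponential diagrams. -/
structure OTamb (G : Type) [CommGroup G] (C : Subgroup G) extends PreGreen.{v} G where
  isMackey : toBurnsideFunctor.IsMackey
  norm : ∀ {X Y : FinGSet G} (f : X →[G] Y), HasNorm C f → obj X → obj Y
  norm_id : ∀ {X : FinGSet G} (h : HasNorm C (MulActionHom.id G : X →[G] X)) (x : obj X),
    norm (MulActionHom.id G) h x = x
  norm_comp : ∀ {X Y Z : FinGSet G} (f : X →[G] Y) (g : Y →[G] Z) (hf : HasNorm C f)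
    (hg : HasNorm C g) (hgf : HasNorm C (g.comp f)) (x : obj X),
    norm (g.comp f) hgf x = norm g hg (norm f hf x)
  norm_base_change : ∀ {P X Y Z : FinGSet G} (p : P →[G] X) (q : P →[G] Y) (f : X →[G] Z)
    (g : Y →[G] Z) (hf : HasNorm C f) (hq : HasNorm C q), IsPB p q f g → ∀ x : obj X,
    res g (norm f hf x) = norm q hq (res p x)
  norm_empty : ∀ {E X : FinGSet G} (u : E →[G] X) (hu : HasNorm C u), IsEmpty E →
    ∀ e : obj E, norm u hu e = 1
  norm_fold : ∀ {X : FinGSet G} (h : HasNorm C (fold X)) (z : obj (sum X X)),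
    norm (fold X) h z = res (inl X X) z * res (inr X X) z
  norm_tr : ∀ {X Y A P E : FinGSet G} (f : X →[G] Y) (q : A →[G] X) (π : P →[G] Y)
    (f' : E →[G] P) (r : E →[G] X) (e : E →[G] A) (hf : HasNorm C f) (hf' : HasNorm C f'),
    IsExponential f q π f' r e → ∀ a : obj A, norm f hf (tr q a) = tr π (norm f' hf' (res e a))

namespace OTamb

variable {C : Subgroup G}

/-- Morphisms: natural transformations compatible with restrictions, transfers, products and
norms. -/
@[ext]
structure Hom (M N : OTamb.{v} G C) extends
    toPreGreenHom : PreGreen.Hom M.toPreGreen N.toPreGreen where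
  app_norm : ∀ {X Y : FinGSet G} (f : X →[G] Y) (hf : HasNorm C f) (x : M.obj X),
    app Y (M.norm f hf x) = N.norm f hf (app X x)

instance : Category (OTamb.{v} G C) where
  Hom := Hom
  id M := ⟨PreGreen.Hom.mk (BurnsideFunctor.Hom.mk (fun _ x => x) (fun _ _ => rfl)
    (fun _ _ => rfl)) (fun _ => rfl) (fun _ _ _ => rfl), fun _ _ _ => rfl⟩
  comp φ ψ := ⟨PreGreen.Hom.mk (BurnsideFunctor.Hom.mk (fun X x => ψ.app X (φ.app X x))
    (fun f y => by rw [φ.app_res, ψ.app_res]) (fun f x => by rw [φ.app_tr, ψ.app_tr]))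
    (fun X => by dsimp only; rw [φ.app_one, ψ.app_one])
    (fun X x y => by dsimp only; rw [φ.app_mul, ψ.app_mul]),
    fun f hf x => by dsimp only; rw [φ.app_norm, ψ.app_norm]⟩

/-- The underlying commutative Green functor for `G`. -/
def toGreen (G : Type) [CommGroup G] (C : Subgroup G) : OTamb.{v} G C ⥤ Green.{v} G where
  obj M := ⟨M.toPreGreen, M.isMackey⟩
  map φ := ObjectProperty.homMk φ.toPreGreenHom

end OTamb

/-- The action of `g` on a `G`-set `X` is a map of `G`-sets, as `G` is abelian. -/
def FinGSet.actHom (g : G) (X : FinGSet G) : X →[G] X :=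
  ⟨fun x => g • x, fun c x => smul_comm g c x⟩

/-- The action of `g ∈ G` on a functor on the Burnside category of the abelian group `G`. At an
orbit `G/H` this is the action of the class of `g` in the Weyl group `G/H`. -/
def BurnsideFunctor.act (g : G) (M : BurnsideFunctor.{v} G) : M ⟶ M where
  app X := M.tr (actHom g X)
  app_res {X Y} f y := by
    symm
    refine M.base_change f (actHom g X) (actHom g Y) f (isPB_of ?_ ?_ ?_) y
    · intro x
      exact (map_smul f g x).symm
    · intro y x h
      refine ⟨g⁻¹ • x, ?_, smul_inv_smul g x⟩
      rw [map_smul, ← h]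
      exact inv_smul_smul g y
    · intro w w' _ h
      exact (MulAction.injective g) h
  app_tr {X Y} f x := by
    rw [← M.tr_comp, ← M.tr_comp]
    congr 1
    ext w
    exact (map_smul f g w).symm

/-- The Weyl action on `M(G/H)` is trivial for every subgroup `H`. -/
def IsWeylTrivial [Finite G] (C : Subgroup G) : ObjectProperty (OTamb.{v} G C) :=
  fun M => ∀ (H : Subgroup G) (g : G) (x : M.obj (orbit H)),
    (BurnsideFunctor.act g M.toBurnsideFunctor).app (orbit H) x = x

/-- The category of incomplete Tambara functors with trivial Weyl action. -/
abbrev OTambTriv (G : Type) [CommGroup G] [Finite G] (C : Subgroup G) :=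
  (IsWeylTrivial.{v} C).FullSubcategory

/-- The functor sending an incomplete Tambara functor with trivial Weyl action to its underlying
commutative Green functor for `C`. -/
def underlyingGreen (G : Type) [CommGroup G] [Finite G] (C : Subgroup G) :
    OTambTriv.{v} G C ⥤ Green.{v} C :=
  (IsWeylTrivial.{v} C).ι ⋙ OTamb.toGreen G C ⋙ restrictGreen C

end Tambara

/-! ### The norm -/

section Coinduction

variable {G : Type} [Group G] [Finite G] {C : Subgroup G}

/-- The coinduced `G`-set `F_C(G, T)` of `C`-equivariant maps `G → T`, with
`(g φ)(x) = φ(x g)`. -/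
def coind (T : FinGSet C) : FinGSet G where
  carrier := {φ : G → T // ∀ (c : C) (x : G), φ (c * x) = c • φ x}
  action :=
    { smul := fun g φ => ⟨fun x => φ.1 (x * g), fun c x =>
        (congrArg φ.1 (mul_assoc (c : G) x g)).trans (φ.2 c (x * g))⟩
      one_smul := fun φ => Subtype.ext (funext fun x => congrArg φ.1 (mul_one x))
      mul_smul := fun g h φ => Subtype.ext (funext fun x =>
        congrArg φ.1 (mul_assoc x g h).symm) }

/-- The map `F_C(G, f)`. -/
def coind.map {T U : FinGSet C} (f : T →[C] U) : coind T →[G] coind U :=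
  ⟨fun φ => ⟨fun x => f (φ.1 x), fun c x =>
    (congrArg f (φ.2 c x)).trans (map_smul f c (φ.1 x))⟩, fun _ _ => rfl⟩

/-- The map `B → F_C(G, T × U)` with components `a` and `b`. -/
def coind.pair {B : FinGSet G} {T U : FinGSet C} (a : B →[G] coind T) (b : B →[G] coind U) :
    B →[G] coind (prod T U) :=
  ⟨fun w => ⟨fun x => ((a w).1 x, (b w).1 x), fun c x =>
      Prod.ext ((a w).2 c x) ((b w).2 c x)⟩, fun g w => by
    rw [map_smul, map_smul]
    rfl⟩

/-- The map to `F_C(G, pt) = pt`. -/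
def coind.toPt (B : FinGSet G) : B →[G] coind (pt C) :=
  ⟨fun _ => ⟨fun _ => PUnit.unit, fun _ _ => rfl⟩, fun _ _ => rfl⟩

end Coinduction

section Norm

variable {G : Type} [Group G] [Finite G] {C : Subgroup G}

/-- A span `F_C(G, T) ←a— B —b→ X` together with an element of `M(T)`. -/
structure NormRep (M : BurnsideFunctor.{v} C) (X : FinGSet G) where
  T : FinGSet C
  B : FinGSet G
  a : B →[G] coind T
  b : B →[G] X
  m : M.obj T

/-- The relations `(σ, φ_* m) ∼ (σ ∘ F_C(G, φ), m)` for the two kinds of generating morphisms `φ` of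
the Burnside category of `C`. (For `φ` an identity, `tr` identifies isomorphic spans.) -/
inductive NormRel (M : BurnsideFunctor.{v} C) (X : FinGSet G) :
    NormRep M X → NormRep M X → Prop
  | tr {T T' : FinGSet C} (f : T →[C] T') {B P : FinGSet G} (a : B →[G] coind T') (b : B →[G] X)
      (p : P →[G] coind T) (q : P →[G] B) (h : IsPB p q (coind.map f) a) (m : M.obj T) :
      NormRel M X ⟨T', B, a, b, M.tr f m⟩ ⟨T, P, p, b.comp q, m⟩
  | res {T T' : FinGSet C} (f : T →[C] T') {B : FinGSet G} (a : B →[G] coind T) (b : B →[G] X)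
      (m : M.obj T') :
      NormRel M X ⟨T, B, a, b, M.res f m⟩ ⟨T', B, (coind.map f).comp a, b, m⟩

namespace NormRep

variable {M : BurnsideFunctor.{v} C}

/-- The class of a representative in the left Kan extension. -/
def cls {X : FinGSet G} (ρ : NormRep M X) : Quot (NormRel M X) := Quot.mk _ ρ

lemma cls_tr {X : FinGSet G} {T T' : FinGSet C} (f : T →[C] T') {B P : FinGSet G}
    (a : B →[G] coind T') (b : B →[G] X) (p : P →[G] coind T) (q : P →[G] B) (b' : P →[G] X)
    (h : IsPB p q (coind.map f) a) (hb : ∀ w, b (q w) = b' w) (m : M.obj T) (m' : M.obj T')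
    (hm : m' = M.tr f m) :
    cls (⟨T', B, a, b, m'⟩ : NormRep M X) = cls ⟨T, P, p, b', m⟩ := by
  obtain rfl : b.comp q = b' := by
    ext w
    exact hb w
  subst hm
  exact Quot.sound (NormRel.tr f a b p q h m)

lemma cls_res {X : FinGSet G} {T T' : FinGSet C} (f : T →[C] T') {B B' : FinGSet G}
    (e : B →[G] B') (he : Function.Bijective e) (a : B →[G] coind T) (b : B →[G] X)
    (a' : B' →[G] coind T') (b' : B' →[G] X) (ha : ∀ w, coind.map f (a w) = a' (e w))
    (hb : ∀ w, b w = b' (e w)) (m : M.obj T) (m' : M.obj T') (hm : m = M.res f m') :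
    cls (⟨T, B, a, b, m⟩ : NormRep M X) = cls ⟨T', B', a', b', m'⟩ := by
  subst hm
  refine (Quot.sound (NormRel.res f a b m')).trans ?_
  have h : IsPB ((coind.map f).comp a) e (coind.map (MulActionHom.id C)) a' :=
    isPB_of ha (fun x y hxy => by
      obtain ⟨w, rfl⟩ := he.2 y
      exact ⟨w, (ha w).trans hxy.symm, rfl⟩) (fun _ _ _ h => he.1 h)
  exact (cls_tr (M := M) _ a' b' _ e b h (fun w => (hb w).symm) m' m' (M.tr_id m').symm).symm

lemma cls_iso {X : FinGSet G} {T : FinGSet C} {B B' : FinGSet G}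
    (e : B →[G] B') (he : Function.Bijective e) (a : B →[G] coind T) (b : B →[G] X)
    (a' : B' →[G] coind T) (b' : B' →[G] X) (ha : ∀ w, a w = a' (e w))
    (hb : ∀ w, b w = b' (e w)) (m : M.obj T) :
    cls (⟨T, B, a, b, m⟩ : NormRep M X) = cls ⟨T, B', a', b', m⟩ :=
  cls_res (MulActionHom.id C) e he a b a' b' ha hb m m (M.res_id m).symm

/-- The covariant functoriality of the representatives. -/
def tr {X Y : FinGSet G} (f : X →[G] Y) (ρ : NormRep M X) : NormRep M Y :=
  ⟨ρ.T, ρ.B, ρ.a, f.comp ρ.b, ρ.m⟩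

/-- The contravariant functoriality of the representatives. -/
def res {X Y : FinGSet G} (f : X →[G] Y) (ρ : NormRep M Y) : NormRep M X :=
  ⟨ρ.T, pb ρ.b f, ρ.a.comp (pbFst ρ.b f), pbSnd ρ.b f, ρ.m⟩

lemma cls_tr_congr {X Y : FinGSet G} (f : X →[G] Y) (ρ σ : NormRep M X) (h : NormRel M X ρ σ) :
    (ρ.tr f).cls = (σ.tr f).cls := by
  cases h with
  | tr g a b p q h m => exact Quot.sound (NormRel.tr g a (f.comp b) p q h m)
  | res g a b m => exact Quot.sound (NormRel.res g a (f.comp b) m)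

lemma cls_res_congr {X Y : FinGSet G} (f : X →[G] Y) (ρ σ : NormRep M Y) (h : NormRel M Y ρ σ) :
    (ρ.res f).cls = (σ.res f).cls := by
  cases h with
  | tr g a b p q h m =>
    let q' : pb (b.comp q) f →[G] pb b f :=
      ⟨fun w => ⟨(q w.1.1, w.1.2), w.2⟩, fun c w =>
        Subtype.ext (Prod.ext (map_smul q c w.1.1) rfl)⟩
    refine cls_tr g _ _ (p.comp (pbFst _ f)) q' _ (isPB_of ?_ ?_ ?_) (fun _ => rfl) m _ rfl
    · intro w
      exact h.1 w.1.1
    · rintro x ⟨⟨y, z⟩, hyz⟩ hxy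
      obtain ⟨w, ⟨h1, h2⟩, -⟩ := h.2 x y hxy
      exact ⟨⟨(w, z), (congrArg b h2).trans hyz⟩, h1, Subtype.ext (Prod.ext h2 rfl)⟩
    · intro w w' h1 h2
      exact Subtype.ext (Prod.ext (h.ext h1 (congrArg (fun u => u.1.1) h2))
        (congrArg (fun u => u.1.2) h2))
  | res g a b m => exact Quot.sound (NormRel.res g (a.comp (pbFst b f)) (pbSnd b f) m)

end NormRep

/-- The norm `N_C^G M`: the left Kan extension of the set-valued functor `M` along the coinduction
functor `F_C(G, -)` from the Burnside category of `C` to that of `G`. -/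
def BurnsideFunctor.norm (G : Type) [Group G] [Finite G] {C : Subgroup G}
    (M : BurnsideFunctor.{v + 1} C) : BurnsideFunctor.{v + 1} G where
  obj X := Quot (NormRel M X)
  res f := Quot.lift (fun ρ => (ρ.res f).cls) (NormRep.cls_res_congr f)
  tr f := Quot.lift (fun ρ => (ρ.tr f).cls) (NormRep.cls_tr_congr f)
  res_id := by
    rintro X ⟨ρ⟩
    exact NormRep.cls_iso (pbFst _ _) ⟨fun w w' h => Subtype.ext (Prod.ext h
      (w.2.symm.trans ((congrArg ρ.b h).trans w'.2))), fun w => ⟨⟨(w, ρ.b w), rfl⟩, rfl⟩⟩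
      _ _ _ _ (fun _ => rfl) (fun w => w.2.symm) _
  res_comp := by
    rintro X Y Z f g ⟨ρ⟩
    let e : pb ρ.b (g.comp f) →[G] pb (pbSnd ρ.b g) f :=
      ⟨fun w => ⟨(⟨(w.1.1, f w.1.2), w.2⟩, w.1.2), rfl⟩, fun c w => Subtype.ext (Prod.ext
        (Subtype.ext (Prod.ext rfl (map_smul f c w.1.2))) rfl)⟩
    refine NormRep.cls_iso e ⟨fun w w' h => ?_, ?_⟩ _ _ _ _ (fun _ => rfl) (fun _ => rfl) _
    · have h1 := congrArg (fun w => w.1.1.1.1) h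
      have h2 := congrArg (fun w => w.1.2) h
      exact Subtype.ext (Prod.ext h1 h2)
    · rintro ⟨⟨⟨⟨b, y⟩, hby⟩, x⟩, hx⟩
      have hx' : y = f x := hx
      subst hx'
      exact ⟨⟨(b, x), hby⟩, rfl⟩
  tr_id := by
    rintro X ⟨ρ⟩
    rfl
  tr_comp := by
    rintro X Y Z f g ⟨ρ⟩
    rfl
  base_change := by
    rintro P X Y Z p q f g h ⟨ρ⟩
    let e : pb ρ.b p →[G] pb (f.comp ρ.b) g :=
      ⟨fun w => ⟨(w.1.1, q w.1.2), (congrArg f w.2).trans (h.1 w.1.2)⟩, fun c w =>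
        Subtype.ext (Prod.ext rfl (map_smul q c w.1.2))⟩
    refine (NormRep.cls_iso e ⟨fun w w' hw => ?_, ?_⟩ _ _ _ _ (fun _ => rfl)
      (fun _ => rfl) _).symm
    · have h1 := congrArg (fun w => w.1.1) hw
      have h2 := congrArg (fun w => w.1.2) hw
      exact Subtype.ext (Prod.ext h1 (h.ext (w.2.symm.trans ((congrArg ρ.b h1).trans w'.2)) h2))
    · rintro ⟨⟨b, y⟩, hby⟩
      obtain ⟨w, ⟨h1, h2⟩, -⟩ := h.2 (ρ.b b) y hby
      exact ⟨⟨(b, w), h1.symm⟩, Subtype.ext (Prod.ext rfl h2)⟩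

end Norm

section NormMul

variable {G : Type} [Group G]

/-- The external product `M(T) × M(U) → M(T × U)` of a commutative monoid `M`. -/
def PreGreen.ext (M : PreGreen.{v} G) {T U : FinGSet G} (m : M.obj T) (n : M.obj U) :
    M.obj (prod T U) :=
  M.res (fst T U) m * M.res (snd T U) n

lemma PreGreen.res_ext (M : PreGreen.{v} G) {W T U : FinGSet G} (a : W →[G] prod T U)
    (m : M.obj T) (n : M.obj U) :
    M.res a (M.ext m n) = M.res ((fst T U).comp a) m * M.res ((snd T U).comp a) n := by
  rw [PreGreen.ext, M.res_mul, M.res_comp, M.res_comp]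

lemma PreGreen.ext_res (M : PreGreen.{v} G) {T T' U U' : FinGSet G} (f : T →[G] T')
    (g : U →[G] U') (m : M.obj T') (n : M.obj U') :
    M.ext (M.res f m) (M.res g n) = M.res (prodMap f g) (M.ext m n) := by
  rw [M.res_ext, PreGreen.ext, ← M.res_comp, ← M.res_comp]
  rfl

lemma PreGreen.mul_tr (M : PreGreen.{v} G) {X Y : FinGSet G} (f : X →[G] Y) (x : M.obj X)
    (y : M.obj Y) : y * M.tr f x = M.tr f (M.res f y * x) := by
  rw [mul_comm y, ← M.frobenius, mul_comm x]

lemma PreGreen.ext_tr_left (M : PreGreen.{v} G) {T T' U : FinGSet G} (f : T →[G] T')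
    (m : M.obj T) (n : M.obj U) :
    M.ext (M.tr f m) n = M.tr (prodMap f (MulActionHom.id G)) (M.ext m n) := by
  have h : IsPB (fst T U) (prodMap f (MulActionHom.id G)) f (fst T' U) :=
    isPB_of (fun _ => rfl) (fun x y hxy => ⟨(x, y.2), rfl, Prod.ext hxy rfl⟩)
      (fun _ _ h1 h2 => Prod.ext h1 (congrArg (fun u => u.2) h2))
  rw [PreGreen.ext, M.base_change _ _ _ _ h, ← M.frobenius, ← M.res_comp]
  rfl

lemma PreGreen.ext_tr_right (M : PreGreen.{v} G) {T U U' : FinGSet G} (g : U →[G] U')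
    (m : M.obj T) (n : M.obj U) :
    M.ext m (M.tr g n) = M.tr (prodMap (MulActionHom.id G) g) (M.ext m n) := by
  have h : IsPB (snd T U) (prodMap (MulActionHom.id G) g) g (snd T U') :=
    isPB_of (fun _ => rfl) (fun x y hxy => ⟨(y.1, x), rfl, Prod.ext rfl hxy⟩)
      (fun _ _ h1 h2 => Prod.ext (congrArg (fun u => u.1) h2) h1)
  rw [PreGreen.ext, M.base_change _ _ _ _ h, M.mul_tr, ← M.res_comp]
  rfl

lemma PreGreen.ext_tr (M : PreGreen.{v} G) {T T' U U' : FinGSet G} (f : T →[G] T')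
    (g : U →[G] U') (m : M.obj T) (n : M.obj U) :
    M.ext (M.tr f m) (M.tr g n) = M.tr (prodMap f g) (M.ext m n) := by
  rw [M.ext_tr_left, M.ext_tr_right, ← M.tr_comp]
  rfl

variable [Finite G] {C : Subgroup G}

namespace NormRep

variable {M : PreGreen.{v} C}

/-- The unit of the norm, represented by `F_C(G, pt) ← X = X` and `1 ∈ M(pt)`. -/
def one (X : FinGSet G) : NormRep M.toBurnsideFunctor X :=
  ⟨pt C, X, coind.toPt X, MulActionHom.id G, 1⟩

/-- The product of the norm, induced by the external product of `M`, the isomorphism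
`F_C(G, T) × F_C(G, U) = F_C(G, T × U)` and restriction along the diagonal of `X`. -/
def mul {X : FinGSet G} (ρ σ : NormRep M.toBurnsideFunctor X) :
    NormRep M.toBurnsideFunctor X :=
  ⟨prod ρ.T σ.T, pb ρ.b σ.b,
    coind.pair (ρ.a.comp (pbFst ρ.b σ.b)) (σ.a.comp (pbSnd ρ.b σ.b)),
    ρ.b.comp (pbFst ρ.b σ.b), M.ext ρ.m σ.m⟩

lemma cls_mul_comm {X : FinGSet G} (ρ σ : NormRep M.toBurnsideFunctor X) :
    (ρ.mul σ).cls = (σ.mul ρ).cls := by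
  let e : pb ρ.b σ.b →[G] pb σ.b ρ.b :=
    ⟨fun w => ⟨(w.1.2, w.1.1), w.2.symm⟩, fun _ _ => rfl⟩
  refine cls_res (pair (snd ρ.T σ.T) (fst ρ.T σ.T)) e ⟨fun w w' h => ?_, fun w =>
    ⟨⟨(w.1.2, w.1.1), w.2.symm⟩, rfl⟩⟩ _ _ _ _ (fun _ => rfl) (fun w => w.2) _ _ ?_
  · exact Subtype.ext (Prod.ext (congrArg (fun u => u.1.2) h) (congrArg (fun u => u.1.1) h))
  · rw [M.res_ext, PreGreen.ext, mul_comm]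
    rfl

lemma cls_mul_congr_left {X : FinGSet G} (ρ ρ' σ : NormRep M.toBurnsideFunctor X)
    (h : NormRel M.toBurnsideFunctor X ρ ρ') : (ρ.mul σ).cls = (ρ'.mul σ).cls := by
  cases h with
  | @tr T T' f B P a b p q h m =>
    let q' : pb (b.comp q) σ.b →[G] pb b σ.b :=
      ⟨fun w => ⟨(q w.1.1, w.1.2), w.2⟩, fun c w =>
        Subtype.ext (Prod.ext (map_smul q c w.1.1) rfl)⟩
    refine cls_tr (prodMap f (MulActionHom.id C)) _ _
      (coind.pair (p.comp (pbFst _ σ.b)) (σ.a.comp (pbSnd _ σ.b))) q' _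
      (isPB_of ?_ ?_ ?_) (fun _ => rfl) _ _ (M.ext_tr_left f m σ.m)
    · intro w
      have h1 := congrArg Subtype.val (h.1 w.1.1)
      exact Subtype.ext (funext fun x => Prod.ext (congrFun h1 x) rfl)
    · rintro x ⟨⟨y, z⟩, hyz⟩ hxy
      have hxy' := fun t => congrFun (congrArg Subtype.val hxy) t
      obtain ⟨w, ⟨h1, h2⟩, -⟩ := h.2 (coind.map (T := prod T σ.T) (fst T σ.T) x) y
        (Subtype.ext (funext fun t => congrArg Prod.fst (hxy' t)))
      refine ⟨⟨(w, z), (congrArg b h2).trans hyz⟩, Subtype.ext (funext fun t => ?_),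
        Subtype.ext (Prod.ext h2 rfl)⟩
      exact Prod.ext (congrFun (congrArg Subtype.val h1) t) (congrArg Prod.snd (hxy' t)).symm
    · intro w w' h1 h2
      refine Subtype.ext (Prod.ext (h.ext ?_ (congrArg (fun u => u.1.1) h2))
        (congrArg (fun u => u.1.2) h2))
      exact Subtype.ext (funext fun t =>
        congrArg Prod.fst (congrFun (congrArg Subtype.val h1) t))
  | res f a b m =>
    refine cls_res (prodMap f (MulActionHom.id C : σ.T →[C] σ.T)) (MulActionHom.id G)
      Function.bijective_id (coind.pair (a.comp (pbFst b σ.b)) (σ.a.comp (pbSnd b σ.b)))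
      (b.comp (pbFst b σ.b)) _ _ (fun _ => rfl) (fun _ => rfl) _ _ ?_
    rw [← M.ext_res, M.res_id]

lemma cls_mul_congr_right {X : FinGSet G} (ρ σ σ' : NormRep M.toBurnsideFunctor X)
    (h : NormRel M.toBurnsideFunctor X σ σ') : (ρ.mul σ).cls = (ρ.mul σ').cls := by
  rw [cls_mul_comm, cls_mul_congr_left _ _ _ h, cls_mul_comm]

end NormRep

/-- The commutative monoid structure on the norm of a commutative monoid. -/
def PreGreen.norm (G : Type) [Group G] [Finite G] {C : Subgroup G} (M : PreGreen.{v + 1} C) :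
    PreGreen.{v + 1} G where
  toBurnsideFunctor := M.toBurnsideFunctor.norm G
  commMonoid X :=
    { mul := Quot.lift₂ (fun ρ σ => (ρ.mul σ).cls) NormRep.cls_mul_congr_right
        NormRep.cls_mul_congr_left
      one := (NormRep.one X).cls
      mul_comm := by
        rintro ⟨ρ⟩ ⟨σ⟩
        exact NormRep.cls_mul_comm ρ σ
      mul_assoc := by
        rintro ⟨ρ⟩ ⟨σ⟩ ⟨τ⟩
        let f : prod (prod ρ.T σ.T) τ.T →[C] prod ρ.T (prod σ.T τ.T) :=
          ⟨fun w => (w.1.1, (w.1.2, w.2)), fun _ _ => rfl⟩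
        let e : pb (ρ.mul σ).b τ.b →[G] pb ρ.b (σ.mul τ).b :=
          ⟨fun w => ⟨(w.1.1.1.1, ⟨(w.1.1.1.2, w.1.2), w.1.1.2.symm.trans w.2⟩), w.1.1.2⟩,
            fun _ _ => rfl⟩
        refine NormRep.cls_res f e ⟨fun w w' h => ?_, fun w => ?_⟩ _ _ _ _ (fun _ => rfl)
          (fun _ => rfl) _ _ ?_
        · have h1 := congrArg (fun u => u.1.1) h
          have h2 := congrArg (fun u => u.1.2.1.1) h
          have h3 := congrArg (fun u => u.1.2.1.2) h
          exact Subtype.ext (Prod.ext (Subtype.ext (Prod.ext h1 h2)) h3)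
        · exact ⟨⟨(⟨(w.1.1, w.1.2.1.1), w.2⟩, w.1.2.1.2), w.2.trans w.1.2.2⟩, rfl⟩
        · change M.ext (M.ext ρ.m σ.m) τ.m = M.res f (M.ext ρ.m (M.ext σ.m τ.m))
          rw [M.res_ext, M.res_ext, PreGreen.ext, M.res_ext, mul_assoc]
          rfl
      one_mul := by
        rintro ⟨ρ⟩
        refine NormRep.cls_res (snd (pt C) ρ.T) (pbSnd (MulActionHom.id G) ρ.b)
          ⟨fun w w' h => ?_, fun w => ⟨⟨(ρ.b w, w), rfl⟩, rfl⟩⟩ _ _ _ _ (fun _ => rfl)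
          (fun w => w.2) _ _ ?_
        · exact Subtype.ext (Prod.ext (w.2.trans ((congrArg ρ.b h).trans w'.2.symm)) h)
        · change M.ext 1 ρ.m = _
          rw [PreGreen.ext, M.res_one, one_mul]
          rfl
      mul_one := by
        rintro ⟨ρ⟩
        refine NormRep.cls_res (fst ρ.T (pt C)) (pbFst ρ.b (MulActionHom.id G))
          ⟨fun w w' h => ?_, fun w => ⟨⟨(w, ρ.b w), rfl⟩, rfl⟩⟩ _ _ _ _ (fun _ => rfl)
          (fun w => rfl) _ _ ?_
        · exact Subtype.ext (Prod.ext h (w.2.symm.trans ((congrArg ρ.b h).trans w'.2)))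
        · change M.ext ρ.m 1 = _
          rw [PreGreen.ext, M.res_one, mul_one]
          rfl }
  res_one {X Y} f := by
    refine NormRep.cls_iso (pbSnd (MulActionHom.id G) f) ⟨fun w w' h => ?_, fun x =>
      ⟨⟨(f x, x), rfl⟩, rfl⟩⟩ _ _ _ _ (fun _ => rfl) (fun _ => rfl) _
    exact Subtype.ext (Prod.ext (w.2.trans ((congrArg f h).trans w'.2.symm)) h)
  res_mul {X Y} f := by
    rintro ⟨ρ⟩ ⟨σ⟩
    let e : pb (ρ.mul σ).b f →[G] pb (pbSnd ρ.b f) (pbSnd σ.b f) :=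
      ⟨fun w => ⟨(⟨(w.1.1.1.1, w.1.2), w.2⟩, ⟨(w.1.1.1.2, w.1.2), w.1.1.2.symm.trans w.2⟩), rfl⟩,
        fun _ _ => rfl⟩
    refine NormRep.cls_iso e ⟨fun w w' h => ?_, fun w => ?_⟩ _ _ _ _ (fun _ => rfl)
      (fun _ => rfl) _
    · have h1 := congrArg (fun u => u.1.1.1.1) h
      have h2 := congrArg (fun u => u.1.2.1.1) h
      have h3 := congrArg (fun u => u.1.2.1.2) h
      exact Subtype.ext (Prod.ext (Subtype.ext (Prod.ext h1 h2)) h3)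
    · obtain ⟨⟨⟨⟨a, x⟩, ha⟩, ⟨⟨b, x'⟩, hb⟩⟩, hx⟩ := w
      have hx' : x = x' := hx
      subst hx'
      exact ⟨⟨(⟨(a, b), ha.trans hb.symm⟩, x), ha⟩, rfl⟩
  frobenius {X Y} f := by
    rintro ⟨ρ⟩ ⟨σ⟩
    let e : pb ρ.b (pbSnd σ.b f) →[G] pb (f.comp ρ.b) σ.b :=
      ⟨fun w => ⟨(w.1.1, w.1.2.1.1), (congrArg f w.2).trans w.1.2.2.symm⟩, fun _ _ => rfl⟩
    refine NormRep.cls_iso e ⟨fun w w' h => ?_, fun w => ?_⟩ _ _ _ _ (fun _ => rfl)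
      (fun _ => rfl) _
    · have h1 := congrArg (fun u => u.1.1) h
      have h2 := congrArg (fun u => u.1.2) h
      exact Subtype.ext (Prod.ext h1 (Subtype.ext (Prod.ext h2
        (w.2.symm.trans ((congrArg ρ.b h1).trans w'.2)))))
    · exact ⟨⟨(w.1.1, ⟨(w.1.2, ρ.b w.1.1), w.2.symm⟩), rfl⟩, rfl⟩

/-- The norm of a morphism. -/
def PreGreen.normMap (G : Type) [Group G] [Finite G] {C : Subgroup G} {M N : PreGreen.{v + 1} C}
    (φ : M ⟶ N) : M.norm G ⟶ N.norm G where
  app X := Quot.lift (fun ρ => (⟨ρ.T, ρ.B, ρ.a, ρ.b, φ.app ρ.T ρ.m⟩ :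
      NormRep N.toBurnsideFunctor X).cls) (by
    intro ρ σ h
    cases h with
    | tr f a b p q h m => exact NormRep.cls_tr f a b p q _ h (fun _ => rfl) _ _ (φ.app_tr f m)
    | res f a b m =>
      exact NormRep.cls_res f (MulActionHom.id G) Function.bijective_id a b _ b (fun _ => rfl)
        (fun _ => rfl) _ _ (φ.app_res f m))
  app_res f := by
    rintro ⟨ρ⟩
    rfl
  app_tr f := by
    rintro ⟨ρ⟩
    rfl
  app_one X := by
    change NormRep.cls _ = NormRep.cls _
    dsimp only [NormRep.one]
    rw [φ.app_one]
  app_mul X := by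
    rintro ⟨ρ⟩ ⟨σ⟩
    change NormRep.cls _ = NormRep.cls _
    dsimp only [NormRep.mul]
    rw [PreGreen.ext, φ.app_mul, φ.app_res, φ.app_res]
    rfl

/-- The norm functor `N_C^G` on commutative monoids. -/
def normFunctor (G : Type) [Group G] [Finite G] (C : Subgroup G) :
    PreGreen.{v + 1} C ⥤ PreGreen.{v + 1} G where
  obj M := M.norm G
  map φ := PreGreen.normMap G φ
  map_id M := PreGreen.Hom.ext (funext fun X => funext fun x => by
    rcases x with ⟨ρ⟩
    rfl)
  map_comp φ ψ := PreGreen.Hom.ext (funext fun X => funext fun x => by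
    rcases x with ⟨ρ⟩
    rfl)

end NormMul

/-! ### The box product -/

section Box

variable {G : Type} [Group G]

/-- A span `T × U ←a— B —b→ X` together with elements of `M(T)` and `N(U)`. -/
structure BoxRep (M N : BurnsideFunctor.{v} G) (X : FinGSet G) where
  T : FinGSet G
  U : FinGSet G
  B : FinGSet G
  a : B →[G] prod T U
  b : B →[G] X
  m : M.obj T
  n : N.obj U

/-- The relations `(σ, φ_* m, ψ_* n) ∼ (σ ∘ (φ × ψ), m, n)` for the two kinds of generating
morphisms of the Burnside category. -/
inductive BoxRel (M N : BurnsideFunctor.{v} G) (X : FinGSet G) :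
    BoxRep M N X → BoxRep M N X → Prop
  | tr {T T' U U' : FinGSet G} (f : T →[G] T') (g : U →[G] U') {B P : FinGSet G}
      (a : B →[G] prod T' U') (b : B →[G] X) (p : P →[G] prod T U) (q : P →[G] B)
      (h : IsPB p q (prodMap f g) a) (m : M.obj T) (n : N.obj U) :
      BoxRel M N X ⟨T', U', B, a, b, M.tr f m, N.tr g n⟩ ⟨T, U, P, p, b.comp q, m, n⟩
  | res {T T' U U' : FinGSet G} (f : T →[G] T') (g : U →[G] U') {B : FinGSet G}
      (a : B →[G] prod T U) (b : B →[G] X) (m : M.obj T') (n : N.obj U') :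
      BoxRel M N X ⟨T, U, B, a, b, M.res f m, N.res g n⟩
        ⟨T', U', B, (prodMap f g).comp a, b, m, n⟩

namespace BoxRep

variable {M N : BurnsideFunctor.{v} G}

/-- The class of a representative in the left Kan extension. -/
def cls {X : FinGSet G} (ρ : BoxRep M N X) : Quot (BoxRel M N X) := Quot.mk _ ρ

lemma cls_tr {X : FinGSet G} {T T' U U' : FinGSet G} (f : T →[G] T') (g : U →[G] U')
    {B P : FinGSet G} (a : B →[G] prod T' U') (b : B →[G] X) (p : P →[G] prod T U)
    (q : P →[G] B) (b' : P →[G] X) (h : IsPB p q (prodMap f g) a) (hb : ∀ w, b (q w) = b' w)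
    (m : M.obj T) (n : N.obj U) (m' : M.obj T') (n' : N.obj U') (hm : m' = M.tr f m)
    (hn : n' = N.tr g n) :
    cls (⟨T', U', B, a, b, m', n'⟩ : BoxRep M N X) = cls ⟨T, U, P, p, b', m, n⟩ := by
  obtain rfl : b.comp q = b' := by
    ext w
    exact hb w
  subst hm hn
  exact Quot.sound (BoxRel.tr f g a b p q h m n)

lemma cls_iso {X T U B B' : FinGSet G} (e : B →[G] B') (he : Function.Bijective e)
    (a : B →[G] prod T U) (b : B →[G] X) (a' : B' →[G] prod T U) (b' : B' →[G] X)
    (ha : ∀ w, a w = a' (e w)) (hb : ∀ w, b w = b' (e w)) (m : M.obj T) (n : N.obj U) :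
    cls (⟨T, U, B, a, b, m, n⟩ : BoxRep M N X) = cls ⟨T, U, B', a', b', m, n⟩ := by
  have h : IsPB a e (prodMap (MulActionHom.id G) (MulActionHom.id G)) a' :=
    isPB_of ha (fun x y hxy => by
      obtain ⟨w, rfl⟩ := he.2 y
      exact ⟨w, (ha w).trans hxy.symm, rfl⟩) (fun _ _ _ h => he.1 h)
  exact (cls_tr _ _ a' b' a e b h (fun w => (hb w).symm) m n m n (M.tr_id m).symm
    (N.tr_id n).symm).symm

/-- The covariant functoriality of the representatives. -/
def tr {X Y : FinGSet G} (f : X →[G] Y) (ρ : BoxRep M N X) : BoxRep M N Y :=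
  ⟨ρ.T, ρ.U, ρ.B, ρ.a, f.comp ρ.b, ρ.m, ρ.n⟩

/-- The contravariant functoriality of the representatives. -/
def res {X Y : FinGSet G} (f : X →[G] Y) (ρ : BoxRep M N Y) : BoxRep M N X :=
  ⟨ρ.T, ρ.U, pb ρ.b f, ρ.a.comp (pbFst ρ.b f), pbSnd ρ.b f, ρ.m, ρ.n⟩

lemma cls_tr_congr {X Y : FinGSet G} (f : X →[G] Y) (ρ σ : BoxRep M N X)
    (h : BoxRel M N X ρ σ) : (ρ.tr f).cls = (σ.tr f).cls := by
  cases h with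
  | tr k l a b p q h m n => exact Quot.sound (BoxRel.tr k l a (f.comp b) p q h m n)
  | res k l a b m n => exact Quot.sound (BoxRel.res k l a (f.comp b) m n)

lemma cls_res_congr {X Y : FinGSet G} (f : X →[G] Y) (ρ σ : BoxRep M N Y)
    (h : BoxRel M N Y ρ σ) : (ρ.res f).cls = (σ.res f).cls := by
  cases h with
  | tr k l a b p q h m n =>
    let q' : pb (b.comp q) f →[G] pb b f :=
      ⟨fun w => ⟨(q w.1.1, w.1.2), w.2⟩, fun c w =>
        Subtype.ext (Prod.ext (map_smul q c w.1.1) rfl)⟩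
    refine cls_tr k l _ _ (p.comp (pbFst _ f)) q' _ (isPB_of ?_ ?_ ?_) (fun _ => rfl) m n _ _
      rfl rfl
    · intro w
      exact h.1 w.1.1
    · rintro x ⟨⟨y, z⟩, hyz⟩ hxy
      obtain ⟨w, ⟨h1, h2⟩, -⟩ := h.2 x y hxy
      exact ⟨⟨(w, z), (congrArg b h2).trans hyz⟩, h1, Subtype.ext (Prod.ext h2 rfl)⟩
    · intro w w' h1 h2
      exact Subtype.ext (Prod.ext (h.ext h1 (congrArg (fun u => u.1.1) h2))
        (congrArg (fun u => u.1.2) h2))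
  | res k l a b m n => exact Quot.sound (BoxRel.res k l (a.comp (pbFst b f)) (pbSnd b f) m n)

end BoxRep

namespace BurnsideFunctor

/-- The box product `M □ N`: the left Kan extension of `(T, U) ↦ M(T) × N(U)` along the product
functor `(T, U) ↦ T × U` of Burnside categories. -/
def box (M N : BurnsideFunctor.{v + 1} G) : BurnsideFunctor.{v + 1} G where
  obj X := Quot (BoxRel M N X)
  res f := Quot.lift (fun ρ => (ρ.res f).cls) (BoxRep.cls_res_congr f)
  tr f := Quot.lift (fun ρ => (ρ.tr f).cls) (BoxRep.cls_tr_congr f)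
  res_id := by
    rintro X ⟨ρ⟩
    exact BoxRep.cls_iso (pbFst _ _) ⟨fun w w' h => Subtype.ext (Prod.ext h
      (w.2.symm.trans ((congrArg ρ.b h).trans w'.2))), fun w => ⟨⟨(w, ρ.b w), rfl⟩, rfl⟩⟩
      _ _ _ _ (fun _ => rfl) (fun w => w.2.symm) _ _
  res_comp := by
    rintro X Y Z f g ⟨ρ⟩
    let e : pb ρ.b (g.comp f) →[G] pb (pbSnd ρ.b g) f :=
      ⟨fun w => ⟨(⟨(w.1.1, f w.1.2), w.2⟩, w.1.2), rfl⟩, fun c w => Subtype.ext (Prod.ext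
        (Subtype.ext (Prod.ext rfl (map_smul f c w.1.2))) rfl)⟩
    refine BoxRep.cls_iso e ⟨fun w w' h => ?_, ?_⟩ _ _ _ _ (fun _ => rfl) (fun _ => rfl) _ _
    · have h1 := congrArg (fun w => w.1.1.1.1) h
      have h2 := congrArg (fun w => w.1.2) h
      exact Subtype.ext (Prod.ext h1 h2)
    · rintro ⟨⟨⟨⟨b, y⟩, hby⟩, x⟩, hx⟩
      have hx' : y = f x := hx
      subst hx'
      exact ⟨⟨(b, x), hby⟩, rfl⟩
  tr_id := by
    rintro X ⟨ρ⟩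
    rfl
  tr_comp := by
    rintro X Y Z f g ⟨ρ⟩
    rfl
  base_change := by
    rintro P X Y Z p q f g h ⟨ρ⟩
    let e : pb ρ.b p →[G] pb (f.comp ρ.b) g :=
      ⟨fun w => ⟨(w.1.1, q w.1.2), (congrArg f w.2).trans (h.1 w.1.2)⟩, fun c w =>
        Subtype.ext (Prod.ext rfl (map_smul q c w.1.2))⟩
    refine (BoxRep.cls_iso e ⟨fun w w' hw => ?_, ?_⟩ _ _ _ _ (fun _ => rfl)
      (fun _ => rfl) _ _).symm
    · have h1 := congrArg (fun w => w.1.1) hw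
      have h2 := congrArg (fun w => w.1.2) hw
      exact Subtype.ext (Prod.ext h1 (h.ext (w.2.symm.trans ((congrArg ρ.b h1).trans w'.2)) h2))
    · rintro ⟨⟨b, y⟩, hby⟩
      obtain ⟨w, ⟨h1, h2⟩, -⟩ := h.2 (ρ.b b) y hby
      exact ⟨⟨(b, w), h1.symm⟩, Subtype.ext (Prod.ext rfl h2)⟩

/-- The box product of two morphisms. -/
def boxMap {M M' N N' : BurnsideFunctor.{v + 1} G} (φ : M ⟶ M') (ψ : N ⟶ N') :
    M.box N ⟶ M'.box N' where
  app X := Quot.lift (fun ρ => (⟨ρ.T, ρ.U, ρ.B, ρ.a, ρ.b, φ.app ρ.T ρ.m, ψ.app ρ.U ρ.n⟩ :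
      BoxRep M' N' X).cls) (by
    intro ρ σ h
    cases h with
    | tr f g a b p q h m n =>
      exact BoxRep.cls_tr f g a b p q _ h (fun _ => rfl) _ _ _ _ (φ.app_tr f m) (ψ.app_tr g n)
    | res f g a b m n =>
      dsimp only
      rw [φ.app_res, ψ.app_res]
      exact Quot.sound (BoxRel.res f g a b _ _))
  app_res f := by
    rintro ⟨ρ⟩
    rfl
  app_tr f := by
    rintro ⟨ρ⟩
    rfl

/-- The symmetry `τ : M □ N ⟶ N □ M`. -/
def boxSwap (M N : BurnsideFunctor.{v + 1} G) : M.box N ⟶ N.box M where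
  app X := Quot.lift (fun ρ => (⟨ρ.U, ρ.T, ρ.B,
      pair ((snd ρ.T ρ.U).comp ρ.a) ((fst ρ.T ρ.U).comp ρ.a), ρ.b, ρ.n, ρ.m⟩ :
      BoxRep N M X).cls) (by
    intro ρ σ h
    cases h with
    | tr f g a b p q h m n =>
      refine BoxRep.cls_tr g f _ b _ q _ (isPB_of ?_ ?_ ?_) (fun _ => rfl) _ _ _ _ rfl rfl
      · intro w
        exact congrArg Prod.swap (h.1 w)
      · intro x y hxy
        obtain ⟨w, ⟨h1, h2⟩, -⟩ := h.2 (x.2, x.1) y (congrArg Prod.swap hxy)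
        exact ⟨w, congrArg Prod.swap h1, h2⟩
      · intro w w' h1 h2
        exact h.ext (congrArg Prod.swap h1) h2
    | res f g a b m n => exact Quot.sound (BoxRel.res g f _ b n m))
  app_res f := by
    rintro ⟨ρ⟩
    rfl
  app_tr f := by
    rintro ⟨ρ⟩
    rfl

end BurnsideFunctor

/-- The multiplication `M □ M ⟶ M` of a commutative monoid `M`. -/
def PreGreen.boxMul (M : PreGreen.{v + 1} G) :
    M.toBurnsideFunctor.box M.toBurnsideFunctor ⟶ M.toBurnsideFunctor where
  app X := Quot.lift (fun ρ => M.tr ρ.b (M.res ρ.a (M.ext ρ.m ρ.n))) (by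
    intro ρ σ h
    cases h with
    | tr f g a b p q h m n =>
      dsimp only
      rw [M.ext_tr, M.base_change _ _ _ _ h, M.tr_comp]
    | res f g a b m n =>
      dsimp only
      rw [M.ext_res, M.res_comp])
  app_res f := by
    rintro ⟨ρ⟩
    change M.tr (pbSnd ρ.b f) (M.res (ρ.a.comp (pbFst ρ.b f)) (M.ext ρ.m ρ.n)) =
      M.res f (M.tr ρ.b (M.res ρ.a (M.ext ρ.m ρ.n)))
    exact (congrArg _ (M.res_comp _ _ _)).trans
      (M.base_change _ _ _ _ (isPB_pb ρ.b f) _).symm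
  app_tr f := by
    rintro ⟨ρ⟩
    exact M.tr_comp ρ.b f (M.res ρ.a (M.ext ρ.m ρ.n))

end Box

/-! ### Twisted Hochschild homology in degree zero and Witt vectors -/

section Witt

variable {G : Type} [CommGroup G]

/-- The face map `d₀ : ᵍM □ M ⟶ M` of the twisted cyclic nerve of `M`: the multiplication. -/
def PreGreen.d₀ (M : PreGreen.{v + 1} G) :
    M.toBurnsideFunctor.box M.toBurnsideFunctor ⟶ M.toBurnsideFunctor :=
  M.boxMul

/-- The face map `d₁ : ᵍM □ M ⟶ M` of the twisted cyclic nerve of `M`: move the last factor to the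
front, act on it by `g`, and multiply. -/
def PreGreen.d₁ (g : G) (M : PreGreen.{v + 1} G) :
    M.toBurnsideFunctor.box M.toBurnsideFunctor ⟶ M.toBurnsideFunctor :=
  BurnsideFunctor.boxSwap _ _ ≫
    BurnsideFunctor.boxMap (BurnsideFunctor.act g M.toBurnsideFunctor) (𝟙 _) ≫ M.boxMul

lemma PreGreen.d₀_cls (M : PreGreen.{v + 1} G) {X : FinGSet G}
    (ρ : BoxRep M.toBurnsideFunctor M.toBurnsideFunctor X) :
    M.d₀.app X ρ.cls = M.tr ρ.b (M.res ((fst ρ.T ρ.U).comp ρ.a) ρ.m *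
      M.res ((snd ρ.T ρ.U).comp ρ.a) ρ.n) :=
  congrArg (M.tr ρ.b) (M.res_ext ρ.a ρ.m ρ.n)

lemma PreGreen.d₁_cls (g : G) (M : PreGreen.{v + 1} G) {X : FinGSet G}
    (ρ : BoxRep M.toBurnsideFunctor M.toBurnsideFunctor X) :
    (M.d₁ g).app X ρ.cls = M.tr ρ.b
      (M.res ((snd ρ.T ρ.U).comp ρ.a) (M.tr (actHom g ρ.U) ρ.n) *
        M.res ((fst ρ.T ρ.U).comp ρ.a) ρ.m) :=
  congrArg (M.tr ρ.b) (M.res_ext (pair ((snd ρ.T ρ.U).comp ρ.a) ((fst ρ.T ρ.U).comp ρ.a))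
    (M.tr (actHom g ρ.U) ρ.n) ρ.m)

/-- The relation `d₀ z ∼ d₁ z` on `M(X)`. -/
def PreGreen.HHRel (g : G) (M : PreGreen.{v + 1} G) (X : FinGSet G) (x y : M.obj X) : Prop :=
  ∃ z : (M.toBurnsideFunctor.box M.toBurnsideFunctor).obj X,
    x = M.d₀.app X z ∧ y = (M.d₁ g).app X z

lemma PreGreen.HHRel.mul_left {g : G} {M : PreGreen.{v + 1} G} {X : FinGSet G} {x y : M.obj X}
    (h : M.HHRel g X x y) (c : M.obj X) : M.HHRel g X (c * x) (c * y) := by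
  obtain ⟨⟨ρ⟩, rfl, rfl⟩ := h
  let i : ρ.B →[G] prod ρ.B ρ.B := pair (MulActionHom.id G) (MulActionHom.id G)
  let m : M.obj ρ.B := M.res ρ.b c * M.res ((fst ρ.T ρ.U).comp ρ.a) ρ.m
  let n : M.obj ρ.B := M.res ((snd ρ.T ρ.U).comp ρ.a) ρ.n
  have h1 : ∀ x : M.obj ρ.B, M.res ((fst ρ.B ρ.B).comp i) x = x := M.res_id
  have h2 : ∀ x : M.obj ρ.B, M.res ((snd ρ.B ρ.B).comp i) x = x := M.res_id
  have h3 : M.tr (actHom g ρ.B) n =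
      M.res ((snd ρ.T ρ.U).comp ρ.a) (M.tr (actHom g ρ.U) ρ.n) :=
    (BurnsideFunctor.act g M.toBurnsideFunctor).app_res _ _
  refine ⟨BoxRep.cls ⟨ρ.B, ρ.B, ρ.B, i, ρ.b, m, n⟩, ?_, ?_⟩
  · rw [M.d₀_cls]
    refine (congrArg (c * ·) (M.d₀_cls ρ)).trans ?_
    dsimp only
    rw [h1, h2, M.mul_tr, mul_assoc]
  · rw [M.d₁_cls]
    refine (congrArg (c * ·) (M.d₁_cls g ρ)).trans ?_
    dsimp only
    rw [h1, h2, h3, M.mul_tr, mul_left_comm]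

/-- The `0`-th twisted Hochschild homology `HH₀` of a commutative monoid `M` with respect to
`g ∈ G`: the coequalizer of `d₀, d₁ : ᵍM □ M ⇉ M`, with the induced commutative monoid structure.
The coequalizer is formed in set-valued functors on the Burnside category. As `d₀` and `d₁` have a
common section (the degeneracy given by the unit of `M`), for a Green functor `M` it is also the
cokernel of `d₀ - d₁` in Mackey functors: two elements of the abelian group `M(X)` are
related by `HHRel` if and only if their difference is in the image of `d₀ - d₁`. -/
def PreGreen.HH0 (g : G) (M : PreGreen.{v + 1} G) : PreGreen.{v + 1} G where
  obj X := Quot (M.HHRel g X)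
  res {X Y} f := Quot.map (M.res f) (by
    rintro _ _ ⟨z, rfl, rfl⟩
    exact ⟨_, (M.d₀.app_res f z).symm, ((M.d₁ g).app_res f z).symm⟩)
  tr {X Y} f := Quot.map (M.tr f) (by
    rintro _ _ ⟨z, rfl, rfl⟩
    exact ⟨_, (M.d₀.app_tr f z).symm, ((M.d₁ g).app_tr f z).symm⟩)
  res_id := by
    rintro X ⟨x⟩
    exact congrArg (Quot.mk _) (M.res_id x)
  res_comp := by
    rintro X Y Z f g ⟨x⟩
    exact congrArg (Quot.mk _) (M.res_comp f g x)
  tr_id := by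
    rintro X ⟨x⟩
    exact congrArg (Quot.mk _) (M.tr_id x)
  tr_comp := by
    rintro X Y Z f g ⟨x⟩
    exact congrArg (Quot.mk _) (M.tr_comp f g x)
  base_change := by
    rintro P X Y Z p q f g h ⟨x⟩
    exact congrArg (Quot.mk _) (M.base_change p q f g h x)
  commMonoid X :=
    { mul := Quot.map₂ (· * ·) (fun c _ _ h => h.mul_left c) (fun x y c h => by
        simpa only [mul_comm _ c] using h.mul_left c)
      one := Quot.mk _ 1
      mul_comm := by
        rintro ⟨x⟩ ⟨y⟩
        exact congrArg (Quot.mk _) (mul_comm x y)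
      mul_assoc := by
        rintro ⟨x⟩ ⟨y⟩ ⟨z⟩
        exact congrArg (Quot.mk _) (mul_assoc x y z)
      one_mul := by
        rintro ⟨x⟩
        exact congrArg (Quot.mk _) (one_mul x)
      mul_one := by
        rintro ⟨x⟩
        exact congrArg (Quot.mk _) (mul_one x) }
  res_one f := congrArg (Quot.mk _) (M.res_one f)
  res_mul f := by
    rintro ⟨x⟩ ⟨y⟩
    exact congrArg (Quot.mk _) (M.res_mul f x y)
  frobenius f := by
    rintro ⟨x⟩ ⟨y⟩
    exact congrArg (Quot.mk _) (M.frobenius f x y)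

lemma PreGreen.HHRel.map {g : G} {M N : PreGreen.{v + 1} G} (φ : M ⟶ N) {X : FinGSet G}
    {x y : M.obj X} (h : M.HHRel g X x y) : N.HHRel g X (φ.app X x) (φ.app X y) := by
  obtain ⟨⟨ρ⟩, rfl, rfl⟩ := h
  refine ⟨BoxRep.cls ⟨ρ.T, ρ.U, ρ.B, ρ.a, ρ.b, φ.app ρ.T ρ.m, φ.app ρ.U ρ.n⟩, ?_, ?_⟩
  · rw [N.d₀_cls]
    refine (congrArg (φ.app X) (M.d₀_cls ρ)).trans ?_
    rw [φ.app_tr, φ.app_mul, φ.app_res, φ.app_res]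
  · rw [N.d₁_cls]
    refine (congrArg (φ.app X) (M.d₁_cls g ρ)).trans ?_
    rw [φ.app_tr, φ.app_mul, φ.app_res, φ.app_res, φ.app_tr]

/-- The functor `HH₀` on commutative monoids. -/
def HH0Functor (g : G) : PreGreen.{v + 1} G ⥤ PreGreen.{v + 1} G where
  obj M := M.HH0 g
  map {M N} φ := PreGreen.Hom.mk (BurnsideFunctor.Hom.mk
      (fun X => Quot.map (φ.app X) (fun _ _ h => h.map φ))
      (fun f => by
        rintro ⟨x⟩
        exact congrArg (Quot.mk _) (φ.app_res f x))
      (fun f => by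
        rintro ⟨x⟩
        exact congrArg (Quot.mk _) (φ.app_tr f x)))
    (fun X => congrArg (Quot.mk _) (φ.app_one X))
    (fun X => by
      rintro ⟨x⟩ ⟨y⟩
      exact congrArg (Quot.mk _) (φ.app_mul X x y))
  map_id M := PreGreen.Hom.ext (funext fun X => funext fun x => by
    rcases x with ⟨x⟩
    rfl)
  map_comp φ ψ := PreGreen.Hom.ext (funext fun X => funext fun x => by
    rcases x with ⟨x⟩
    rfl)

/-- The Green Witt vectors `W_G(R) = HH₀` of the norm `N_C^G R` twisted by the generator `g` of `G`,
as a functor from commutative Green functors for `C` to commutative monoids in functors on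
the Burnside category of `G`. -/
def greenWitt [Finite G] (g : G) (C : Subgroup G) : Green.{v + 1} C ⥤ PreGreen.{v + 1} G :=
  (isGreen C).ι ⋙ normFunctor G C ⋙ HH0Functor g

end Witt

/-! ### Maps of finite `G`-sets, pullbacks and coproducts -/

namespace FinGSet

section

variable {G : Type} [Group G]

/-! Two universal properties are composed: the norm `N_C^G R` is the free incomplete Tambara functor
on the Green functor `R`, and twisted `HH₀` is the universal way of making the Weyl action trivial.

Freeness of the norm. Finite `C`-sets are the same as finite `G`-sets over `G/C` (through `fib` and
`ind`). In these terms the `C`-set underlying `B` is `B × G/C`, and coinduction is a dependent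
product along `B × G/C → B`. The Kan extension therefore has a normal form: every element is `tr b
(nmBase m)` with `m` a value of `R` at the `C`-set underlying `B` (`exists_eq_tr_nmBase`), and the
only relation is that `nmBase` distributes over transfers along exponential diagrams (`nmBase_tr`,
`normLift`). So `nmBase` behaves as a norm along `B × G/C → B`. An admissible map `h : D → B`, with
`D` over `G/C`, factors as `D → B × G/C → B`. On fibres over the base point of `G/C` the first map
preserves stabilizers in `C` (`HasNorm.isLocTriv_fib`), and along such maps every commutative Green
functor already has norms, namely products over the fibres (`prodAlong`). This gives `nm h c m`, the
norm along `h` of an element at `D`. The norm along `f` of `tr b (nmBase m)` is then forced: an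
exponential diagram moves the transfer outside, and what remains is the norm along a composite of
admissible maps (`normNorm_tr_nm`). Well-definedness and the Tambara axioms become the calculus of
exponential diagrams: composition in either variable, base change, uniqueness. Additive inverses
come from expanding the norm of `1 + y₀ = 0` (`exists_neg_one_norm`). Conversely, a morphism `φ`
from `R` to the underlying Green functor of `S` can extend only by sending `tr b (nmBase m)` to the
transfer along `b` of the norm along `B × G/C → B` of `φ m`. This is well defined because `S`
satisfies the same distributive law (`normDesc`, `normDesc_eq`).

Trivial Weyl action. The relation imposed by `HH₀` is `tr b (m n) ∼ tr b ((g n) m)`. With `m = 1`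
and `b` an identity it reads `x ∼ g x`, and `g` generates `G`, so the action on the quotient is
trivial. Any morphism to a functor with trivial Weyl action identifies the two sides. Norms are
multiplicative, commute with the action and distribute over transfers, so they respect the relation
and descend (`PreTamb.hhRel_norm`). The two universal properties combine in `wittHomEquiv`. -/

lemma hom_ext {X Y : FinGSet G} {f g : X →[G] Y} (h : ∀ x, f x = g x) : f = g :=
  DFunLike.ext _ _ h

/-- The inverse of a bijective map. -/
noncomputable def inv {X Y : FinGSet G} (f : X →[G] Y) (hf : Function.Bijective f) : Y →[G] X where
  toFun := (Equiv.ofBijective f hf).symm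
  map_smul' c y := by
    apply hf.1
    have h : ∀ y, f ((Equiv.ofBijective f hf).symm y) = y :=
      (Equiv.ofBijective f hf).apply_symm_apply
    simp only [id_eq, map_smul, h]

lemma inv_apply {X Y : FinGSet G} (f : X →[G] Y) (hf : Function.Bijective f) (x : X) :
    inv f hf (f x) = x :=
  (Equiv.ofBijective f hf).symm_apply_apply x

lemma IsPB.symm {P X Y Z : FinGSet G} {p : P →[G] X} {q : P →[G] Y} {f : X →[G] Z} {g : Y →[G] Z}
    (h : IsPB p q f g) : IsPB q p g f :=
  isPB_of (fun w => (h.1 w).symm) (fun x y hxy => by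
    obtain ⟨w, hw, -⟩ := h.2 y x hxy.symm
    exact ⟨w, hw.2, hw.1⟩) (fun _ _ h1 h2 => h.ext h2 h1)

lemma isPB_of_bijective {P X Y Z : FinGSet G} {p : P →[G] X} {q : P →[G] Y} {f : X →[G] Z}
    {g : Y →[G] Z} (h : ∀ w, f (p w) = g (q w)) (hq : Function.Bijective q)
    (hf : Function.Injective f) : IsPB p q f g :=
  isPB_of h (fun x y hxy => by
    obtain ⟨w, rfl⟩ := hq.2 y
    exact ⟨w, hf ((h w).trans hxy.symm), rfl⟩) (fun _ _ _ h2 => hq.1 h2)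

lemma isPB_id {X Y : FinGSet G} (f : X →[G] Y) :
    IsPB f (MulActionHom.id G) (MulActionHom.id G) f :=
  isPB_of_bijective (fun _ => rfl) Function.bijective_id Function.injective_id

/-- The map into a pullback determined by its components. -/
noncomputable def IsPB.lift {W P X Y Z : FinGSet G} {p : P →[G] X} {q : P →[G] Y} {f : X →[G] Z}
    {g : Y →[G] Z} (h : IsPB p q f g) (a : W →[G] X) (b : W →[G] Y) (hab : ∀ w, f (a w) = g (b w)) :
    W →[G] P where
  toFun w := (h.2 (a w) (b w) (hab w)).choose
  map_smul' c w := by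
    have h1 := fun w => (h.2 (a w) (b w) (hab w)).choose_spec.1
    apply h.ext
    · rw [(h1 _).1, id_eq, map_smul, map_smul, (h1 _).1]
    · rw [(h1 _).2, id_eq, map_smul, map_smul, (h1 _).2]

lemma IsPB.lift_fst {W P X Y Z : FinGSet G} {p : P →[G] X} {q : P →[G] Y} {f : X →[G] Z}
    {g : Y →[G] Z} (h : IsPB p q f g) (a : W →[G] X) (b : W →[G] Y) (hab : ∀ w, f (a w) = g (b w))
    (w : W) : p (h.lift a b hab w) = a w :=
  (h.2 (a w) (b w) (hab w)).choose_spec.1.1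

lemma IsPB.lift_snd {W P X Y Z : FinGSet G} {p : P →[G] X} {q : P →[G] Y} {f : X →[G] Z}
    {g : Y →[G] Z} (h : IsPB p q f g) (a : W →[G] X) (b : W →[G] Y) (hab : ∀ w, f (a w) = g (b w))
    (w : W) : q (h.lift a b hab w) = b w :=
  (h.2 (a w) (b w) (hab w)).choose_spec.1.2

/-- Pasting of pullback squares. -/
lemma IsPB.paste {P Q X Y Z W : FinGSet G} {a : P →[G] Q} {b : Q →[G] X} {p : P →[G] W}
    {q : Q →[G] Y} {f : X →[G] Z} {g : Y →[G] Z} {k : W →[G] Y} (h : IsPB b q f g)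
    (h' : IsPB a p q k) : IsPB (b.comp a) p f (g.comp k) :=
  isPB_of (fun w => (h.1 _).trans (congrArg g (h'.1 w))) (fun x y hxy => by
    obtain ⟨u, ⟨hu1, hu2⟩, -⟩ := h.2 x (k y) hxy
    obtain ⟨w, ⟨hw1, hw2⟩, -⟩ := h'.2 u y hu2
    exact ⟨w, (congrArg b hw1).trans hu1, hw2⟩) (fun w w' h1 h2 => by
    refine h'.ext (h.ext h1 ?_) h2
    rw [h'.1, h'.1, h2])

lemma IsPB.paste' {P Q X Y Z W : FinGSet G} {a : P →[G] W} {b : P →[G] Q} {k : W →[G] X}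
    {p : Q →[G] X} {q : Q →[G] Y} {f : X →[G] Z} {g : Y →[G] Z} (h : IsPB p q f g)
    (h' : IsPB a b k p) : IsPB a (q.comp b) (f.comp k) g :=
  (h.symm.paste h'.symm).symm

/-- Cancellation of pullback squares. -/
lemma IsPB.of_paste {P Q X Y Z W : FinGSet G} {a : P →[G] Q} {b : Q →[G] X} {p : P →[G] W}
    {q : Q →[G] Y} {f : X →[G] Z} {g : Y →[G] Z} {k : W →[G] Y} {b' : P →[G] X}
    (h : IsPB b q f g) (h' : IsPB b' p f (g.comp k)) (ha : ∀ w, q (a w) = k (p w))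
    (hb : ∀ w, b (a w) = b' w) : IsPB a p q k :=
  isPB_of ha (fun x y hxy => by
    obtain ⟨w, ⟨hw1, hw2⟩, -⟩ := h'.2 (b x) y (((h.1 x).trans (congrArg g hxy)))
    refine ⟨w, h.ext ?_ ?_, hw2⟩
    · rw [hb, hw1]
    · rw [ha, hw2, hxy]) (fun w w' h1 h2 => h'.ext (by rw [← hb, ← hb, h1]) h2)

/-- An invariant subset. -/
def sub (X : FinGSet G) (s : Set X) (hs : ∀ (c : G) (x : X), x ∈ s → c • x ∈ s) : FinGSet G where
  carrier := s
  action :=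
    { smul := fun c x => ⟨c • x.1, hs c x.1 x.2⟩
      one_smul := fun x => Subtype.ext (one_smul G x.1)
      mul_smul := fun c d x => Subtype.ext (mul_smul c d x.1) }

/-- The inclusion of an invariant subset. -/
def subIncl (X : FinGSet G) (s : Set X) (hs : ∀ (c : G) (x : X), x ∈ s → c • x ∈ s) :
    sub X s hs →[G] X :=
  ⟨Subtype.val, fun _ _ => rfl⟩

/-- The complement of the image of a map. -/
def compl {X Y : FinGSet G} (i : X →[G] Y) : FinGSet G :=
  sub Y (Set.range i)ᶜ (fun c y hy ⟨x, hx⟩ => hy ⟨c⁻¹ • x, by rw [map_smul, hx, inv_smul_smul]⟩)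

/-- The inclusion of the complement of the image of a map. -/
def complIncl {X Y : FinGSet G} (i : X →[G] Y) : compl i →[G] Y := subIncl Y _ _

lemma isCoprod_compl {X Y : FinGSet G} (i : X →[G] Y) (hi : Function.Injective i) :
    IsCoprod i (complIncl i) := by
  constructor
  · rintro (a | a) (b | b) hab
    · exact congrArg _ (hi hab)
    · exact (b.2 ⟨a, hab⟩).elim
    · exact (a.2 ⟨b, hab.symm⟩).elim
    · exact congrArg _ (Subtype.ext hab)
  · intro y
    by_cases h : y ∈ Set.range i
    · obtain ⟨x, rfl⟩ := h
      exact ⟨Sum.inl x, rfl⟩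
    · exact ⟨Sum.inr ⟨y, h⟩, rfl⟩

lemma isCoprod_sum (X Y : FinGSet G) : IsCoprod (inl X Y) (inr X Y) :=
  ⟨fun a b h => by
    rcases a with a | a <;> rcases b with b | b
    · exact congrArg _ (Sum.inl.inj h)
    · cases h
    · cases h
    · exact congrArg _ (Sum.inr.inj h), fun a => ⟨a, by rcases a with a | a <;> rfl⟩⟩

lemma IsCoprod.injective_left {X Y Z : FinGSet G} {i : X →[G] Z} {j : Y →[G] Z}
    (h : IsCoprod i j) : Function.Injective i := fun a b hab =>
  Sum.inl.inj (h.1 (a₁ := Sum.inl a) (a₂ := Sum.inl b) hab)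

lemma IsCoprod.injective_right {X Y Z : FinGSet G} {i : X →[G] Z} {j : Y →[G] Z}
    (h : IsCoprod i j) : Function.Injective j := fun a b hab =>
  Sum.inr.inj (h.1 (a₁ := Sum.inr a) (a₂ := Sum.inr b) hab)

lemma IsCoprod.ne {X Y Z : FinGSet G} {i : X →[G] Z} {j : Y →[G] Z}
    (h : IsCoprod i j) (x : X) (y : Y) : i x ≠ j y := fun hab => by
  cases h.1 (a₁ := Sum.inl x) (a₂ := Sum.inr y) hab

lemma IsCoprod.cases {X Y Z : FinGSet G} {i : X →[G] Z} {j : Y →[G] Z}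
    (h : IsCoprod i j) (z : Z) : (∃ x, i x = z) ∨ ∃ y, j y = z := by
  obtain ⟨x | y, h⟩ := h.2 z
  · exact Or.inl ⟨x, h⟩
  · exact Or.inr ⟨y, h⟩

/-- Transitive `G`-sets. -/
structure IsTransitive (O : FinGSet G) : Prop where
  nonempty : Nonempty O
  exists_smul : ∀ x y : O, ∃ c : G, c • x = y

lemma IsTransitive.hom_ext {O X : FinGSet G} (hO : IsTransitive O) {s t : O →[G] X} (o : O)
    (h : s o = t o) : s = t := by
  ext x
  obtain ⟨c, rfl⟩ := hO.exists_smul o x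
  rw [map_smul, map_smul, h]

/-- Induction on cardinality: the orbit of a point is split off and its complement has fewer
elements. As the step is stated for arbitrary coproduct diagrams, `P` need not be known to be
invariant under isomorphism. -/
lemma orbit_induction {P : FinGSet G → Prop} (h0 : ∀ X : FinGSet G, IsEmpty X → P X)
    (h1 : ∀ (O X Y : FinGSet G) (i : O →[G] Y) (j : X →[G] Y), IsTransitive O → IsCoprod i j →
      P X → P Y) (X : FinGSet G) : P X := by
  induction hn : Nat.card X using Nat.strong_induction_on generalizing X with
  | _ n ih =>
    subst hn
    rcases isEmpty_or_nonempty X with h | ⟨⟨x⟩⟩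
    · exact h0 X h
    · let O := sub X (MulAction.orbit G x) (fun c y hy => MulAction.mem_orbit_of_mem_orbit c hy)
      let i : O →[G] X := subIncl X _ _
      have hi : Function.Injective i := Subtype.val_injective
      have hO : IsTransitive O :=
        ⟨⟨⟨x, MulAction.mem_orbit_self x⟩⟩, fun ⟨_, a, ha⟩ ⟨_, b, hb⟩ =>
          ⟨b * a⁻¹, Subtype.ext (by
            subst ha hb
            change (b * a⁻¹) • a • x = b • x
            rw [smul_smul, inv_mul_cancel_right])⟩⟩
      refine h1 O (compl i) X i (complIncl i) hO (isCoprod_compl i hi) (ih _ ?_ _ rfl)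
      refine Finite.card_subtype_lt (x := x) ?_
      exact fun h => h ⟨⟨x, MulAction.mem_orbit_self x⟩, rfl⟩

/-! ### Exponential diagrams -/

/-- A point of `P` is determined by its image in `Y` and by the section that `e` attaches to it.
Equality of sections is phrased through pairs of points of `E` with the same image in `X`, which
avoids comparing functions on different fibres. -/
lemma IsExponential.ext {X Y A P E : FinGSet G} {f : X →[G] Y} {q : A →[G] X} {π : P →[G] Y}
    {f' : E →[G] P} {r : E →[G] X} {e : E →[G] A} (h : IsExponential f q π f' r e) {w w' : P}
    (h1 : π w = π w')
    (h2 : ∀ t t', f' t = w → f' t' = w' → r t = r t' → e t = e t') : w = w' := by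
  choose t ht using fun x : {x : X // f x = π w'} => (h.isPB.2 x.1 w' x.2).exists
  refine (h.exists_unique_section (π w') (fun x => e (t x)) (fun x => ?_)).unique
    ⟨h1, fun u hu hfu => ?_⟩ ⟨rfl, fun u hu hfu => ?_⟩
  · rw [h.proj_eval, (ht x).1]
  · exact h2 _ _ hu (ht ⟨r u, hfu⟩).2 (ht ⟨r u, hfu⟩).1.symm
  · congr 1
    exact h.isPB.ext (ht ⟨r u, hfu⟩).1.symm (hu.trans (ht ⟨r u, hfu⟩).2.symm)

lemma IsExponential.exists_point {X Y A P E : FinGSet G} {f : X →[G] Y} {q : A →[G] X}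
    {π : P →[G] Y} {f' : E →[G] P} {r : E →[G] X} {e : E →[G] A}
    (h : IsExponential f q π f' r e) (y : Y) (s : {x : X // f x = y} → A)
    (hs : ∀ x, q (s x) = x.1) :
    ∃ w : P, π w = y ∧ ∀ t : E, f' t = w → ∀ h : f (r t) = y, e t = s ⟨r t, h⟩ :=
  (h.exists_unique_section y s hs).exists

/-- Existence and uniqueness of the point representing a section are separated, uniqueness being in
the pointwise form of `IsExponential.ext`. -/
lemma isExponential_of {X Y A P E : FinGSet G} {f : X →[G] Y} {q : A →[G] X} {π : P →[G] Y}
    {f' : E →[G] P} {r : E →[G] X} {e : E →[G] A} (h1 : IsPB r f' f π)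
    (h2 : ∀ t, q (e t) = r t)
    (h3 : ∀ (y : Y) (s : {x : X // f x = y} → A), (∀ x, q (s x) = x.1) →
      ∃ w : P, π w = y ∧ ∀ t : E, f' t = w → ∀ h : f (r t) = y, e t = s ⟨r t, h⟩)
    (h4 : ∀ w w' : P, π w = π w' →
      (∀ t t', f' t = w → f' t' = w' → r t = r t' → e t = e t') → w = w') :
    IsExponential f q π f' r e where
  isPB := h1
  proj_eval := h2
  exists_unique_section y s hs := by
    obtain ⟨w, hw⟩ := h3 y s hs
    refine ⟨w, hw, fun w' hw' => h4 _ _ (hw'.1.trans hw.1.symm) fun t t' ht ht' htt => ?_⟩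
    have e1 : f (r t) = y := by rw [h1.1, ht, hw'.1]
    have e2 : f (r t') = y := by rw [h1.1, ht', hw.1]
    rw [hw'.2 t ht e1, hw.2 t' ht' e2]
    congr 1
    exact Subtype.ext htt

/-- The universal property of the dependent product. -/
lemma IsExponential.exists_classifying {X Y A P E W F : FinGSet G} {f : X →[G] Y} {q : A →[G] X}
    {π : P →[G] Y} {f' : E →[G] P} {r : E →[G] X} {e : E →[G] A}
    (h : IsExponential f q π f' r e) {πW : W →[G] Y} {fW : F →[G] W} {rW : F →[G] X}
    {eW : F →[G] A} (hW : IsPB rW fW f πW) (heW : ∀ t, q (eW t) = rW t) :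
    ∃ u : W →[G] P, (∀ w, π (u w) = πW w) ∧
      ∀ t t', f' t = u (fW t') → r t = rW t' → e t = eW t' := by
  have key : ∀ w, ∃ p, π p = πW w ∧ ∀ t t', f' t = p → fW t' = w → r t = rW t' → e t = eW t' := by
    intro w
    choose t ht using fun x : {x : X // f x = πW w} => (hW.2 x.1 w x.2).exists
    obtain ⟨p, hp1, hp2⟩ := h.exists_point (πW w) (fun x => eW (t x)) (fun x => by
      rw [heW, (ht x).1])
    refine ⟨p, hp1, fun s s' hs hs' hss => ?_⟩
    have e1 : f (r s) = πW w := by rw [h.isPB.1, hs, hp1]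
    rw [hp2 s hs e1]
    congr 1
    exact hW.ext ((ht ⟨r s, e1⟩).1.trans hss) ((ht ⟨r s, e1⟩).2.trans hs'.symm)
  choose u hu1 hu2 using key
  -- Equivariance of `u` is uniqueness of points: `u (c • w)` and `c • u w` have the same section,
  -- as is seen after translating by `c⁻¹`.
  refine ⟨⟨u, fun c w => h.ext ?_ fun t t' ht ht' htt => ?_⟩, hu1, fun t t' ht =>
    hu2 _ _ _ ht rfl⟩
  · rw [hu1, id_eq, map_smul, map_smul, hu1]
  · obtain ⟨s, ⟨hs1, hs2⟩, -⟩ := hW.2 (r t) (c • w) (by rw [h.isPB.1, ht, hu1])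
    rw [hu2 _ _ _ ht hs2 hs1.symm]
    have h1 := hu2 w (c⁻¹ • t') (c⁻¹ • s) (by rw [map_smul, ht', id_eq, inv_smul_smul])
      (by rw [map_smul, hs2, inv_smul_smul])
      (by rw [map_smul, map_smul, hs1, htt])
    rw [map_smul, map_smul] at h1
    exact ((MulAction.injective _) h1).symm

/-- The classifying maps in the two directions are mutually inverse, because a point of a dependent
product is determined by its section. Constructions that choose an exponential diagram are
independent of the choice for this reason. -/
lemma IsExponential.exists_iso {X Y A P E P₂ E₂ : FinGSet G} {f : X →[G] Y} {q : A →[G] X}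
    {π : P →[G] Y} {f' : E →[G] P} {r : E →[G] X} {e : E →[G] A}
    (h : IsExponential f q π f' r e) {π₂ : P₂ →[G] Y}
    {f₂ : E₂ →[G] P₂} {r₂ : E₂ →[G] X} {e₂ : E₂ →[G] A}
    (h₂ : IsExponential f q π₂ f₂ r₂ e₂) :
    ∃ (u : P →[G] P₂) (w : E →[G] E₂), Function.Bijective u ∧ Function.Bijective w ∧
      (∀ p, π₂ (u p) = π p) ∧ (∀ t, f₂ (w t) = u (f' t)) ∧ (∀ t, r₂ (w t) = r t) ∧
      ∀ t, e₂ (w t) = e t := by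
  obtain ⟨u, hu1, hu2⟩ := h₂.exists_classifying h.isPB h.proj_eval
  obtain ⟨u', hu1', hu2'⟩ := h.exists_classifying h₂.isPB h₂.proj_eval
  have hu : Function.Bijective u := by
    refine Function.bijective_iff_has_inverse.2 ⟨u', fun p => h.ext ?_ ?_, fun p => h₂.ext ?_ ?_⟩
    · rw [hu1', hu1]
    · intro t t' ht ht' htt
      obtain ⟨s, ⟨hs1, hs2⟩, -⟩ := h₂.isPB.2 (r t') (u (f' t')) (by rw [h.isPB.1, hu1])
      rw [hu2' t s (by rw [ht, hs2, ht']) (htt.trans hs1.symm), hu2 s t' hs2 hs1]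
    · rw [hu1, hu1']
    · intro t t' ht ht' htt
      obtain ⟨s, ⟨hs1, hs2⟩, -⟩ := h.isPB.2 (r₂ t') (u' (f₂ t')) (by rw [h₂.isPB.1, hu1'])
      rw [hu2 t s (by rw [ht, hs2, ht']) (htt.trans hs1.symm), hu2' s t' hs2 hs1]
  have hc : ∀ t, f (r t) = π₂ (u.comp f' t) := fun t => (h.isPB.1 t).trans (hu1 _).symm
  refine ⟨u, h₂.isPB.lift r (u.comp f') hc, hu, ⟨fun t t' htt => ?_, fun t => ?_⟩, hu1,
    h₂.isPB.lift_snd r (u.comp f') hc, h₂.isPB.lift_fst r (u.comp f') hc, fun t => ?_⟩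
  · refine h.isPB.ext ?_ (hu.1 ?_)
    · rw [← h₂.isPB.lift_fst r (u.comp f') hc, htt, h₂.isPB.lift_fst]
    · have := congrArg f₂ htt
      rwa [h₂.isPB.lift_snd, h₂.isPB.lift_snd] at this
  · obtain ⟨p, hp⟩ := hu.2 (f₂ t)
    obtain ⟨s, ⟨hs1, hs2⟩, -⟩ := h.isPB.2 (r₂ t) p (by rw [h₂.isPB.1, ← hp, hu1])
    refine ⟨s, h₂.isPB.ext ?_ ?_⟩
    · rw [h₂.isPB.lift_fst, hs1]
    · rw [h₂.isPB.lift_snd, ← hp, ← hs2]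
      rfl
  · exact hu2 _ _ (h₂.isPB.lift_snd r (u.comp f') hc t) (h₂.isPB.lift_fst r (u.comp f') hc t)

/-- The dependent product of `q : A → X` along `f : X → Y` and of a composite with `q`. -/
lemma IsExponential.comp_left {X Y A B B' P E P₂ E₂ : FinGSet G} {f : X →[G] Y} {q : A →[G] X}
    {π : P →[G] Y} {f' : E →[G] P} {r : E →[G] X} {e : E →[G] A}
    (h : IsExponential f q π f' r e) {q₂ : B →[G] A} {b : B' →[G] E} {eB : B' →[G] B}
    (hB : IsPB b eB e q₂) {π₂ : P₂ →[G] P} {f₂ : E₂ →[G] P₂} {r₂ : E₂ →[G] E} {e₂ : E₂ →[G] B'}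
    (h₂ : IsExponential f' b π₂ f₂ r₂ e₂) :
    IsExponential f (q.comp q₂) (π.comp π₂) f₂ (r.comp r₂) (eB.comp e₂) := by
  refine isExponential_of (h.isPB.paste h₂.isPB) (fun t => ?_) (fun y s hs => ?_)
    (fun w w' hw hww => ?_)
  · change q (q₂ (eB (e₂ t))) = r (r₂ t)
    rw [← hB.1, h₂.proj_eval, h.proj_eval]
  -- The section of `q ∘ q₂` is first projected to a section of `q`, which is the point `w`; what
  -- remains is a section of `b` over the fibre of `f'` at `w`.
  · obtain ⟨w, hw1, hw2⟩ := h.exists_point y (fun x => q₂ (s x)) hs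
    have h3 : ∀ t : {t : E // f' t = w}, f (r t.1) = y := fun t => by
      rw [h.isPB.1, t.2, hw1]
    choose s' hs' using fun t : {t : E // f' t = w} =>
      (hB.2 t.1 (s ⟨r t.1, h3 t⟩) (hw2 t.1 t.2 (h3 t))).exists
    obtain ⟨w₂, hw₂, hw₂'⟩ := h₂.exists_point w s' (fun t => (hs' t).1)
    refine ⟨w₂, (congrArg π hw₂).trans hw1, fun t ht ht' => ?_⟩
    have h4 : f' (r₂ t) = w := by rw [h₂.isPB.1, ht, hw₂]
    change eB (e₂ t) = _
    rw [hw₂' t ht h4, (hs' ⟨r₂ t, h4⟩).2]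
    rfl
  · have h1 : π₂ w = π₂ w' := by
      refine h.ext hw fun t t' ht ht' htt => ?_
      obtain ⟨s, ⟨hs1, hs2⟩, -⟩ := h₂.isPB.2 t w ht
      obtain ⟨s', ⟨hs1', hs2'⟩, -⟩ := h₂.isPB.2 t' w' ht'
      have h2 : eB (e₂ s) = eB (e₂ s') := hww s s' hs2 hs2' (by
        change r (r₂ s) = r (r₂ s')
        rw [hs1, hs1', htt])
      rw [← hs1, ← hs1', ← h₂.proj_eval, ← h₂.proj_eval, hB.1, hB.1, h2]
    refine h₂.ext h1 fun t t' ht ht' htt => hB.ext ?_ ?_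
    · rw [h₂.proj_eval, h₂.proj_eval, htt]
    · exact hww t t' ht ht' (congrArg r htt)

/-- Dependent products along a composite map. -/
lemma IsExponential.comp_right {X Y Z A P E P₂ E₂ E₃ : FinGSet G} {f : X →[G] Y} {q : A →[G] X}
    {π : P →[G] Y} {f' : E →[G] P} {r : E →[G] X} {e : E →[G] A}
    (h : IsExponential f q π f' r e) {g : Y →[G] Z} {π₂ : P₂ →[G] Z} {g' : E₂ →[G] P₂}
    {r₂ : E₂ →[G] Y} {e₂ : E₂ →[G] P} (h₂ : IsExponential g π π₂ g' r₂ e₂)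
    {k : E₃ →[G] E} {l : E₃ →[G] E₂} (h₃ : IsPB k l f' e₂) :
    IsExponential (g.comp f) q π₂ (g'.comp l) (r.comp k) (e.comp k) := by
  have h12 : ∀ t, f (r (k t)) = r₂ (l t) := fun t => by
    rw [h.isPB.1, h₃.1, h₂.proj_eval]
  refine isExponential_of (isPB_of (fun t => ?_) (fun x w hxw => ?_) fun t t' h1 h2 => ?_)
    (fun t => h.proj_eval _) (fun z s hs => ?_) fun w w' hw hww => ?_
  · exact (congrArg g (h12 t)).trans (h₂.isPB.1 _)
  · obtain ⟨t₂, ⟨h1, h2⟩, -⟩ := h₂.isPB.2 (f x) w hxw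
    obtain ⟨t, ⟨h3, h4⟩, -⟩ := h.isPB.2 x (e₂ t₂) (by rw [h₂.proj_eval, h1])
    obtain ⟨u, ⟨h5, h6⟩, -⟩ := h₃.2 t t₂ h4
    exact ⟨u, (congrArg r h5).trans h3, (congrArg g' h6).trans h2⟩
  · have h3 : l t = l t' := h₂.isPB.ext (by
      rw [← h12, ← h12]
      exact congrArg f h1) h2
    exact h₃.ext (h.isPB.ext h1 (by rw [h₃.1, h₃.1, h3])) h3
  -- A section over the fibre of `g ∘ f` at `z` is a family of sections over the fibres of `f` at
  -- the points `y` of `g⁻¹(z)`. Each of these is a point of `P` over `y`, and together they form a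
  -- section of `π`.
  · have h1 : ∀ y : {y : Y // g y = z}, ∃ p : P, π p = y.1 ∧ ∀ t : E, f' t = p →
        ∀ h : g.comp f (r t) = z, e t = s ⟨r t, h⟩ := by
      rintro ⟨y, rfl⟩
      obtain ⟨p, hp1, hp2⟩ := h.exists_point y (fun x => s ⟨x.1, congrArg g x.2⟩)
        (fun x => hs _)
      refine ⟨p, hp1, fun t ht _ => ?_⟩
      exact hp2 t ht (by rw [h.isPB.1, ht, hp1])
    choose σ hσ1 hσ2 using h1
    obtain ⟨w, hw1, hw2⟩ := h₂.exists_point z σ hσ1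
    refine ⟨w, hw1, fun t ht ht' => ?_⟩
    have h2 : g (r₂ (l t)) = z := by rw [← h12]; exact ht'
    exact hσ2 ⟨_, h2⟩ (k t) ((h₃.1 t).trans (hw2 _ ht h2)) ht'
  · refine h₂.ext hw fun t t' ht ht' htt => h.ext ?_ fun u u' hu hu' huu => ?_
    · rw [h₂.proj_eval, h₂.proj_eval, htt]
    · obtain ⟨v, ⟨h1, h2⟩, -⟩ := h₃.2 u t hu
      obtain ⟨v', ⟨h1', h2'⟩, -⟩ := h₃.2 u' t' hu'
      have := hww v v' ((congrArg g' h2).trans ht) ((congrArg g' h2').trans ht') (by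
        change r (k v) = r (k v')
        rw [h1, h1', huu])
      change e (k v) = e (k v') at this
      rwa [h1, h1'] at this

/-- Base change of dependent products. -/
lemma IsExponential.base_change {X Y A P E X' Y' A' P' E' : FinGSet G} {f : X →[G] Y}
    {q : A →[G] X} {π : P →[G] Y} {f' : E →[G] P} {r : E →[G] X} {e : E →[G] A}
    (h : IsExponential f q π f' r e) {g : Y' →[G] Y} {gX : X' →[G] X} {f₁ : X' →[G] Y'}
    (hX : IsPB gX f₁ f g) {gA : A' →[G] A} {q₁ : A' →[G] X'} (hA : IsPB gA q₁ q gX)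
    {gP : P' →[G] P} {π₁ : P' →[G] Y'} (hP : IsPB gP π₁ π g) {gE : E' →[G] E} {f₁' : E' →[G] P'}
    {r₁ : E' →[G] X'} {e₁ : E' →[G] A'} (hE : IsPB r₁ f₁' f₁ π₁) (h1 : ∀ t, gA (e₁ t) = e (gE t))
    (h2 : ∀ t, q₁ (e₁ t) = r₁ t) (h3 : ∀ t, f' (gE t) = gP (f₁' t)) :
    IsExponential f₁ q₁ π₁ f₁' r₁ e₁ := by
  have h4 : ∀ t, gX (r₁ t) = r (gE t) := fun t => by
    rw [← h2, ← hA.1, h1, h.proj_eval]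
  refine isExponential_of hE h2 (fun y s hs => ?_) fun w w' hw hww => ?_
  -- As `gX` maps `f₁⁻¹(y)` bijectively to `f⁻¹(g y)`, the section `s` can be carried to the latter
  -- fibre. The value is recorded by its characterizing property, so that no inverse of `gX` is
  -- chosen.
  · have hx : ∀ x : {x : X // f x = g y}, ∃ a : A, ∀ x' : {x' // f₁ x' = y}, gX x'.1 = x.1 →
        a = gA (s x') := by
      rintro ⟨x, hx⟩
      obtain ⟨x', ⟨hx1, hx2⟩, -⟩ := hX.2 x y hx
      refine ⟨gA (s ⟨x', hx2⟩), ?_⟩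
      rintro ⟨x'', hx''⟩ hxx
      congr 2
      exact Subtype.ext (hX.ext (hx1.trans hxx.symm) (hx2.trans hx''.symm))
    choose σ hσ using hx
    obtain ⟨p, hp1, hp2⟩ := h.exists_point (g y) σ (by
      rintro ⟨x, hx⟩
      obtain ⟨x', ⟨hx1, hx2⟩, -⟩ := hX.2 x y hx
      rw [hσ ⟨x, hx⟩ ⟨x', hx2⟩ hx1, hA.1, hs, hx1])
    obtain ⟨w, ⟨hw1, hw2⟩, -⟩ := hP.2 p y hp1
    refine ⟨w, hw2, fun t ht ht' => hA.ext ?_ ?_⟩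
    · have h5 : f (r (gE t)) = g y := by rw [← h4, hX.1, ht']
      rw [h1, hp2 (gE t) (by rw [h3, ht, hw1]) h5, hσ ⟨_, h5⟩ ⟨r₁ t, ht'⟩ (h4 t)]
    · rw [h2, hs]
  · refine hP.ext (h.ext ?_ fun t t' ht ht' htt => ?_) hw
    · rw [hP.1, hP.1, hw]
    · obtain ⟨x, ⟨hx1, hx2⟩, -⟩ := hX.2 (r t) (π₁ w) (by rw [h.isPB.1, ht, hP.1])
      obtain ⟨u, ⟨hu1, hu2⟩, -⟩ := hE.2 x w hx2
      obtain ⟨u', ⟨hu1', hu2'⟩, -⟩ := hE.2 x w' (hx2.trans hw)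
      have hg : gE u = t := h.isPB.ext (by rw [← h4, hu1, hx1]) (by rw [h3, hu2, ht])
      have hg' : gE u' = t' := h.isPB.ext (by rw [← h4, hu1', hx1, htt]) (by rw [h3, hu2', ht'])
      rw [← hg, ← hg', ← h1, ← h1, hww u u' hu2 hu2' (hu1.trans hu1'.symm)]

lemma isExponential_id {X A : FinGSet G} (q : A →[G] X) :
    IsExponential (MulActionHom.id G) q q (MulActionHom.id G) q (MulActionHom.id G) :=
  isExponential_of (isPB_id q) (fun _ => rfl)
    (fun x s hs => ⟨s ⟨x, rfl⟩, hs _, fun t ht h => by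
      subst h
      exact ht⟩) fun w w' _ h => h w w' rfl rfl ‹_›

/-- The dependent product of an identity. -/
lemma isExponential_id_right {X Y : FinGSet G} (f : X →[G] Y) :
    IsExponential f (MulActionHom.id G) (MulActionHom.id G) f (MulActionHom.id G)
      (MulActionHom.id G) :=
  isExponential_of (isPB_id f).symm (fun _ => rfl)
    (fun y _ hs => ⟨y, rfl, fun _ _ h => (hs ⟨_, h⟩).symm⟩) fun _ _ h _ => h

open scoped Pointwise in
/-- The dependent product of `q : A → X` along `f : X → Y`: a point over `y` is a subset of `A`
which `q` maps bijectively to the fibre of `f` over `y`. -/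
def dprod {X Y A : FinGSet G} (f : X →[G] Y) (q : A →[G] X) : FinGSet G :=
  sub ⟨Y × Set A⟩ {w | Set.BijOn q w.2 (f ⁻¹' {w.1})} (by
    rintro c ⟨y, σ⟩ ⟨h1, h2, h3⟩
    refine ⟨?_, ?_, ?_⟩
    · rintro _ ⟨a, ha, rfl⟩
      change f (q (c • a)) = c • y
      rw [map_smul, map_smul, h1 ha]
    · rintro _ ⟨a, ha, rfl⟩ _ ⟨a', ha', rfl⟩ haa
      change q (c • a) = q (c • a') at haa
      rw [map_smul, map_smul] at haa
      rw [h2 ha ha' (MulAction.injective _ haa)]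
    · intro x hx
      change f x = c • y at hx
      obtain ⟨a, ha, ha'⟩ := h3 (show f (c⁻¹ • x) = y by rw [map_smul, hx, inv_smul_smul])
      exact ⟨c • a, ⟨a, ha, rfl⟩, by rw [map_smul, ha', smul_inv_smul]⟩)

/-- A section over a fibre is encoded by its image, and evaluation picks the unique point of the
subset above a given point of the fibre. Uniqueness in the choice makes evaluation equivariant. -/
lemma exists_isExponential {X Y A : FinGSet G} (f : X →[G] Y) (q : A →[G] X) :
    ∃ (P E : FinGSet G) (π : P →[G] Y) (f' : E →[G] P) (r : E →[G] X) (e : E →[G] A),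
      IsExponential f q π f' r e := by
  let π : dprod f q →[G] Y := ⟨fun w => w.1.1, fun _ _ => rfl⟩
  have hex : ∀ t : pb f π, ∃ a ∈ t.1.2.1.2, q a = t.1.1 := fun t => t.1.2.2.2.2 t.2
  choose e he1 he2 using hex
  refine ⟨dprod f q, pb f π, π, pbSnd f π, pbFst f π, ⟨e, fun c t => ?_⟩,
    isExponential_of (isPB_pb f π) he2 (fun y s hs => ?_) fun w w' hw hww => ?_⟩
  · refine (c • t).1.2.2.2.1 (he1 _) ⟨e t, he1 t, rfl⟩ ?_
    rw [he2]
    change c • t.1.1 = q (c • e t)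
    rw [map_smul, he2]
  · refine ⟨⟨(y, Set.range s), ?_⟩, rfl, fun t ht ht' => ?_⟩
    · refine ⟨?_, ?_, ?_⟩
      · rintro _ ⟨x, rfl⟩
        change f (q (s x)) = y
        rw [hs, x.2]
      · rintro _ ⟨x, rfl⟩ _ ⟨x', rfl⟩ hxx
        rw [hs, hs] at hxx
        rw [Subtype.ext hxx]
      · intro x hx
        exact ⟨s ⟨x, hx⟩, ⟨_, rfl⟩, hs _⟩
    · have h1 : e t ∈ Set.range s := by
        have := he1 t
        have h2 : t.1.2 = _ := ht
        rw [h2] at this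
        exact this
      obtain ⟨x, hx⟩ := h1
      change e t = _
      rw [← hx]
      congr 1
      refine Subtype.ext ?_
      rw [← hs, hx, he2]
      rfl
  · have hsub : ∀ w w' : dprod f q, π w = π w' →
        (∀ t t', pbSnd f π t = w → pbSnd f π t' = w' → pbFst f π t = pbFst f π t' →
          e t = e t') → w.1.2 ⊆ w'.1.2 := by
      intro w w' hw hww a ha
      have h1 : f (q a) = π w := w.2.1 ha
      let t : pb f π := ⟨(q a, w), h1⟩
      let t' : pb f π := ⟨(q a, w'), h1.trans hw⟩
      have h2 : e t = a := w.2.2.1 (he1 t) ha (he2 t)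
      rw [← h2, hww t t' rfl rfl rfl]
      exact he1 t'
    exact Subtype.ext (Prod.ext hw ((hsub w w' hw hww).antisymm
      (hsub w' w hw.symm fun t t' h1 h2 h3 => (hww t' t h2 h1 h3.symm).symm)))

end

end FinGSet

/-! ### Transfers and restrictions along bijections -/

namespace BurnsideFunctor

section

variable {G : Type} [Group G] (M : BurnsideFunctor.{v} G)

/-- Injectivity suffices: the kernel pair of `f` is then the diagonal, and base change involves only
identities. -/
lemma res_tr_of_bijective {X Y : FinGSet G} (f : X →[G] Y) (hf : Function.Injective f)
    (x : M.obj X) : M.res f (M.tr f x) = x := by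
  rw [M.base_change (MulActionHom.id G) (MulActionHom.id G) f f
    (isPB_of_bijective (fun _ => rfl) Function.bijective_id hf), M.res_id, M.tr_id]

lemma tr_res_of_bijective {X Y : FinGSet G} (f : X →[G] Y) (hf : Function.Bijective f)
    (y : M.obj Y) : M.tr f (M.res f y) = y := by
  rw [← M.base_change f f (MulActionHom.id G) (MulActionHom.id G)
    (isPB_of_bijective (fun _ => rfl) hf Function.injective_id), M.tr_id, M.res_id]

lemma res_injective_of_bijective {X Y : FinGSet G} (f : X →[G] Y) (hf : Function.Bijective f) :
    Function.Injective (M.res f) := fun x y h => by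
  rw [← M.tr_res_of_bijective f hf x, h, M.tr_res_of_bijective f hf]

variable {M}

lemma IsSemiMackey.eq_of_isEmpty (hM : M.IsSemiMackey) {X : FinGSet G} (hX : IsEmpty X)
    (x y : M.obj X) : x = y :=
  (hM.empty X hX).unique trivial trivial

lemma IsSemiMackey.ext (hM : M.IsSemiMackey) {X Y Z : FinGSet G} {i : X →[G] Z} {j : Y →[G] Z}
    (h : IsCoprod i j) {z z' : M.obj Z} (h1 : M.res i z = M.res i z')
    (h2 : M.res j z = M.res j z') : z = z' :=
  (hM.coprod i j h).1 (Prod.ext h1 h2)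

lemma IsSemiMackey.exists_glue (hM : M.IsSemiMackey) {X Y Z : FinGSet G} {i : X →[G] Z}
    {j : Y →[G] Z} (h : IsCoprod i j) (x : M.obj X) (y : M.obj Y) :
    ∃ z, M.res i z = x ∧ M.res j z = y := by
  obtain ⟨z, hz⟩ := (hM.coprod i j h).2 (x, y)
  exact ⟨z, congrArg Prod.fst hz, congrArg Prod.snd hz⟩

/-- Elements are detected by their restrictions to transitive `G`-sets. -/
lemma IsSemiMackey.ext_of_transitive (hM : M.IsSemiMackey) {X : FinGSet G} {x y : M.obj X}
    (h : ∀ (O : FinGSet G) (t : O →[G] X), IsTransitive O → M.res t x = M.res t y) : x = y := by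
  induction X using orbit_induction with
  | h0 X hX => exact hM.eq_of_isEmpty hX x y
  | h1 O X Y i j hO hij ih =>
    refine hM.ext hij (h O i hO) (ih fun O t hO => ?_)
    rw [← M.res_comp, ← M.res_comp, h O _ hO]

end

end BurnsideFunctor

/-! ### Products along locally trivial maps -/

namespace FinGSet

section

variable {G : Type} [Group G]

/-- A map is locally trivial if it preserves stabilizers. -/
def IsLocTriv {X Y : FinGSet G} (f : X →[G] Y) : Prop :=
  ∀ (c : G) (x : X), c • f x = f x → c • x = x

lemma IsLocTriv.comp {X Y Z : FinGSet G} {f : X →[G] Y} {g : Y →[G] Z} (hg : IsLocTriv g)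
    (hf : IsLocTriv f) : IsLocTriv (g.comp f) :=
  fun c x h => hf c x (hg c _ h)

lemma IsLocTriv.of_injective {X Y : FinGSet G} {f : X →[G] Y} (hf : Function.Injective f) :
    IsLocTriv f :=
  fun c x h => hf ((map_smul f c x).trans h)

lemma IsLocTriv.base_change {P X Y Z : FinGSet G} {p : P →[G] X} {q : P →[G] Y} {f : X →[G] Z}
    {g : Y →[G] Z} (h : IsPB p q f g) (hf : IsLocTriv f) : IsLocTriv q := fun c w hw =>
  h.ext (by
    rw [map_smul]
    refine hf c _ ?_
    rw [h.1, ← map_smul, hw]) ((map_smul q c w).trans hw)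

lemma isLocTriv_fold (X : FinGSet G) : IsLocTriv (fold X) := by
  rintro c (x | x) h
  · exact congrArg Sum.inl h
  · exact congrArg Sum.inr h

lemma exists_factor {O X Y : FinGSet G} (j : X →[G] Y) (hj : Function.Injective j) (t : O →[G] Y)
    (h : ∀ o, ∃ x, j x = t o) : ∃ t' : O →[G] X, j.comp t' = t := by
  choose t' ht' using h
  refine ⟨⟨t', fun c o => hj ?_⟩, hom_ext ht'⟩
  rw [ht', id_eq, map_smul, map_smul, ht']

/-- The family `s` consists of lifts of `t` along `f`, and each lift of each point of `t` is in
exactly one of them. -/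
structure IsLifts {O X Y : FinGSet G} (f : X →[G] Y) (t : O →[G] Y) {ι : Type}
    (s : ι → (O →[G] X)) : Prop where
  apply_lift : ∀ i o, f (s i o) = t o
  existsUnique : ∀ o x, f x = t o → ∃! i, s i o = x

lemma IsLifts.comp {O O' X Y : FinGSet G} {f : X →[G] Y} {t : O →[G] Y} {ι : Type}
    {s : ι → (O →[G] X)} (h : IsLifts f t s) (u : O' →[G] O) :
    IsLifts f (t.comp u) (fun i => (s i).comp u) :=
  ⟨fun i o => h.apply_lift i (u o), fun o x hx => h.existsUnique (u o) x hx⟩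

lemma IsLifts.of_base_change {O P X Y Z : FinGSet G} {p : P →[G] X} {q : P →[G] Y} {f : X →[G] Z}
    {g : Y →[G] Z} (h : IsPB p q f g) {t : O →[G] Y} {ι : Type}
    {s : ι → (O →[G] P)} (hs : IsLifts q t s) : IsLifts f (g.comp t) (fun i => p.comp (s i)) := by
  refine ⟨fun i o => (h.1 _).trans (congrArg g (hs.apply_lift i o)), fun o x hx => ?_⟩
  obtain ⟨w, ⟨hw1, hw2⟩, -⟩ := h.2 x (t o) hx
  obtain ⟨i, hi, hi'⟩ := hs.existsUnique o w hw2
  refine ⟨i, (congrArg p hi).trans hw1, fun i' h' => hi' i' (h.ext ?_ ?_)⟩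
  · exact Eq.trans h' hw1.symm
  · rw [hs.apply_lift, hw2]

/-- Lifts are indexed by the fibre over `t o` for a point `o` of the orbit: a point `x` of it
extends by `c • o ↦ c • x`, which is well defined because the stabilizer of `o` fixes `t o`, hence
fixes `x`. -/
lemma exists_isLifts {O X Y : FinGSet G} {f : X →[G] Y} (hf : IsLocTriv f) (t : O →[G] Y)
    (hO : IsTransitive O) : ∃ (ι : Type) (_ : Fintype ι) (s : ι → (O →[G] X)), IsLifts f t s := by
  obtain ⟨o⟩ := hO.nonempty
  choose d hd using hO.exists_smul o
  have key : ∀ (x : X), f x = t o → ∀ c c' : G, c • o = c' • o → c • x = c' • x := by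
    intro x hx c c' h
    have h1 : (c'⁻¹ * c) • x = x := by
      refine hf _ _ ?_
      rw [hx, ← map_smul, mul_smul, h, inv_smul_smul]
    rw [← inv_smul_eq_iff, smul_smul, h1]
  refine ⟨{x : X // f x = t o}, Fintype.ofFinite _, fun x => ⟨fun o' => d o' • x.1, fun c o' => ?_⟩,
    fun x o' => ?_, fun o' x hx => ?_⟩
  · rw [id_eq, smul_smul]
    refine key _ x.2 _ _ ?_
    rw [hd, mul_smul, hd]
  · change f (d o' • x.1) = t o'
    rw [map_smul, x.2, ← map_smul, hd]
  · refine ⟨⟨(d o')⁻¹ • x, ?_⟩, ?_, fun x' hx' => Subtype.ext ?_⟩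
    · rw [map_smul, hx, ← map_smul, inv_smul_eq_iff.2 (hd o').symm]
    · exact smul_inv_smul _ _
    · exact eq_inv_smul_iff.2 hx'

end

end FinGSet

namespace PreGreen

section

variable {G : Type} [Group G] (M : PreGreen.{v} G)

/-- Restriction as a homomorphism. -/
def resHom {X Y : FinGSet G} (f : X →[G] Y) : M.obj Y →* M.obj X where
  toFun := M.res f
  map_one' := M.res_one f
  map_mul' := M.res_mul f

lemma res_prod {X Y : FinGSet G} (f : X →[G] Y) {ι : Type} [Fintype ι] (z : ι → M.obj Y) :
    M.res f (∏ i, z i) = ∏ i, M.res f (z i) :=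
  map_prod (M.resHom f) z Finset.univ

lemma tr_mul_res_of_bijective {X Y : FinGSet G} (f : X →[G] Y) (hf : Function.Bijective f)
    (x y : M.obj X) : M.tr f (x * y) = M.tr f x * M.tr f y := by
  apply M.res_injective_of_bijective f hf
  rw [M.res_mul, M.res_tr_of_bijective f hf.1, M.res_tr_of_bijective f hf.1,
    M.res_tr_of_bijective f hf.1]

lemma tr_one_of_bijective {X Y : FinGSet G} (f : X →[G] Y) (hf : Function.Bijective f) :
    M.tr f 1 = 1 := by
  apply M.res_injective_of_bijective f hf
  rw [M.res_one, M.res_tr_of_bijective f hf.1]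

lemma tr_mul_tr {X Y Z P : FinGSet G} (p : P →[G] X) (q : P →[G] Y) (f : X →[G] Z) (g : Y →[G] Z)
    (h : IsPB p q f g) (x : M.obj X) (y : M.obj Y) :
    M.tr f x * M.tr g y = M.tr (f.comp p) (M.res p x * M.res q y) := by
  rw [← M.frobenius, M.base_change q p g f h.symm, M.mul_tr, ← M.tr_comp]

/-- The element `y` is the product of `z` along the fibres of `f`: its restriction along any map `t`
over which `f` splits is the product of the restrictions of `z` along the lifts of `t`. -/
def IsProdAlong {X Y : FinGSet G} (f : X →[G] Y) (z : M.obj X) (y : M.obj Y) : Prop :=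
  ∀ (O : FinGSet G) (t : O →[G] Y) (ι : Type) [Fintype ι] (s : ι → (O →[G] X)), IsLifts f t s →
    M.res t y = ∏ i, M.res (s i) z

/-- The product of `z` along the fibres of a locally trivial map. -/
noncomputable def prodAlong {X Y : FinGSet G} (f : X →[G] Y) (z : M.obj X) : M.obj Y :=
  @Classical.epsilon _ ⟨1⟩ (M.IsProdAlong f z)

variable {M}

/-- Transitive `O` and one family of lifts for each `t` are enough: maps out of a transitive set
that agree at a point are equal, so any other family of lifts, restricted to a transitive set, is a
reindexing of the given one. -/
lemma isProdAlong_of (hM : M.IsSemiMackey) {X Y : FinGSet G} {f : X →[G] Y} {z : M.obj X}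
    {y : M.obj Y} (h : ∀ (O : FinGSet G) (t : O →[G] Y), IsTransitive O →
      ∃ (ι : Type) (_ : Fintype ι) (s : ι → (O →[G] X)), IsLifts f t s ∧
        M.res t y = ∏ i, M.res (s i) z) : M.IsProdAlong f z y := by
  intro O t ι _ s hs
  refine hM.ext_of_transitive fun O' u hO' => ?_
  obtain ⟨κ, _, r, hr, hy⟩ := h O' (t.comp u) hO'
  obtain ⟨o⟩ := hO'.nonempty
  rw [← M.res_comp, hy, M.res_prod]
  choose e he he' using fun k => hs.existsUnique (u o) (r k o) (hr.apply_lift k o)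
  refine Fintype.prod_bijective e ⟨fun k k' hk => ?_, fun i => ?_⟩ _ _ fun k => ?_
  · refine (hr.existsUnique o (r k' o) (hr.apply_lift _ _)).unique ?_ rfl
    rw [← he, ← he, hk]
  · obtain ⟨k, hk, -⟩ := hr.existsUnique o (s i (u o)) (hs.apply_lift _ _)
    exact ⟨k, (he' k i hk.symm).symm⟩
  · rw [← M.res_comp]
    congr 1
    exact hO'.hom_ext o (he k).symm

/-- Orbit induction on the target. On the split-off orbit the value is the product of the
restrictions of `z` along the lifts of its inclusion, on the rest it is given by induction for the
pulled-back map, and the two are glued. A test map from a transitive set lands in one of the two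
parts. -/
lemma exists_isProdAlong (hM : M.IsSemiMackey) {X Y : FinGSet G} {f : X →[G] Y} (hf : IsLocTriv f)
    (z : M.obj X) : ∃ y, M.IsProdAlong f z y := by
  induction Y using orbit_induction generalizing X with
  | h0 Y hY =>
    exact ⟨1, isProdAlong_of hM fun O t hO => (hY.false (t hO.nonempty.some)).elim⟩
  | h1 O Y' Y i j hO hij ih =>
    obtain ⟨y', hy'⟩ := ih (hf.base_change (isPB_pb f j)) (M.res (pbFst f j) z)
    obtain ⟨ι, _, s, hs⟩ := exists_isLifts hf i hO
    obtain ⟨y, hy1, hy2⟩ := hM.exists_glue hij (∏ k, M.res (s k) z) y'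
    refine ⟨y, isProdAlong_of hM fun O' t hO' => ?_⟩
    obtain ⟨o⟩ := hO'.nonempty
    have hcase : (∃ t' : O' →[G] O, i.comp t' = t) ∨ ∃ t' : O' →[G] Y', j.comp t' = t := by
      rcases hij.cases (t o) with ⟨w, hw⟩ | ⟨w, hw⟩
      · refine Or.inl (exists_factor i hij.injective_left t fun o' => ?_)
        obtain ⟨c, rfl⟩ := hO'.exists_smul o o'
        exact ⟨c • w, by rw [map_smul, map_smul, hw]⟩
      · refine Or.inr (exists_factor j hij.injective_right t fun o' => ?_)
        obtain ⟨c, rfl⟩ := hO'.exists_smul o o'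
        exact ⟨c • w, by rw [map_smul, map_smul, hw]⟩
    rcases hcase with ⟨t', rfl⟩ | ⟨t', rfl⟩
    · refine ⟨ι, inferInstance, _, hs.comp t', ?_⟩
      rw [M.res_comp, hy1, M.res_prod]
      simp only [M.res_comp]
    · obtain ⟨κ, _, r, hr⟩ := exists_isLifts (hf.base_change (isPB_pb f j)) t' hO'
      refine ⟨κ, inferInstance, _, hr.of_base_change (isPB_pb f j), ?_⟩
      rw [M.res_comp, hy2, hy' _ _ _ _ hr]
      simp only [M.res_comp]

lemma isProdAlong_prodAlong (hM : M.IsSemiMackey) {X Y : FinGSet G} {f : X →[G] Y}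
    (hf : IsLocTriv f) (z : M.obj X) : M.IsProdAlong f z (M.prodAlong f z) :=
  Classical.epsilon_spec (exists_isProdAlong hM hf z)

/-- Products along `f` are unique, being prescribed on transitive sets. The value chosen by
`prodAlong` is thus identified by verifying `IsProdAlong`, which is how its formal properties are
obtained. -/
lemma IsProdAlong.eq (hM : M.IsSemiMackey) {X Y : FinGSet G} {f : X →[G] Y}
    (hf : IsLocTriv f) {z : M.obj X} {y : M.obj Y} (h : M.IsProdAlong f z y) :
    M.prodAlong f z = y :=
  hM.ext_of_transitive fun O t hO => by
    obtain ⟨ι, _, s, hs⟩ := exists_isLifts hf t hO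
    rw [h _ _ _ _ hs, isProdAlong_prodAlong hM hf z _ _ _ _ hs]

lemma prodAlong_id (hM : M.IsSemiMackey) {X : FinGSet G} (z : M.obj X) :
    M.prodAlong (MulActionHom.id G) z = z :=
  IsProdAlong.eq hM (IsLocTriv.of_injective Function.injective_id) <|
    isProdAlong_of hM fun O t _ => ⟨Unit, inferInstance, fun _ => t,
      ⟨fun _ _ => rfl, fun _ _ h => ⟨(), h.symm, fun _ _ => rfl⟩⟩, by simp⟩

lemma prodAlong_comp (hM : M.IsSemiMackey) {X Y Z : FinGSet G} {f : X →[G] Y} {g : Y →[G] Z}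
    (hf : IsLocTriv f) (hg : IsLocTriv g) (z : M.obj X) :
    M.prodAlong (g.comp f) z = M.prodAlong g (M.prodAlong f z) := by
  refine IsProdAlong.eq hM (hg.comp hf) (isProdAlong_of hM fun O t hO => ?_)
  obtain ⟨ι, _, s, hs⟩ := exists_isLifts hg t hO
  choose κ hκ r hr using fun i => exists_isLifts hf (s i) hO
  refine ⟨Σ i, κ i, inferInstance, fun w => r w.1 w.2, ⟨fun w o => ?_, fun o x hx => ?_⟩, ?_⟩
  · exact (congrArg g ((hr w.1).apply_lift w.2 o)).trans (hs.apply_lift w.1 o)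
  · obtain ⟨i, hi, hi'⟩ := hs.existsUnique o (f x) hx
    obtain ⟨k, hk, hk'⟩ := (hr i).existsUnique o x hi.symm
    refine ⟨⟨i, k⟩, hk, ?_⟩
    rintro ⟨i', k'⟩ h
    change r i' k' o = x at h
    obtain rfl : i' = i := hi' i' (by
      change s i' o = f x
      rw [← (hr i').apply_lift k', h])
    rw [hk' k' h]
  · rw [isProdAlong_prodAlong hM hg _ _ _ _ _ hs, Fintype.prod_sigma]
    exact Finset.prod_congr rfl fun i _ => isProdAlong_prodAlong hM hf z _ _ _ _ (hr i)

lemma res_prodAlong (hM : M.IsSemiMackey) {P X Y Z : FinGSet G} {p : P →[G] X} {q : P →[G] Y}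
    {f : X →[G] Z} {g : Y →[G] Z} (h : IsPB p q f g) (hf : IsLocTriv f) (z : M.obj X) :
    M.res g (M.prodAlong f z) = M.prodAlong q (M.res p z) := by
  symm
  refine IsProdAlong.eq hM (hf.base_change h) fun O t ι _ s hs => ?_
  rw [← M.res_comp, isProdAlong_prodAlong hM hf z _ _ _ _ (hs.of_base_change h)]
  simp only [M.res_comp]

lemma prodAlong_one (hM : M.IsSemiMackey) {X Y : FinGSet G} {f : X →[G] Y} (hf : IsLocTriv f) :
    M.prodAlong f 1 = 1 :=
  IsProdAlong.eq hM hf fun O t ι _ s _ => by simp only [M.res_one, Finset.prod_const_one]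

lemma prodAlong_mul (hM : M.IsSemiMackey) {X Y : FinGSet G} {f : X →[G] Y} (hf : IsLocTriv f)
    (z w : M.obj X) : M.prodAlong f (z * w) = M.prodAlong f z * M.prodAlong f w :=
  IsProdAlong.eq hM hf fun O t ι _ s hs => by
    rw [M.res_mul, isProdAlong_prodAlong hM hf z _ _ _ _ hs,
      isProdAlong_prodAlong hM hf w _ _ _ _ hs, ← Finset.prod_mul_distrib]
    simp only [M.res_mul]

lemma prodAlong_eq_prod (hM : M.IsSemiMackey) {X Y : FinGSet G} {f : X →[G] Y} (hf : IsLocTriv f)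
    {ι : Type} [Fintype ι] {s : ι → (Y →[G] X)} (hs : IsLifts f (MulActionHom.id G) s)
    (z : M.obj X) : M.prodAlong f z = ∏ i, M.res (s i) z := by
  rw [← isProdAlong_prodAlong hM hf z _ _ _ _ hs, M.res_id]

/-- A product of transfers along maps `A i → O` is a transfer from their fibre product. -/
lemma prod_tr {ι : Type} [Fintype ι] {O P : FinGSet G} {A : ι → FinGSet G} (q : ∀ i, A i →[G] O)
    (π : P →[G] O) (pr : ∀ i, P →[G] A i) (h1 : ∀ i w, q i (pr i w) = π w)
    (h2 : ∀ (o : O) (a : ∀ i, A i), (∀ i, q i (a i) = o) → ∃! w, π w = o ∧ ∀ i, pr i w = a i)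
    (a : ∀ i, M.obj (A i)) :
    ∏ i, M.tr (q i) (a i) = M.tr π (∏ i, M.res (pr i) (a i)) := by
  -- The index type is generalized together with an arbitrary `Fintype` instance, as needed for
  -- induction along `Option`.
  have key : ∀ (ι : Type) [Finite ι], ∀ [Fintype ι] (P : FinGSet G) (A : ι → FinGSet G)
      (q : ∀ i, A i →[G] O)
      (π : P →[G] O) (pr : ∀ i, P →[G] A i) (_ : ∀ i w, q i (pr i w) = π w)
      (_ : ∀ (o : O) (a : ∀ i, A i), (∀ i, q i (a i) = o) → ∃! w, π w = o ∧ ∀ i, pr i w = a i)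
      (a : ∀ i, M.obj (A i)), ∏ i, M.tr (q i) (a i) = M.tr π (∏ i, M.res (pr i) (a i)) := by
    intro ι _
    induction ι using Finite.induction_empty_option with
    | of_equiv e ih =>
      intro _ P A q π pr h1 h2 a
      have := Fintype.ofEquiv _ e.symm
      rw [← e.prod_comp, ← e.prod_comp]
      refine ih P (fun i => A (e i)) (fun i => q (e i)) π (fun i => pr (e i)) (fun i => h1 (e i))
        (fun o a ha => ?_) (fun i => a (e i))
      obtain ⟨w, ⟨hw1, hw2⟩, hw3⟩ := h2 o ((e.piCongrLeft fun i => A i) a) (fun i => by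
        obtain ⟨i, rfl⟩ := e.surjective i
        rw [Equiv.piCongrLeft_apply_apply, ha])
      refine ⟨w, ⟨hw1, fun i => by rw [hw2, Equiv.piCongrLeft_apply_apply]⟩, fun w' hw' =>
        hw3 w' ⟨hw'.1, fun i => ?_⟩⟩
      obtain ⟨i, rfl⟩ := e.surjective i
      rw [hw'.2, Equiv.piCongrLeft_apply_apply]
    | h_empty =>
      intro _ P A q π pr h1 h2 a
      have hπ : Function.Bijective π := by
        refine ⟨fun w w' h => ?_, fun o => ?_⟩
        · exact (h2 (π w') (fun i => i.elim) (fun i => i.elim)).unique ⟨h, fun i => i.elim⟩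
            ⟨rfl, fun i => i.elim⟩
        · obtain ⟨w, hw, -⟩ := h2 o (fun i => i.elim) (fun i => i.elim)
          exact ⟨w, hw.1⟩
      simp only [Finset.univ_eq_empty, Finset.prod_empty, M.tr_one_of_bijective π hπ]
    | @h_option ι _ ih =>
      intro inst P A q π pr h1 h2 a
      -- The fibre product over `O` of all factors except `none`; then `P` is the pullback of this
      -- and `A none`.
      let P' : FinGSet G := sub ⟨O × ∀ i : ι, A (some i)⟩ {w | ∀ i, q (some i) (w.2 i) = w.1}
        (fun c w hw i => (map_smul (q (some i)) c (w.2 i)).trans (congrArg (c • ·) (hw i)))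
      let π' : P' →[G] O := ⟨fun w => w.1.1, fun _ _ => rfl⟩
      let pr' : ∀ i : ι, P' →[G] A (some i) := fun i => ⟨fun w => w.1.2 i, fun _ _ => rfl⟩
      let u : P →[G] P' := ⟨fun w => ⟨(π w, fun i => pr (some i) w), fun i => h1 _ _⟩,
        fun c w => Subtype.ext (Prod.ext (map_smul π c w) (funext fun i =>
          map_smul (pr (some i)) c w))⟩
      have hu : IsPB u (pr none) π' (q none) := by
        refine isPB_of (fun w => (h1 none w).symm) (fun x y hxy => ?_) fun w w' hw hw' => ?_
        · obtain ⟨w, ⟨hw1, hw2⟩, -⟩ := h2 (π' x) (fun i => Option.rec y x.1.2 i) (fun i => by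
            cases i with
            | none => exact hxy.symm
            | some i => exact x.2 i)
          exact ⟨w, Subtype.ext (Prod.ext hw1 (funext fun i => hw2 (some i))), hw2 none⟩
        · refine (h2 (π w') (fun i => pr i w') (fun i => h1 i w')).unique
            ⟨congrArg (fun u => u.1.1) hw, fun i => ?_⟩ ⟨rfl, fun _ => rfl⟩
          cases i with
          | none => exact hw'
          | some i => exact congrFun (congrArg (fun u => u.1.2) hw) i
      have := Fintype.ofFinite ι
      have ih' := ih P' (fun i => A (some i)) (fun i => q (some i)) π' pr' (fun i w => w.2 i)
        (fun o a ha => ⟨⟨(o, a), ha⟩, ⟨rfl, fun _ => rfl⟩, fun w hw =>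
          Subtype.ext (Prod.ext hw.1 (funext hw.2))⟩) (fun i => a (some i))
      have hprod : ∀ {N : Type v} [CommMonoid N] (f : Option ι → N),
          ∏ i, f i = f none * ∏ i, f (some i) := fun f => by
        rw [Subsingleton.elim inst instFintypeOption]
        exact Fintype.prod_option f
      rw [hprod, hprod, ih', mul_comm, M.tr_mul_tr u (pr none) π' (q none) hu, mul_comm,
        M.res_prod]
      simp only [← M.res_comp]
      rfl
  exact key ι P A q π pr h1 h2 a

/-- Products along locally trivial maps distribute over transfers. -/
lemma prodAlong_tr (hM : M.IsSemiMackey) {X Y A P E : FinGSet G} {f : X →[G] Y} {q : A →[G] X}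
    {π : P →[G] Y} {f' : E →[G] P} {r : E →[G] X} {e : E →[G] A} (hf : IsLocTriv f)
    (h : IsExponential f q π f' r e) (a : M.obj A) :
    M.prodAlong f (M.tr q a) = M.tr π (M.prodAlong f' (M.res e a)) := by
  refine IsProdAlong.eq hM hf (isProdAlong_of hM fun O t hO => ?_)
  obtain ⟨ι, _, s, hs⟩ := exists_isLifts hf t hO
  refine ⟨ι, inferInstance, s, hs, ?_⟩
  have hl : ∀ i (w : pb π t), f ((s i).comp (pbSnd π t) w) = π (pbFst π t w) := fun i w =>
    (hs.apply_lift i _).trans w.2.symm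
  let s' : ι → (pb π t →[G] E) := fun i => h.isPB.lift ((s i).comp (pbSnd π t)) (pbFst π t) (hl i)
  have hs1 : ∀ i w, r (s' i w) = s i (pbSnd π t w) := fun i => h.isPB.lift_fst _ _ (hl i)
  have hs2 : ∀ i w, f' (s' i w) = pbFst π t w := fun i => h.isPB.lift_snd _ _ (hl i)
  have hs' : IsLifts f' (pbFst π t) s' := by
    refine ⟨hs2, fun w x hx => ?_⟩
    obtain ⟨i, hi, hi'⟩ := hs.existsUnique (pbSnd π t w) (r x) (by rw [h.isPB.1, hx]; exact w.2)
    refine ⟨i, h.isPB.ext ((hs1 i w).trans hi) ((hs2 i w).trans hx.symm), fun i' h' => hi' i' ?_⟩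
    change s' i' w = x at h'
    rw [← h', hs1]
  rw [M.base_change _ _ _ _ (isPB_pb π t),
    isProdAlong_prodAlong hM (hf.base_change h.isPB) _ _ _ _ _ hs']
  have hb : ∀ i, M.res (s i) (M.tr q a) =
      M.tr (pbSnd q (s i)) (M.res (pbFst q (s i)) a) := fun i =>
    M.base_change _ _ _ _ (isPB_pb q (s i)) a
  simp only [hb]
  have hq : ∀ i (w : pb π t), q (e.comp (s' i) w) = s i (pbSnd π t w) := fun i w =>
    (h.proj_eval _).trans (hs1 i w)
  let pr : ∀ i, pb π t →[G] pb q (s i) := fun i =>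
    (isPB_pb q (s i)).lift (e.comp (s' i)) (pbSnd π t) (hq i)
  have hpr1 : ∀ i w, pbFst q (s i) (pr i w) = e (s' i w) := fun i =>
    (isPB_pb q (s i)).lift_fst _ _ (hq i)
  have hpr2 : ∀ i w, pbSnd q (s i) (pr i w) = pbSnd π t w := fun i =>
    (isPB_pb q (s i)).lift_snd _ _ (hq i)
  rw [prod_tr (fun i => pbSnd q (s i)) (pbSnd π t) pr hpr2]
  · congr 1
    refine Finset.prod_congr rfl fun i _ => ?_
    rw [← M.res_comp, ← M.res_comp]
    congr 1
    exact hom_ext fun w => (hpr1 i w).symm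
  -- The lifts enumerate the fibre of `f` over `t o`, so a compatible family of points of the
  -- pullbacks of `A` is the same as a section of `q` over that fibre, that is, a point of `P`.
  · intro o b hb
    choose k hk hk' using fun x : {x : X // f x = t o} => hs.existsUnique o x.1 x.2
    obtain ⟨p, hp1, hp2⟩ := h.exists_point (t o) (fun x => pbFst q (s (k x)) (b (k x)))
      (fun x => by
        rw [(isPB_pb q (s (k x))).1, hb, hk])
    obtain ⟨w₀, ⟨hw1, hw2⟩, -⟩ := (isPB_pb π t).2 p o hp1
    refine ⟨w₀, ⟨hw2, fun i => (isPB_pb q (s i)).ext ?_ ?_⟩, fun w hw => (isPB_pb π t).ext ?_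
      (hw.1.trans hw2.symm)⟩
    · have h3 : f (r (s' i w₀)) = t o := by rw [hs1, hs.apply_lift, hw2]
      have h4 : i = k ⟨_, h3⟩ := hk' ⟨_, h3⟩ i
        ((congrArg (s i) hw2).symm.trans (hs1 i w₀).symm)
      rw [hpr1, hp2 _ ((hs2 i _).trans hw1) h3]
      exact (congrArg (fun j => pbFst q (s j) (b j)) h4).symm
    · rw [hpr2, hb, hw2]
    · refine h.ext ?_ fun u u' hu hu' huu => ?_
      · rw [hw1, hp1, (isPB_pb π t).1, hw.1]
      · have h3 : f (r u') = t o := by rw [h.isPB.1, hu', hw1, hp1]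
        rw [hp2 u' (hu'.trans hw1) h3]
        have h4 : u = s' (k ⟨_, h3⟩) w := h.isPB.ext (by
          rw [hs1, hw.1, huu]
          exact (hk ⟨_, h3⟩).symm) (hu.trans (hs2 _ _).symm)
        rw [← hw.2, hpr1, ← h4]

/-- Only restrictions and finite products occur in the characterization, and morphisms preserve
both. -/
lemma IsProdAlong.map {N : PreGreen.{v} G} (φ : M ⟶ N) {X Y : FinGSet G} {f : X →[G] Y}
    {z : M.obj X} {y : M.obj Y} (h : M.IsProdAlong f z y) :
    N.IsProdAlong f (φ.app X z) (φ.app Y y) := by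
  intro O t ι _ s hs
  rw [← φ.app_res, h _ _ _ _ hs]
  refine (map_prod (⟨⟨φ.app O, φ.app_one O⟩, φ.app_mul O⟩ : M.obj O →* N.obj O) _ _).trans ?_
  exact Finset.prod_congr rfl fun i _ => φ.app_res _ _

end

end PreGreen

/-! ### Negatives -/

/-- Multiply `1 + y = 0` by `x`: Frobenius reciprocity carries the factor through the transfers that
define sums and zeros. -/
lemma PreGreen.exists_neg_of_one {G : Type} [Group G] {M : PreGreen.{v} G}
    (h : ∀ X, ∃ y s : M.obj X, M.IsSum 1 y s ∧ M.IsZero s) (X : FinGSet G) (x : M.obj X) :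
    ∃ y s : M.obj X, M.IsSum x y s ∧ M.IsZero s := by
  obtain ⟨y, s, ⟨z, hz1, hz2, hz3⟩, E, hE, u, e, hs⟩ := h X
  refine ⟨x * y, x * s, ⟨M.res (fold X) x * z, ?_, ?_, ?_⟩, E, hE, u, M.res u x * e, ?_⟩
  · rw [M.res_mul, ← M.res_comp, hz1, mul_one]
    exact M.res_id x
  · rw [M.res_mul, ← M.res_comp, hz2]
    exact congrArg (· * y) (M.res_id x)
  · rw [← M.mul_tr, hz3]
  · rw [← M.mul_tr, hs]

/-! ### Maps along which there are norms -/

section HasNorm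

variable {G : Type} [CommGroup G] {C : Subgroup G}

lemma HasNorm.comp {X Y Z : FinGSet G} {f : X →[G] Y} {g : Y →[G] Z} (hg : HasNorm C g)
    (hf : HasNorm C f) : HasNorm C (g.comp f) := by
  rintro z c ⟨hc, hz⟩ x rfl
  exact hf (f x) c ⟨hc, hg _ c ⟨hc, hz⟩ (f x) rfl⟩ x rfl

lemma HasNorm.base_change {P X Y Z : FinGSet G} {p : P →[G] X} {q : P →[G] Y} {f : X →[G] Z}
    {g : Y →[G] Z} (hf : HasNorm C f) (h : IsPB p q f g) : HasNorm C q := by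
  rintro y c ⟨hc, hy⟩ w rfl
  refine h.ext ?_ ((map_smul q c w).trans hy)
  rw [map_smul]
  refine hf _ c ⟨hc, ?_⟩ (p w) (h.1 w)
  exact (map_smul g c _).symm.trans (congrArg g hy)

lemma hasNorm_of_isLocTriv {X Y : FinGSet G} {f : X →[G] Y} (hf : IsLocTriv f) :
    HasNorm C f := by
  rintro y c ⟨-, hy⟩ x rfl
  exact hf c x hy

lemma hasNorm_of_injective {X Y : FinGSet G} {f : X →[G] Y} (hf : Function.Injective f) :
    HasNorm C f :=
  hasNorm_of_isLocTriv (IsLocTriv.of_injective hf)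

lemma hasNorm_id (X : FinGSet G) : HasNorm C (MulActionHom.id G : X →[G] X) :=
  hasNorm_of_injective Function.injective_id

lemma hasNorm_fold (X : FinGSet G) : HasNorm C (fold X) :=
  hasNorm_of_isLocTriv (isLocTriv_fold X)

lemma HasNorm.of_comp {X Y Z : FinGSet G} {f : X →[G] Y} {g : Y →[G] Z}
    (h : HasNorm C (g.comp f)) : HasNorm C f := by
  rintro y c ⟨hc, hy⟩ x rfl
  exact h (g (f x)) c ⟨hc, (map_smul g c (f x)).symm.trans (congrArg g hy)⟩ x rfl

lemma actHom_bijective (g : G) (X : FinGSet G) : Function.Bijective (actHom g X) :=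
  MulAction.bijective g

lemma isPB_actHom (g : G) {X Y : FinGSet G} (f : X →[G] Y) :
    IsPB (actHom g X) f f (actHom g Y) :=
  (isPB_of_bijective (fun w => (map_smul f g w).symm) (actHom_bijective g X)
    (actHom_bijective g Y).1).symm

lemma BurnsideFunctor.tr_actHom (M : BurnsideFunctor.{v} G) (g : G) {X : FinGSet G}
    (x : M.obj X) : M.tr (actHom g X) x = M.res (actHom g⁻¹ X) x := by
  have h : (actHom g⁻¹ X).comp (actHom g X) = MulActionHom.id G :=
    hom_ext fun w => inv_smul_smul g w
  apply M.res_injective_of_bijective _ (actHom_bijective g X)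
  rw [M.res_tr_of_bijective _ (actHom_bijective g X).1, ← M.res_comp, h, M.res_id]

end HasNorm

/-- Incomplete Tambara functors, without the requirement that the underlying functor is a Mackey
functor. -/
structure PreTamb (G : Type) [CommGroup G] (C : Subgroup G) extends PreGreen.{v} G where
  norm : ∀ {X Y : FinGSet G} (f : X →[G] Y), HasNorm C f → obj X → obj Y
  norm_id : ∀ {X : FinGSet G} (h : HasNorm C (MulActionHom.id G : X →[G] X)) (x : obj X),
    norm (MulActionHom.id G) h x = x
  norm_comp : ∀ {X Y Z : FinGSet G} (f : X →[G] Y) (g : Y →[G] Z) (hf : HasNorm C f)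
    (hg : HasNorm C g) (hgf : HasNorm C (g.comp f)) (x : obj X),
    norm (g.comp f) hgf x = norm g hg (norm f hf x)
  norm_base_change : ∀ {P X Y Z : FinGSet G} (p : P →[G] X) (q : P →[G] Y) (f : X →[G] Z)
    (g : Y →[G] Z) (hf : HasNorm C f) (hq : HasNorm C q), IsPB p q f g → ∀ x : obj X,
    res g (norm f hf x) = norm q hq (res p x)
  norm_empty : ∀ {E X : FinGSet G} (u : E →[G] X) (hu : HasNorm C u), IsEmpty E →
    ∀ e : obj E, norm u hu e = 1
  norm_fold : ∀ {X : FinGSet G} (h : HasNorm C (fold X)) (z : obj (sum X X)),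
    norm (fold X) h z = res (inl X X) z * res (inr X X) z
  norm_tr : ∀ {X Y A P E : FinGSet G} (f : X →[G] Y) (q : A →[G] X) (π : P →[G] Y)
    (f' : E →[G] P) (r : E →[G] X) (e : E →[G] A) (hf : HasNorm C f) (hf' : HasNorm C f'),
    IsExponential f q π f' r e → ∀ a : obj A, norm f hf (tr q a) = tr π (norm f' hf' (res e a))

/-! ### Formal consequences of the Tambara axioms. -/

namespace PreTamb

section

variable {G : Type} [CommGroup G] {C : Subgroup G} (M : PreTamb.{v} G C)

lemma norm_congr {X Y : FinGSet G} {f f' : X →[G] Y} (h : f = f') (hf : HasNorm C f)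
    (hf' : HasNorm C f') (x : M.obj X) : M.norm f hf x = M.norm f' hf' x := by
  subst h
  rfl

lemma res_norm_of_injective {X Y : FinGSet G} (f : X →[G] Y) (hf : Function.Injective f)
    (h : HasNorm C f) (x : M.obj X) : M.res f (M.norm f h x) = x := by
  rw [M.norm_base_change (MulActionHom.id G) (MulActionHom.id G) f f h (hasNorm_id X)
    (isPB_of_bijective (fun _ => rfl) Function.bijective_id hf), M.res_id, M.norm_id]

lemma norm_eq_tr {X Y : FinGSet G} (f : X →[G] Y) (hf : Function.Bijective f)
    (h : HasNorm C f) (x : M.obj X) : M.norm f h x = M.tr f x := by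
  apply M.res_injective_of_bijective f hf
  rw [M.res_norm_of_injective f hf.1, M.res_tr_of_bijective f hf.1]

/-- Norms from the empty set are `1`, so the unit at `X` is itself such a norm and functoriality
applies. -/
lemma norm_one {X Y : FinGSet G} (f : X →[G] Y) (h : HasNorm C f) : M.norm f h 1 = 1 := by
  let u : FinGSet.empty G →[G] X := ⟨fun a => PEmpty.elim a, fun _ a => PEmpty.elim a⟩
  have hE : IsEmpty (FinGSet.empty G) := inferInstanceAs (IsEmpty PEmpty)
  have hu : HasNorm C u := fun _ _ _ a => PEmpty.elim a
  rw [← M.norm_empty u hu hE 1, ← M.norm_comp u f hu h (h.comp hu), M.norm_empty _ _ hE]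

/-- After identifying `Z` with `X ⨿ Y`, the map `f` is the fold map of `W` composed with `f i ⨿ f
j`, and the norm along a fold map is a product. -/
lemma norm_of_isCoprod {X Y Z W : FinGSet G} {i : X →[G] Z} {j : Y →[G] Z} (hij : IsCoprod i j)
    (f : Z →[G] W) (hf : HasNorm C f) (hi : HasNorm C (f.comp i)) (hj : HasNorm C (f.comp j))
    (z : M.obj Z) :
    M.norm f hf z = M.norm (f.comp i) hi (M.res i z) * M.norm (f.comp j) hj (M.res j z) := by
  let e : sum X Y →[G] Z := ⟨Sum.elim i j, fun c a => by
    rcases a with a | a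
    · exact map_smul i c a
    · exact map_smul j c a⟩
  have he : Function.Bijective e := hij
  let k : sum X Y →[G] sum W W := ⟨Sum.map (f.comp i) (f.comp j), fun c a => by
    rcases a with a | a
    · exact congrArg Sum.inl (map_smul (f.comp i) c a)
    · exact congrArg Sum.inr (map_smul (f.comp j) c a)⟩
  have hk : f.comp e = (fold W).comp k := hom_ext fun a => by rcases a with a | a <;> rfl
  have hfe : HasNorm C (f.comp e) := hf.comp (hasNorm_of_injective he.1)
  have hk' : HasNorm C k := (hk ▸ hfe).of_comp
  have h1 : IsPB (inl X Y) (f.comp i) k (inl W W) := isPB_of (fun _ => rfl) (fun x y hxy => by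
    rcases x with x | x
    · exact ⟨x, rfl, Sum.inl.inj hxy⟩
    · cases hxy) (fun _ _ h _ => Sum.inl.inj h)
  have h2 : IsPB (inr X Y) (f.comp j) k (inr W W) := isPB_of (fun _ => rfl) (fun x y hxy => by
    rcases x with x | x
    · cases hxy
    · exact ⟨x, rfl, Sum.inr.inj hxy⟩) (fun _ _ h _ => Sum.inr.inj h)
  rw [← M.tr_res_of_bijective e he z, ← M.norm_eq_tr e he (hasNorm_of_injective he.1),
    ← M.norm_comp e f _ hf hfe, M.norm_congr hk hfe ((hasNorm_fold W).comp hk'),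
    M.norm_comp k (fold W) hk' (hasNorm_fold W), M.norm_fold,
    M.norm_base_change _ _ _ _ hk' hi h1, M.norm_base_change _ _ _ _ hk' hj h2,
    M.norm_eq_tr e he, M.tr_res_of_bijective e he, ← M.res_comp, ← M.res_comp]
  rfl

/-- The product axiom is a consequence of the norms. Applied to the identity of `Z`,
`norm_of_isCoprod` recovers an element from its two restrictions; conversely `(x, y)` is realized by
the product of the norms of `x` and `y` along the inclusions. For the functors constructed below
only negatives remain to be checked. -/
lemma isSemiMackey : M.toBurnsideFunctor.IsSemiMackey where
  empty X hX := ⟨1, trivial, fun x _ => by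
    rw [← M.norm_id (hasNorm_id X) x, M.norm_empty _ _ hX]⟩
  coprod {X Y Z} i j hij := by
    have hi : HasNorm C i := hasNorm_of_injective hij.injective_left
    have hj : HasNorm C j := hasNorm_of_injective hij.injective_right
    have hE : IsEmpty (FinGSet.empty G) := inferInstanceAs (IsEmpty PEmpty)
    let uX : FinGSet.empty G →[G] X := ⟨fun a => PEmpty.elim a, fun _ a => PEmpty.elim a⟩
    let uY : FinGSet.empty G →[G] Y := ⟨fun a => PEmpty.elim a, fun _ a => PEmpty.elim a⟩
    have hu : HasNorm C uX := fun _ _ _ a => PEmpty.elim a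
    have hu' : HasNorm C uY := fun _ _ _ a => PEmpty.elim a
    have h1 : IsPB uX uY i j := isPB_of (fun a => PEmpty.elim a)
      (fun x y hxy => (hij.ne x y hxy).elim) (fun a => PEmpty.elim a)
    constructor
    · intro z z' h
      have key : ∀ z : M.obj Z, z = M.norm i hi (M.res i z) * M.norm j hj (M.res j z) := fun z =>
        (M.norm_id (hasNorm_id Z) z).symm.trans (M.norm_of_isCoprod hij _ _ hi hj z)
      rw [key z, key z']
      exact congrArg₂ (· * ·) (congrArg (M.norm i hi) (congrArg Prod.fst h))
        (congrArg (M.norm j hj) (congrArg Prod.snd h))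
    · rintro ⟨x, y⟩
      refine ⟨M.norm i hi x * M.norm j hj y, Prod.ext ?_ ?_⟩
      · change M.res i _ = x
        rw [M.res_mul, M.res_norm_of_injective i hij.injective_left,
          M.norm_base_change _ _ _ _ hj hu h1.symm, M.norm_empty _ _ hE, mul_one]
      · change M.res j _ = y
        rw [M.res_mul, M.res_norm_of_injective j hij.injective_right,
          M.norm_base_change _ _ _ _ hi hu' h1, M.norm_empty _ _ hE, one_mul]

/-- Glue the two elements to one on `X ⨿ X` and compute its norm along `f ∘ fold` in two ways. -/
lemma norm_mul {X Y : FinGSet G} (f : X →[G] Y) (h : HasNorm C f) (x y : M.obj X) :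
    M.norm f h (x * y) = M.norm f h x * M.norm f h y := by
  obtain ⟨z, rfl, rfl⟩ := M.isSemiMackey.exists_glue (isCoprod_sum X X) x y
  rw [← M.norm_fold (hasNorm_fold X), ← M.norm_comp _ _ _ h (h.comp (hasNorm_fold X)),
    M.norm_of_isCoprod (isCoprod_sum X X) _ _ h h]
  rfl

lemma norm_tr_actHom {X Y : FinGSet G} (f : X →[G] Y) (h : HasNorm C f) (g : G) (x : M.obj X) :
    M.norm f h (M.tr (actHom g X) x) = M.tr (actHom g Y) (M.norm f h x) := by
  rw [M.tr_actHom, M.tr_actHom, M.norm_base_change _ _ _ _ h h (isPB_actHom g⁻¹ f)]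

/-- The norm along a map which splits is a product. -/
lemma norm_eq_prod {ι : Type} [Fintype ι] {O P : FinGSet G} (q : P →[G] O) (hq : HasNorm C q)
    {s : ι → (O →[G] P)} (hs : IsLifts q (MulActionHom.id G) s) (z : M.obj P) :
    M.norm q hq z = ∏ i, M.res (s i) z := by
  have key : ∀ (ι : Type) [Finite ι], ∀ [Fintype ι] (P : FinGSet G) (q : P →[G] O)
      (hq : HasNorm C q) (s : ι → (O →[G] P)) (_ : IsLifts q (MulActionHom.id G) s)
      (z : M.obj P), M.norm q hq z = ∏ i, M.res (s i) z := by
    intro ι _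
    induction ι using Finite.induction_empty_option with
    | of_equiv e ih =>
      intro _ P q hq s hs z
      have := Fintype.ofEquiv _ e.symm
      rw [← e.prod_comp]
      refine ih P q hq (fun i => s (e i)) ⟨fun i => hs.apply_lift (e i), fun o x hx => ?_⟩ z
      obtain ⟨i, hi, hi'⟩ := hs.existsUnique o x hx
      obtain ⟨i, rfl⟩ := e.surjective i
      exact ⟨i, hi, fun i' h => e.injective (hi' _ h)⟩
    | h_empty =>
      intro _ P q hq s hs z
      simp only [Finset.univ_eq_empty, Finset.prod_empty]
      refine M.norm_empty _ _ ⟨fun x => ?_⟩ _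
      obtain ⟨i, -⟩ := hs.existsUnique (q x) x rfl
      exact i.elim
    | @h_option ι _ ih =>
      intro inst P q hq s hs z
      have := Fintype.ofFinite ι
      have hprod : ∀ {N : Type v} [CommMonoid N] (f : Option ι → N),
          ∏ i, f i = f none * ∏ i, f (some i) := fun f => by
        rw [Subsingleton.elim inst instFintypeOption]
        exact Fintype.prod_option f
      -- The section indexed by `none` splits a copy of `O` off `P`; the other sections land in the
      -- complement, to which induction applies.
      have hinj : Function.Injective (s none) := fun o o' h => by
        have := congrArg q h
        rwa [hs.apply_lift, hs.apply_lift] at this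
      have hc := isCoprod_compl (s none) hinj
      have hfac : ∀ i : ι, ∃ t, (complIncl (s none)).comp t = s (some i) := fun i =>
        exists_factor _ hc.injective_right _ fun o => by
          rcases hc.cases (s (some i) o) with ⟨o', h⟩ | h
          · have h1 : o' = o := by
              have := congrArg q h
              rwa [hs.apply_lift, hs.apply_lift] at this
            subst h1
            have := (hs.existsUnique _ _ (hs.apply_lift (some i) o')).unique h rfl
            cases this
          · exact h
      choose t ht using hfac
      have hid : q.comp (s none) = MulActionHom.id G := hom_ext fun o => hs.apply_lift none o
      have hn : HasNorm C (q.comp (complIncl (s none))) :=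
        hq.comp (hasNorm_of_injective hc.injective_right)
      rw [M.norm_of_isCoprod hc q hq (hq.comp (hasNorm_of_injective hinj)) hn, hprod,
        M.norm_congr hid _ (hasNorm_id O), M.norm_id, ih _ _ hn t ⟨?_, ?_⟩]
      · simp only [← M.res_comp, ht]
      · intro i o
        have := hs.apply_lift (some i) o
        rw [← ht] at this
        exact this
      · intro o x hx
        obtain ⟨i, hi, hi'⟩ := hs.existsUnique o (complIncl (s none) x) hx
        rcases i with _ | i
        · exact (hc.ne o x hi).elim
        · refine ⟨i, hc.injective_right ?_, fun i' h => Option.some.inj (hi' (some i') ?_)⟩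
          · rw [← hi, ← ht]
            rfl
          · change s (some i') o = _
            rw [← ht, ← h]
            rfl
  exact key ι P q hq s hs z

lemma res_norm_eq_prod {ι : Type} [Fintype ι] {O X Y : FinGSet G} (f : X →[G] Y)
    (hf : HasNorm C f) {t : O →[G] Y} {s : ι → (O →[G] X)} (hs : IsLifts f t s) (z : M.obj X) :
    M.res t (M.norm f hf z) = ∏ i, M.res (s i) z := by
  have hl : ∀ i o, f (s i o) = t (MulActionHom.id G o) := hs.apply_lift
  have h := isPB_pb f t
  rw [M.norm_base_change _ _ _ _ hf (hf.base_change h) h,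
    M.norm_eq_prod _ _ (s := fun i => h.lift (s i) (MulActionHom.id G) (hl i)) ⟨?_, ?_⟩]
  · refine Finset.prod_congr rfl fun i _ => ?_
    rw [← M.res_comp]
    congr 1
    exact hom_ext fun o => h.lift_fst _ _ (hl i) o
  · exact fun i o => h.lift_snd _ _ (hl i) o
  · intro o x hx
    have hx' : pbSnd f t x = o := hx
    obtain ⟨i, hi, hi'⟩ := hs.existsUnique o (pbFst f t x) (by rw [h.1, hx'])
    refine ⟨i, h.ext ((h.lift_fst _ _ (hl i) o).trans hi)
      ((h.lift_snd _ _ (hl i) o).trans hx'.symm), fun i' h' => hi' i' ?_⟩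
    change h.lift (s i') (MulActionHom.id G) (hl i') o = x at h'
    rw [← h', h.lift_fst]

/-- An incomplete Tambara functor from one without the requirement of being a Mackey functor. -/
def toOTamb (h : ∀ X, ∃ y s : M.obj X, M.IsSum 1 y s ∧ M.IsZero s) : OTamb.{v} G C :=
  { M with
    isMackey := { M.isSemiMackey with exists_neg := PreGreen.exists_neg_of_one h } }

end

end PreTamb

/-- Forget that an incomplete Tambara functor is a Mackey functor. -/
abbrev OTamb.toPreTamb {G : Type} [CommGroup G] {C : Subgroup G} (M : OTamb.{v} G C) :
    PreTamb.{v} G C :=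
  { M with }

lemma OTamb.norm_eq_tr {G : Type} [CommGroup G] {C : Subgroup G} (S : OTamb.{v} G C)
    {X Y : FinGSet G} (f : X →[G] Y) (hf : Function.Bijective f) (h : HasNorm C f) (x : S.obj X) :
    S.norm f h x = S.tr f x :=
  S.toPreTamb.norm_eq_tr f hf h x

lemma OTamb.norm_one {G : Type} [CommGroup G] {C : Subgroup G} (S : OTamb.{v} G C)
    {X Y : FinGSet G} (f : X →[G] Y) (h : HasNorm C f) : S.norm f h 1 = 1 :=
  S.toPreTamb.norm_one f h

lemma OTamb.norm_mul {G : Type} [CommGroup G] {C : Subgroup G} (S : OTamb.{v} G C)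
    {X Y : FinGSet G} (f : X →[G] Y) (h : HasNorm C f) (x y : S.obj X) :
    S.norm f h (x * y) = S.norm f h x * S.norm f h y :=
  S.toPreTamb.norm_mul f h x y

/-! ### `G`-sets over `G/C` and `C`-sets -/

section Fib

variable {G : Type} [CommGroup G] [Finite G] {C : Subgroup G}

/-- The base point of `G/C`. -/
def orbit.base (C : Subgroup G) : orbit C := QuotientGroup.mk (1 : G)

lemma orbit.smul_base (c : C) : (c : G) • orbit.base C = orbit.base C :=
  QuotientGroup.eq.2 (by simp)

lemma orbit.exists_smul_base (y : orbit C) : ∃ x : G, y = x • orbit.base C := by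
  obtain ⟨x, rfl⟩ := QuotientGroup.mk_surjective y
  exact ⟨x, congrArg QuotientGroup.mk (mul_one x).symm⟩

lemma orbit.mem_of_smul_base {x : G} (h : x • orbit.base C = orbit.base C) : x ∈ C := by
  have := QuotientGroup.eq.1 h
  simpa using this

/-- The fibre over the base point of a `G`-set over `G/C`, a `C`-set. -/
def fib {D : FinGSet G} (c : D →[G] orbit C) : FinGSet C where
  carrier := {d : D // c d = orbit.base C}
  action :=
    { smul := fun x d => ⟨(x : G) • d.1, by rw [map_smul, d.2, orbit.smul_base]⟩
      one_smul := fun d => Subtype.ext (one_smul G d.1)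
      mul_smul := fun x y d => Subtype.ext (mul_smul (x : G) (y : G) d.1) }

/-- The map on fibres. -/
def fib.map {D D' : FinGSet G} {c : D →[G] orbit C} {c' : D' →[G] orbit C} (k : D' →[G] D)
    (hk : ∀ d, c (k d) = c' d) : fib c' →[C] fib c :=
  ⟨fun d => ⟨k d.1, (hk d.1).trans d.2⟩, fun x d => Subtype.ext (map_smul k (x : G) d.1)⟩

/-- Every point of a `G`-set over `G/C` is a translate of a point of the fibre. -/
lemma fib.exists_smul {D : FinGSet G} (c : D →[G] orbit C) (d : D) :
    ∃ (x : G) (d₀ : fib c), d = x • d₀.1 := by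
  obtain ⟨x, hx⟩ := orbit.exists_smul_base (c d)
  exact ⟨x, ⟨x⁻¹ • d, by rw [map_smul, hx, inv_smul_smul]⟩, (smul_inv_smul x d).symm⟩

lemma fib.hom_ext {D X : FinGSet G} (c : D →[G] orbit C) {f f' : D →[G] X}
    (h : ∀ d : fib c, f d.1 = f' d.1) (d : D) : f d = f' d := by
  obtain ⟨x, d₀, rfl⟩ := fib.exists_smul c d
  rw [map_smul, map_smul, h]

lemma fib.isPB {P X Y Z : FinGSet G} {p : P →[G] X} {q : P →[G] Y} {f : X →[G] Z} {g : Y →[G] Z}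
    {cP : P →[G] orbit C} {cX : X →[G] orbit C} {cY : Y →[G] orbit C} {cZ : Z →[G] orbit C}
    (h : IsPB p q f g) (hp : ∀ w, cX (p w) = cP w) (hq : ∀ w, cY (q w) = cP w)
    (hf : ∀ w, cZ (f w) = cX w) (hg : ∀ w, cZ (g w) = cY w) :
    IsPB (fib.map p hp) (fib.map q hq) (fib.map f hf) (fib.map g hg) := by
  refine isPB_of (fun w => Subtype.ext (h.1 w.1)) (fun x y hxy => ?_) fun w w' h1 h2 =>
    Subtype.ext (h.ext (congrArg Subtype.val h1) (congrArg Subtype.val h2))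
  obtain ⟨w, ⟨h1, h2⟩, -⟩ := h.2 x.1 y.1 (congrArg Subtype.val hxy)
  exact ⟨⟨w, by rw [← hp, h1, x.2]⟩, Subtype.ext h1, Subtype.ext h2⟩

/-- The fibre of `f` over a point of `fib cY` lies entirely in `fib cX`, so the sections over it are
the same for `G`-sets and for `C`-sets. -/
lemma fib.isExponential {X Y A P E : FinGSet G} {f : X →[G] Y} {q : A →[G] X} {π : P →[G] Y}
    {f' : E →[G] P} {r : E →[G] X} {e : E →[G] A} {cX : X →[G] orbit C} {cY : Y →[G] orbit C}
    {cA : A →[G] orbit C} {cP : P →[G] orbit C} {cE : E →[G] orbit C}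
    (h : IsExponential f q π f' r e) (hf : ∀ w, cY (f w) = cX w) (hq : ∀ w, cX (q w) = cA w)
    (hπ : ∀ w, cY (π w) = cP w) (hf' : ∀ w, cP (f' w) = cE w) (hr : ∀ w, cX (r w) = cE w)
    (he : ∀ w, cA (e w) = cE w) :
    IsExponential (fib.map f hf) (fib.map q hq) (fib.map π hπ) (fib.map f' hf') (fib.map r hr)
      (fib.map e he) := by
  refine isExponential_of (fib.isPB h.isPB _ _ _ _) (fun t => Subtype.ext (h.proj_eval t.1))
    (fun y s hs => ?_) (fun w w' hw hww => Subtype.ext (h.ext (congrArg Subtype.val hw)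
      fun t t' ht ht' htt => ?_))
  · have hX : ∀ x : {x : X // f x = y.1}, cX x.1 = orbit.base C := fun x => by
      rw [← hf, x.2, y.2]
    obtain ⟨w, hw1, hw2⟩ := h.exists_point y.1
      (fun x => (s ⟨⟨x.1, hX x⟩, Subtype.ext x.2⟩).1) (fun x => congrArg Subtype.val (hs _))
    refine ⟨⟨w, by rw [← hπ, hw1, y.2]⟩, Subtype.ext hw1, fun t ht ht' => ?_⟩
    exact Subtype.ext (hw2 t.1 (congrArg Subtype.val ht) (congrArg Subtype.val ht'))
  · have h1 : cE t = orbit.base C := by rw [← hf', ht, w.2]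
    have h2 : cE t' = orbit.base C := by rw [← hf', ht', w'.2]
    exact congrArg Subtype.val (hww ⟨t, h1⟩ ⟨t', h2⟩ (Subtype.ext ht) (Subtype.ext ht')
      (Subtype.ext htt))

/-- In the `C`-set of points over the base point, stabilizers have the form `C ∩ K`, and these act
trivially on the fibres of an admissible map. Over `G/C`, admissible norms thus reduce to products
over fibres, which every commutative Green functor for `C` has: this is what the indexing system is
chosen for. -/
lemma HasNorm.isLocTriv_fib {D D' : FinGSet G} {c : D →[G] orbit C} {c' : D' →[G] orbit C}
    {k : D' →[G] D} (h : HasNorm C k) (hk : ∀ d, c (k d) = c' d) : IsLocTriv (fib.map k hk) :=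
  fun x d hx => Subtype.ext (h (k d.1) x ⟨x.2, congrArg Subtype.val hx⟩ d.1 rfl)

lemma hasNorm_pair {D B : FinGSet G} {h : D →[G] B} (hh : HasNorm C h) (c : D →[G] orbit C) :
    HasNorm C (FinGSet.pair h c) := by
  rintro y x ⟨hx, hy⟩ d rfl
  exact hh (h d) x ⟨hx, congrArg Prod.fst hy⟩ d rfl

/-- As `G` is abelian, `C` acts trivially on `G/C`. Norms along this projection are the ones that
`N_C^G` adds to `R`. -/
lemma hasNorm_fst (B : FinGSet G) : HasNorm C (fst B (orbit C)) := by
  rintro y x ⟨hx, hy⟩ ⟨b, o⟩ rfl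
  refine Prod.ext hy ?_
  obtain ⟨z, rfl⟩ := orbit.exists_smul_base o
  change x • z • orbit.base C = z • orbit.base C
  rw [smul_comm, orbit.smul_base ⟨x, hx⟩]

/-- The projection of an induced `G`-set to `G/C`. -/
def indStr (T : FinGSet C) : ind C T →[G] orbit C where
  toFun := Quotient.lift (fun a => QuotientGroup.mk a.1) (by
    rintro ⟨x, t⟩ _ ⟨c, rfl⟩
    exact QuotientGroup.eq.2 (by simp))
  map_smul' := by
    rintro x ⟨y, t⟩
    rfl

lemma indStr_mk {T : FinGSet C} (x : G) (t : T) : indStr T (ind.mk x t) = x • orbit.base C :=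
  congrArg QuotientGroup.mk (mul_one x).symm

lemma indStr_map {T U : FinGSet C} (f : T →[C] U) (a : ind C T) :
    indStr U (ind.map f a) = indStr T a := by
  obtain ⟨x, t, rfl⟩ := ind.exists_rep a
  rfl

/-- The isomorphism of a `C`-set with the fibre of the induced `G`-set. -/
def fibInd (T : FinGSet C) : T →[C] fib (indStr T) :=
  ⟨fun t => ⟨ind.mk 1 t, rfl⟩, fun c t => Subtype.ext (by
    change ind.mk 1 (c • t) = ind.mk ((c : G) * 1) t
    rw [← ind.mk_mul, one_mul, mul_one])⟩

lemma ind.mk_injective {T : FinGSet C} (x : G) : Function.Injective (ind.mk (T := T) x) := by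
  intro t t' h
  obtain ⟨c, hc, rfl⟩ := ind.mk_eq_iff.1 h
  have : c = 1 := by
    refine Subtype.ext ?_
    simpa using hc.symm
  rw [this, one_smul]

lemma fibInd_bijective (T : FinGSet C) : Function.Bijective (fibInd T) := by
  constructor
  · exact fun t t' h => ind.mk_injective 1 (congrArg Subtype.val h)
  · rintro ⟨a, ha⟩
    obtain ⟨x, t, rfl⟩ := ind.exists_rep a
    rw [indStr_mk] at ha
    refine ⟨(⟨x, orbit.mem_of_smul_base ha⟩ : C) • t, Subtype.ext ?_⟩
    change ind.mk 1 _ = ind.mk x t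
    rw [← ind.mk_mul, one_mul]

/-- The isomorphism of the `G`-set induced from the fibre with a `G`-set over `G/C`. -/
def indFib {D : FinGSet G} (c : D →[G] orbit C) : ind C (fib c) →[G] D where
  toFun := Quotient.lift (fun a => a.1 • a.2.1) (by
    rintro ⟨x, t⟩ _ ⟨y, rfl⟩
    change x • t.1 = (x * (y : G)⁻¹) • (y : G) • t.1
    rw [smul_smul, inv_mul_cancel_right])
  map_smul' := by
    rintro x ⟨y, t⟩
    exact mul_smul x y t.1

lemma indFib_mk {D : FinGSet G} (c : D →[G] orbit C) (x : G) (d : fib c) :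
    indFib c (ind.mk x d) = x • d.1 := rfl

lemma indFib_bijective {D : FinGSet G} (c : D →[G] orbit C) : Function.Bijective (indFib c) := by
  constructor
  · intro a b hab
    obtain ⟨x, s, rfl⟩ := ind.exists_rep a
    obtain ⟨y, t, rfl⟩ := ind.exists_rep b
    rw [indFib_mk, indFib_mk] at hab
    have h : t.1 = (y⁻¹ * x) • s.1 := by rw [mul_smul, hab, inv_smul_smul]
    have hm : y⁻¹ * x ∈ C := orbit.mem_of_smul_base (by
      rw [← s.2, ← map_smul, ← h, t.2, s.2])
    refine ind.mk_eq_iff.2 ⟨⟨y⁻¹ * x, hm⟩, ?_, Subtype.ext h⟩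
    simp
  · intro d
    obtain ⟨x, d₀, rfl⟩ := fib.exists_smul c d
    exact ⟨ind.mk x d₀, rfl⟩

lemma indFib_str {D : FinGSet G} (c : D →[G] orbit C) (a : ind C (fib c)) :
    c (indFib c a) = indStr _ a := by
  obtain ⟨x, d, rfl⟩ := ind.exists_rep a
  rw [indFib_mk, map_smul, d.2, indStr_mk]

lemma indFib_map {D D' : FinGSet G} {c : D →[G] orbit C} {c' : D' →[G] orbit C} (k : D' →[G] D)
    (hk : ∀ d, c (k d) = c' d) (a : ind C (fib c')) :
    indFib c (ind.map (fib.map k hk) a) = k (indFib c' a) := by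
  obtain ⟨x, d, rfl⟩ := ind.exists_rep a
  exact (map_smul k x d.1).symm

/-- The map from an induced `G`-set to a `G`-set over `G/C` adjoint to a map of `C`-sets. -/
def indDesc {T : FinGSet C} {D : FinGSet G} {c : D →[G] orbit C} (f : T →[C] fib c) :
    ind C T →[G] D :=
  (indFib c).comp (ind.map f)

lemma indDesc_mk {T : FinGSet C} {D : FinGSet G} {c : D →[G] orbit C} (f : T →[C] fib c)
    (x : G) (t : T) : indDesc f (ind.mk x t) = x • (f t).1 := rfl

lemma indDesc_str {T : FinGSet C} {D : FinGSet G} {c : D →[G] orbit C} (f : T →[C] fib c)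
    (a : ind C T) : c (indDesc f a) = indStr T a :=
  (indFib_str c _).trans (indStr_map f a)

lemma fib_map_indDesc_fibInd {T : FinGSet C} {D : FinGSet G} {c : D →[G] orbit C}
    (f : T →[C] fib c) : (fib.map (indDesc f) (indDesc_str f)).comp (fibInd T) = f :=
  FinGSet.hom_ext fun t => Subtype.ext (one_smul G (f t).1)

/-- The map of `G`-sets over `G/C` determined by its restriction to fibres. -/
noncomputable def fib.extend {D D' : FinGSet G} {c : D →[G] orbit C} {c' : D' →[G] orbit C}
    (f : fib c' →[C] fib c) : D' →[G] D :=
  (indDesc f).comp (inv (indFib c') (indFib_bijective c'))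

lemma fib.extend_smul {D D' : FinGSet G} {c : D →[G] orbit C} {c' : D' →[G] orbit C}
    (f : fib c' →[C] fib c) (x : G) (d : fib c') : fib.extend f (x • d.1) = x • (f d).1 := by
  have h : inv (indFib c') (indFib_bijective c') (x • d.1) = ind.mk x d :=
    inv_apply (indFib c') (indFib_bijective c') (ind.mk x d)
  exact congrArg (indDesc f) h

lemma fib.extend_str {D D' : FinGSet G} {c : D →[G] orbit C} {c' : D' →[G] orbit C}
    (f : fib c' →[C] fib c) (d : D') : c (fib.extend f d) = c' d := by
  obtain ⟨x, d₀, rfl⟩ := fib.exists_smul c' d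
  rw [fib.extend_smul, map_smul, map_smul, (f d₀).2, d₀.2]

end Fib

/-- `E` matters only as a pullback, so another model of it may be used; in particular `P × G/C` when
`f` is the projection `B × G/C → B`. -/
lemma FinGSet.IsExponential.of_isPB {G : Type} [Group G] {X Y A P E E₂ : FinGSet G} {f : X →[G] Y}
    {q : A →[G] X} {π : P →[G] Y} {f' : E →[G] P} {r : E →[G] X} {e : E →[G] A}
    (h : IsExponential f q π f' r e) {f₂ : E₂ →[G] P} {r₂ : E₂ →[G] X} (h₂ : IsPB r₂ f₂ f π)
    {e₂ : E₂ →[G] A} (u : E₂ →[G] E) (hf : ∀ t, f' (u t) = f₂ t) (hr : ∀ t, r (u t) = r₂ t)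
    (he : ∀ t, e (u t) = e₂ t) : IsExponential f q π f₂ r₂ e₂ := by
  have hu : ∀ t, ∃ t', u t' = t := fun t => by
    obtain ⟨t', ⟨h1, h3⟩, -⟩ := h₂.2 (r t) (f' t) (h.isPB.1 t)
    exact ⟨t', h.isPB.ext (by rw [hr, h1]) (by rw [hf, h3])⟩
  refine isExponential_of h₂ (fun t => by rw [← he, h.proj_eval, hr]) (fun y s hs => ?_)
    fun w w' hw hww => h.ext hw fun t t' ht ht' htt => ?_
  · obtain ⟨w, hw1, hw2⟩ := h.exists_point y s hs
    refine ⟨w, hw1, fun t ht ht' => ?_⟩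
    rw [← he, hw2 (u t) ((hf t).trans ht) (by rw [hr, ht'])]
    congr 1
    exact Subtype.ext (hr t)
  · obtain ⟨t, rfl⟩ := hu t
    obtain ⟨t', rfl⟩ := hu t'
    rw [he, he]
    exact hww t t' ((hf t).symm.trans ht) ((hf t').symm.trans ht')
      ((hr t).symm.trans (htt.trans (hr t')))

lemma FinGSet.snd_prodMap {G : Type} [Group G] {X Y : FinGSet G} (f : X →[G] Y) (Z : FinGSet G)
    (w : prod X Z) : snd Y Z (prodMap f (MulActionHom.id G) w) = snd X Z w := rfl

lemma FinGSet.snd_pair {G : Type} [Group G] {W X Y : FinGSet G} (a : W →[G] X) (b : W →[G] Y)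
    (w : W) : snd X Y (FinGSet.pair a b w) = b w := rfl

/-! ### Elements of the norm -/

section NormClass

variable {G : Type} [CommGroup G] [Finite G] {C : Subgroup G}

/-- The point of the fibre of `B × G/C` given by a point of `B`. -/
def fibPt (C : Subgroup G) {B : FinGSet G} (b : B) : fib (snd B (orbit C)) :=
  ⟨(b, orbit.base C), rfl⟩

/-- The map `B → F_C(G, T)` adjoint to the identity of the `C`-set underlying `B`. -/
def coindUnit (C : Subgroup G) (B : FinGSet G) : B →[G] coind (fib (snd B (orbit C))) :=
  ⟨fun b => ⟨fun x => fibPt C (x • b), fun c x => Subtype.ext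
    (Prod.ext (mul_smul (c : G) x b) (orbit.smul_base c).symm)⟩, fun g b =>
    Subtype.ext (funext fun x => Subtype.ext (Prod.ext (smul_smul x g b) rfl))⟩

/-- The map of `C`-sets adjoint to a map to a coinduced `G`-set. -/
def coindAdj {T : FinGSet C} {B : FinGSet G} (a : B →[G] coind T) :
    fib (snd B (orbit C)) →[C] T :=
  ⟨fun w => (a w.1.1).1 1, fun c w => by
    have h1 : a ((c : G) • w.1.1) = (c : G) • a w.1.1 := map_smul a _ _
    change (a ((c : G) • w.1.1)).1 1 = c • (a w.1.1).1 1
    rw [h1, ← (a w.1.1).2]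
    change (a w.1.1).1 (1 * c) = _
    rw [one_mul, mul_one]⟩

/-- The fibre of `B × G/C` is a model of the `C`-set underlying `B`. This and the next lemma say
that `coindAdj` is transposition for the adjunction between restriction and coinduction, with unit
`coindUnit`. -/
lemma coindAdj_unit (B : FinGSet G) : coindAdj (coindUnit C B) = MulActionHom.id C :=
  FinGSet.hom_ext fun w => Subtype.ext (Prod.ext (one_smul G w.1.1) w.2.symm)

lemma map_coindAdj_comp_unit {T : FinGSet C} {B : FinGSet G} (a : B →[G] coind T) :
    (coind.map (coindAdj a)).comp (coindUnit C B) = a :=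
  FinGSet.hom_ext fun b => Subtype.ext (funext fun x => by
    change (a (x • b)).1 1 = (a b).1 x
    rw [map_smul]
    exact congrArg (a b).1 (one_mul x))

namespace PreGreen

variable (R : PreGreen.{v + 1} C)

/-- The element of the norm at `B` given by an element at the `C`-set underlying `B`. -/
def nmBase {B : FinGSet G} (m : R.obj (fib (snd B (orbit C)))) : (R.norm G).obj B :=
  NormRep.cls ⟨fib (snd B (orbit C)), B, coindUnit C B, MulActionHom.id G, m⟩

/-- The map `a` is `coindUnit` followed by the coinduction of its transpose, and the restriction
relation moves the transpose onto `m`. Hence `T` can always be taken to be the `C`-set underlying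
`B`. -/
lemma cls_eq_tr_nmBase {X B : FinGSet G} {T : FinGSet C} (a : B →[G] coind T) (b : B →[G] X)
    (m : R.obj T) : NormRep.cls (⟨T, B, a, b, m⟩ : NormRep R.toBurnsideFunctor X) =
      (R.norm G).tr b (R.nmBase (R.res (coindAdj a) m)) :=
  (NormRep.cls_res (coindAdj a) (MulActionHom.id G) Function.bijective_id _ _ a b
    (fun w => DFunLike.congr_fun (map_coindAdj_comp_unit a) w) (fun _ => rfl) _ m rfl).symm

lemma exists_eq_tr_nmBase {X : FinGSet G} (z : (R.norm G).obj X) :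
    ∃ (B : FinGSet G) (b : B →[G] X) (m : R.obj (fib (snd B (orbit C)))),
      z = (R.norm G).tr b (R.nmBase m) := by
  obtain ⟨ρ, rfl⟩ := Quot.exists_rep z
  exact ⟨_, _, _, R.cls_eq_tr_nmBase ρ.a ρ.b ρ.m⟩

lemma res_nmBase {B B' : FinGSet G} (f : B' →[G] B) (m : R.obj (fib (snd B (orbit C)))) :
    (R.norm G).res f (R.nmBase m) =
      R.nmBase (R.res (fib.map (prodMap f (MulActionHom.id G)) (snd_prodMap f _)) m) := by
  let e : B' →[G] pb (MulActionHom.id G) f :=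
    (isPB_pb (MulActionHom.id G) f).lift f (MulActionHom.id G) (fun _ => rfl)
  have he1 : ∀ w, pbFst (MulActionHom.id G) f (e w) = f w := IsPB.lift_fst _ _ _ _
  have he2 : ∀ w, pbSnd (MulActionHom.id G) f (e w) = w := IsPB.lift_snd _ _ _ _
  refine (NormRep.cls_res (fib.map (prodMap f (MulActionHom.id G)) (snd_prodMap f _)) e
    ⟨fun w w' h => ?_, fun w => ⟨pbSnd _ _ w, ?_⟩⟩ _ _ _ _ (fun w => ?_) (fun w => (he2 w).symm)
    _ _ rfl).symm
  · rw [← he2 w, h, he2]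
  · refine (isPB_pb _ _).ext ((he1 _).trans w.2.symm) (he2 _)
  · refine Subtype.ext (funext fun x => Subtype.ext (Prod.ext ?_ rfl))
    change f (x • w) = x • pbFst (MulActionHom.id G) f (e w)
    rw [he1, map_smul]

lemma nmBase_one (B : FinGSet G) : R.nmBase (B := B) 1 = 1 :=
  NormRep.cls_res (toPt _) (MulActionHom.id G : B →[G] B) Function.bijective_id _ _ _ _
    (fun _ => rfl) (fun _ => rfl) _ _ (R.res_one _).symm

lemma nmBase_mul {B : FinGSet G} (m m' : R.obj (fib (snd B (orbit C)))) :
    R.nmBase (m * m') = R.nmBase m * R.nmBase m' := by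
  let e : B →[G] pb (MulActionHom.id G : B →[G] B) (MulActionHom.id G) :=
    ⟨fun w => ⟨(w, w), rfl⟩, fun _ _ => rfl⟩
  refine NormRep.cls_res (FinGSet.pair (MulActionHom.id C) (MulActionHom.id C)) e
    ⟨fun w w' h => congrArg (fun u => u.1.1) h, fun w => ⟨w.1.1, Subtype.ext
      (Prod.ext rfl w.2)⟩⟩ _ _ _ _ (fun _ => rfl) (fun _ => rfl) _ _ ?_
  rw [R.res_ext]
  exact (congrArg₂ (· * ·) (R.res_id m) (R.res_id m')).symm

/-- The exponential diagram attached to the span defining the coinduction of a transfer. -/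
lemma isExponential_of_isPB_coind {T T' : FinGSet C} {f : T →[C] T'} {B P : FinGSet G}
    {a : B →[G] coind T'} {p : P →[G] coind T} {q : P →[G] B} (h : IsPB p q (coind.map f) a) :
    ∃ e₀ : fib (snd P (orbit C)) →[C] pb (coindAdj a) f,
      (pbSnd (coindAdj a) f).comp e₀ = coindAdj p ∧
      IsExponential (fst B (orbit C)) (indDesc (pbFst (coindAdj a) f)) q (fst P (orbit C))
        (prodMap q (MulActionHom.id G)) (fib.extend ((fibInd _).comp e₀)) := by
  have h0 := isPB_pb (coindAdj a) f
  let q' : fib (snd P (orbit C)) →[C] fib (snd B (orbit C)) :=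
    fib.map (prodMap q (MulActionHom.id G)) (fun _ => rfl)
  have hc : ∀ w, coindAdj a (q' w) = f (coindAdj p w) := fun w =>
    (congrFun (congrArg Subtype.val (h.1 w.1.1)) 1).symm
  let e₀ := h0.lift q' (coindAdj p) hc
  have he1 : ∀ w, pbFst (coindAdj a) f (e₀ w) = q' w := h0.lift_fst q' (coindAdj p) hc
  have he2 : ∀ w, pbSnd (coindAdj a) f (e₀ w) = coindAdj p w := h0.lift_snd q' (coindAdj p) hc
  -- Evaluation over the coset of `x`: translate to the base point by `x⁻¹`, evaluate there,
  -- translate back.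
  have hext : ∀ (x : G) (w : P), fib.extend ((fibInd _).comp e₀) (w, x • orbit.base C) =
      ind.mk x (e₀ (fibPt C (x⁻¹ • w))) := fun x w => by
    have h1 : ((w, x • orbit.base C) : prod P (orbit C)) =
        x • ((x⁻¹ • w, orbit.base C) : prod P (orbit C)) :=
      Prod.ext (smul_inv_smul x w).symm rfl
    rw [h1]
    refine (fib.extend_smul ((fibInd _).comp e₀) x (fibPt C (x⁻¹ • w))).trans ?_
    exact congrArg (fun y => ind.mk y _) (mul_one x)
  refine ⟨e₀, FinGSet.hom_ext he2, isExponential_of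
    (isPB_of (fun _ => rfl) (fun x y hxy => ⟨(y, x.2), Prod.ext hxy.symm rfl, rfl⟩)
      fun w w' h1 h2 => Prod.ext h2 (congrArg (fun u => u.2) h1)) ?_ ?_ ?_⟩
  · rintro ⟨w, o⟩
    obtain ⟨x, rfl⟩ := orbit.exists_smul_base o
    rw [hext, indDesc_mk, he1]
    refine Prod.ext ?_ rfl
    change x • q (x⁻¹ • w) = q w
    rw [map_smul, smul_inv_smul]
  · intro y s hs
    -- A section over `{y} × G/C` has, over the coset of each `x`, a value of the form `ind.mk x (t
    -- x)`. Then `x ↦ t x⁻¹` is `C`-equivariant, and its component in `T` is the required point of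
    -- the coinduced set.
    have hex : ∀ x : G, ∃ t : pb (coindAdj a) f,
        s ⟨(y, x • orbit.base C), rfl⟩ = ind.mk x t := fun x => by
      obtain ⟨x', t, ht⟩ := ind.exists_rep (s ⟨(y, x • orbit.base C), rfl⟩)
      have h1 := congrArg (fun u => u.2) (hs ⟨(y, x • orbit.base C), rfl⟩)
      rw [ht] at h1
      have h2 : x' • orbit.base C = x • orbit.base C := by
        rw [← indStr_mk x' t, ← indDesc_str (pbFst (coindAdj a) f)]
        exact h1
      have h3 : x⁻¹ * x' ∈ C := orbit.mem_of_smul_base (by rw [mul_smul, h2, inv_smul_smul])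
      refine ⟨(⟨_, h3⟩ : C) • t, ht.trans ?_⟩
      rw [← ind.mk_mul]
      simp
    choose t ht using hex
    have ht1 : ∀ x, (pbFst (coindAdj a) f (t x)).1.1 = x⁻¹ • y := fun x => by
      have h1 := congrArg (fun u => u.1) (hs ⟨(y, x • orbit.base C), rfl⟩)
      rw [ht] at h1
      have h2 : x • (pbFst (coindAdj a) f (t x)).1.1 = y := h1
      rw [← h2, inv_smul_smul]
    have ht2 : ∀ (c : C) (x : G), t (c * x)⁻¹ = c • t x⁻¹ := fun c x => by
      refine ind.mk_injective (c * x : G)⁻¹ ?_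
      rw [← ind.mk_mul, ← ht]
      have h1 : (((c : G) * x)⁻¹ * c : G) = x⁻¹ := by
        rw [mul_comm (c : G) x, mul_inv_rev, mul_comm, mul_inv_cancel_left]
      rw [h1, ← ht]
      congr 3
      rw [mul_inv_rev, mul_smul, ← Subgroup.coe_inv, orbit.smul_base]
    let φ : coind T := ⟨fun x => pbSnd (coindAdj a) f (t x⁻¹), fun c x => by
      dsimp only
      rw [ht2, map_smul]⟩
    have hφ : coind.map f φ = a y := Subtype.ext (funext fun x => by
      change f (pbSnd (coindAdj a) f (t x⁻¹)) = _
      rw [← h0.1]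
      change (a (pbFst (coindAdj a) f (t x⁻¹)).1.1).1 1 = _
      rw [ht1, inv_inv, map_smul]
      exact congrArg (a y).1 (one_mul x))
    obtain ⟨w, ⟨hw1, hw2⟩, -⟩ := h.2 φ y hφ
    refine ⟨w, hw2, ?_⟩
    rintro ⟨w', o⟩ hw' hy
    obtain rfl : w' = w := hw'
    obtain ⟨x, rfl⟩ := orbit.exists_smul_base o
    have hst : s ⟨prodMap q (MulActionHom.id G) (w', x • orbit.base C), hy⟩ = ind.mk x (t x) := by
      rw [← ht]
      congr 1
      exact Subtype.ext (Prod.ext hw2 rfl)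
    rw [hext, hst]
    congr 1
    refine h0.ext (Subtype.ext (Prod.ext ?_ ?_)) ?_
    · rw [he1, ht1, ← hw2]
      exact map_smul q _ _
    · exact (pbFst (coindAdj a) f _).2.trans (pbFst (coindAdj a) f _).2.symm
    · rw [he2]
      change (p (x⁻¹ • w')).1 1 = _
      rw [map_smul, hw1]
      change pbSnd (coindAdj a) f (t (1 * x⁻¹)⁻¹) = _
      rw [one_mul, inv_inv]
  · intro w w' hw hww
    refine h.ext (Subtype.ext (funext fun x => ?_)) hw
    have h1 := hww (w, x⁻¹ • orbit.base C) (w', x⁻¹ • orbit.base C) rfl rfl (Prod.ext hw rfl)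
    rw [hext, hext] at h1
    have h3 := congrArg (pbSnd (coindAdj a) f) (ind.mk_injective _ h1.symm)
    rw [he2, he2] at h3
    change (p (x⁻¹⁻¹ • w')).1 1 = (p (x⁻¹⁻¹ • w)).1 1 at h3
    rw [inv_inv, map_smul, map_smul] at h3
    have h4 : ∀ u : P, (x • p u).1 1 = (p u).1 x := fun u => congrArg (p u).1 (one_mul x)
    rw [← h4, ← h4, h3]

/-- A converse to `isExponential_of_isPB_coind`: translated to the base point, sections of `q` over
`{y} × G/C` are the `C`-equivariant maps from `G` to the fibre of `A` that lie over `x ↦ x • y`. -/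
lemma isPB_coind_of_isExponential {B A P : FinGSet G} {q : A →[G] prod B (orbit C)}
    {cA : A →[G] orbit C} (hq : ∀ w, snd B (orbit C) (q w) = cA w) {π : P →[G] B}
    {e : prod P (orbit C) →[G] A} (he : ∀ w, cA (e w) = snd P (orbit C) w)
    (h : IsExponential (fst B (orbit C)) q π (fst P (orbit C)) (prodMap π (MulActionHom.id G)) e) :
    IsPB ((coind.map (fib.map e he)).comp (coindUnit C P)) π (coind.map (fib.map q hq))
      (coindUnit C B) := by
  have hq' : ∀ w o, q (e (w, o)) = (π w, o) := fun w o => h.proj_eval (w, o)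
  have hmk : ∀ w (x : G), e (x • w, orbit.base C) = x • e (w, x⁻¹ • orbit.base C) := fun w x => by
    have h1 : ((x • w, orbit.base C) : prod P (orbit C)) =
        x • ((w, x⁻¹ • orbit.base C) : prod P (orbit C)) :=
      Prod.ext rfl (smul_inv_smul x (orbit.base C)).symm
    exact (congrArg e h1).trans (map_smul e x _)
  refine isPB_of (fun w => Subtype.ext (funext fun x => Subtype.ext ?_)) (fun φ y hφ => ?_)
    fun w w' h1 h2 => h.ext h2 ?_
  · change q (e (x • w, orbit.base C)) = (x • π w, orbit.base C)
    rw [hq', map_smul]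
  · have hφ' : ∀ x, q (φ.1 x).1 = (x • y, orbit.base C) := fun x =>
      congrArg Subtype.val (congrFun (congrArg Subtype.val hφ) x)
    have hrep : ∀ u : {u : prod B (orbit C) // fst B (orbit C) u = y}, ∃ x : G,
        u.1.2 = x • orbit.base C := fun u => orbit.exists_smul_base _
    choose x hx using hrep
    obtain ⟨w, hw1, hw2⟩ := h.exists_point y (fun u => x u • (φ.1 (x u)⁻¹).1) (fun u => by
      rw [map_smul, hφ']
      refine Prod.ext ?_ (hx u).symm
      exact (smul_inv_smul (x u) y).trans u.2.symm)
    refine ⟨w, Subtype.ext (funext fun z => Subtype.ext ?_), hw1⟩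
    change e (z • w, orbit.base C) = (φ.1 z).1
    rw [hmk, hw2 (w, z⁻¹ • orbit.base C) rfl hw1]
    -- The section was defined with chosen coset representatives; equivariance of `φ` makes its
    -- values independent of them.
    have h1 : ∀ x' : G, z⁻¹ • orbit.base C = x' • orbit.base C →
        z • x' • (φ.1 x'⁻¹).1 = (φ.1 z).1 := fun x' hx' => by
      have hm : z * x' ∈ C := orbit.mem_of_smul_base (by rw [mul_smul, ← hx', smul_inv_smul])
      have := congrArg Subtype.val (φ.2 ⟨z * x', hm⟩ x'⁻¹)
      rw [smul_smul]
      refine Eq.trans this.symm (congrArg (fun u => (φ.1 u).1) ?_)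
      exact mul_inv_cancel_right z x'
    exact h1 _ (hx ⟨(π w, z⁻¹ • orbit.base C), hw1⟩)
  · rintro ⟨u, o⟩ ⟨u', o'⟩ hu hu' hr
    obtain rfl : u = w := hu
    obtain rfl : u' = w' := hu'
    obtain rfl : o = o' := congrArg Prod.snd hr
    obtain ⟨x, rfl⟩ := orbit.exists_smul_base o
    have h3 : e (x⁻¹ • u, orbit.base C) = e (x⁻¹ • u', orbit.base C) :=
      congrArg Subtype.val (congrFun (congrArg Subtype.val h1) x⁻¹)
    rw [hmk, hmk, inv_inv] at h3
    exact MulAction.injective _ h3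

/-- The transfer relation of the Kan extension, rewritten as the distributive law of a norm along `B
× G/C → B`. By `normLift` there are no further relations between elements in normal form. -/
lemma nmBase_tr {B A P : FinGSet G} {q : A →[G] prod B (orbit C)}
    {cA : A →[G] orbit C} (hq : ∀ w, snd B (orbit C) (q w) = cA w) {π : P →[G] B}
    {e : prod P (orbit C) →[G] A} (he : ∀ w, cA (e w) = snd P (orbit C) w)
    (h : IsExponential (fst B (orbit C)) q π (fst P (orbit C)) (prodMap π (MulActionHom.id G)) e)
    (m : R.obj (fib cA)) :
    R.nmBase (R.tr (fib.map q hq) m) = (R.norm G).tr π (R.nmBase (R.res (fib.map e he) m)) := by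
  refine (NormRep.cls_tr (fib.map q hq) _ _ _ π π (isPB_coind_of_isExponential hq he h)
    (fun _ => rfl) m _ rfl).trans ?_
  rw [R.cls_eq_tr_nmBase]
  congr 3
  exact FinGSet.hom_ext fun w => congrArg (fib.map e he)
    (DFunLike.congr_fun (coindAdj_unit P) w)

/-- Maps out of the norm. -/
def normLift {X : FinGSet G} {Z : Type*}
    (F : ∀ B : FinGSet G, (B →[G] X) → R.obj (fib (snd B (orbit C))) → Z)
    (hF : ∀ (B : FinGSet G) (b : B →[G] X) (A : FinGSet G) (q : A →[G] prod B (orbit C))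
      (cA : A →[G] orbit C) (hq : ∀ w, snd B (orbit C) (q w) = cA w) (P : FinGSet G) (π : P →[G] B)
      (e : prod P (orbit C) →[G] A) (he : ∀ w, cA (e w) = snd P (orbit C) w),
      IsExponential (fst B (orbit C)) q π (fst P (orbit C)) (prodMap π (MulActionHom.id G)) e →
      ∀ m : R.obj (fib cA),
        F B b (R.tr (fib.map q hq) m) = F P (b.comp π) (R.res (fib.map e he) m)) :
    (R.norm G).obj X → Z :=
  Quot.lift (fun ρ => F ρ.B ρ.b (R.res (coindAdj ρ.a) ρ.m)) (by
    intro ρ σ h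
    cases h with
    | @tr T T' f B P a b p q h m =>
      obtain ⟨e₀, he₀, hexp⟩ := isExponential_of_isPB_coind h
      -- After base change the transfer comes from a `C`-set over the fibre of `B × G/C`; inducing
      -- that `C`-set up to `G` gives it the form `fib.map q hq` required by `hF`.
      have h1 : R.res (coindAdj a) (R.tr f m) =
          R.tr (fib.map (indDesc (pbFst (coindAdj a) f)) (indDesc_str _))
            (R.tr (fibInd _) (R.res (pbSnd (coindAdj a) f) m)) := by
        rw [← R.tr_comp, fib_map_indDesc_fibInd,
          R.base_change _ _ _ _ (isPB_pb (coindAdj a) f).symm]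
      have h2 : fib.map (fib.extend ((fibInd _).comp e₀)) (fib.extend_str _) =
          (fibInd _).comp e₀ := FinGSet.hom_ext fun w => Subtype.ext (by
        refine Eq.trans ?_ (one_smul G ((fibInd _).comp e₀ w).1)
        rw [← fib.extend_smul, one_smul]
        rfl)
      dsimp only
      rw [h1, hF B b _ _ _ (indDesc_str _) P q _ (fib.extend_str _) hexp, h2, R.res_comp,
        R.res_tr_of_bijective _ (fibInd_bijective _).1, ← R.res_comp, he₀]
    | res f a b m =>
      dsimp only
      rw [← R.res_comp]
      rfl)

lemma normLift_tr_nmBase {X : FinGSet G} {Z : Type*}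
    (F : ∀ B : FinGSet G, (B →[G] X) → R.obj (fib (snd B (orbit C))) → Z) (hF)
    {B : FinGSet G} (b : B →[G] X) (m : R.obj (fib (snd B (orbit C)))) :
    R.normLift F hF ((R.norm G).tr b (R.nmBase m)) = F B b m := by
  change F B b (R.res (coindAdj (coindUnit C B)) m) = _
  rw [coindAdj_unit, R.res_id]

end PreGreen

end NormClass

/-! ### Norms on the norm of a Green functor -/

namespace FinGSet

section

variable {G : Type} [Group G]

lemma isPB_fst_right {X Y : FinGSet G} (f : X →[G] Y) (Z : FinGSet G) :
    IsPB (prodMap f (MulActionHom.id G)) (fst X Z) (fst Y Z) f :=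
  isPB_of (fun _ => rfl) (fun x y hxy => ⟨(y, x.2), Prod.ext hxy.symm rfl, rfl⟩)
    (fun _ _ h1 h2 => Prod.ext h2 (congrArg (fun u => u.2) h1))

lemma isPB_prodMap {P X Y Z : FinGSet G} {p : P →[G] X} {q : P →[G] Y} {f : X →[G] Z}
    {g : Y →[G] Z} (h : IsPB p q f g) {W : FinGSet G} {cX : X →[G] W} {cP : P →[G] W}
    (hc : ∀ w, cX (p w) = cP w) :
    IsPB p (pair q cP) (pair f cX) (prodMap g (MulActionHom.id G)) :=
  isPB_of (fun w => Prod.ext (h.1 w) (hc w)) (fun x y hxy => by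
    obtain ⟨w, ⟨h1, h2⟩, -⟩ := h.2 x y.1 (congrArg (fun u => u.1) hxy)
    refine ⟨w, h1, Prod.ext h2 ?_⟩
    change cP w = y.2
    rw [← hc, h1]
    exact congrArg (fun u => u.2) hxy)
    (fun _ _ h1 h2 => h.ext h1 (congrArg (fun u => u.1) h2))

lemma IsExponential.exists_base_change {X Y A P E X' Y' A' P' : FinGSet G} {f : X →[G] Y}
    {q : A →[G] X} {π : P →[G] Y} {f' : E →[G] P} {r : E →[G] X} {e : E →[G] A}
    (h : IsExponential f q π f' r e) {g : Y' →[G] Y} {gX : X' →[G] X} {f₁ : X' →[G] Y'}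
    (hX : IsPB gX f₁ f g) {gA : A' →[G] A} {q₁ : A' →[G] X'} (hA : IsPB gA q₁ q gX)
    {gP : P' →[G] P} {π₁ : P' →[G] Y'} (hP : IsPB gP π₁ π g) :
    ∃ (gE : pb f₁ π₁ →[G] E) (e₁ : pb f₁ π₁ →[G] A'),
      IsExponential f₁ q₁ π₁ (pbSnd f₁ π₁) (pbFst f₁ π₁) e₁ ∧ (∀ t, gA (e₁ t) = e (gE t)) ∧
        IsPB gE (pbSnd f₁ π₁) f' gP := by
  have hE := isPB_pb f₁ π₁
  have h1 : ∀ t, f (gX.comp (pbFst f₁ π₁) t) = π (gP.comp (pbSnd f₁ π₁) t) := fun t => by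
    change f (gX _) = π (gP _)
    rw [hX.1, hE.1, hP.1]
  let gE := h.isPB.lift (gX.comp (pbFst f₁ π₁)) (gP.comp (pbSnd f₁ π₁)) h1
  have hE1 : ∀ t, r (gE t) = gX (pbFst f₁ π₁ t) := h.isPB.lift_fst _ _ h1
  have hE2 : ∀ t, f' (gE t) = gP (pbSnd f₁ π₁ t) := h.isPB.lift_snd _ _ h1
  have h2 : ∀ t, q (e.comp gE t) = gX (pbFst f₁ π₁ t) := fun t => (h.proj_eval _).trans (hE1 t)
  refine ⟨gE, hA.lift (e.comp gE) (pbFst f₁ π₁) h2, h.base_change hX hA hP hE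
    (hA.lift_fst _ _ h2) (hA.lift_snd _ _ h2) hE2, hA.lift_fst _ _ h2, ?_⟩
  have h3 : g.comp π₁ = π.comp gP := hom_ext fun w => (hP.1 w).symm
  exact h.isPB.of_paste (h3 ▸ hX.paste hE) hE2 hE1

/-- Exponential diagrams along the projection of a product. -/
lemma exists_isExponential_fst {B Z A : FinGSet G} (q : A →[G] prod B Z) :
    ∃ (P : FinGSet G) (π : P →[G] B) (e : prod P Z →[G] A),
      IsExponential (fst B Z) q π (fst P Z) (prodMap π (MulActionHom.id G)) e := by
  obtain ⟨P, E, π, f', r, e, h⟩ := exists_isExponential (fst B Z) q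
  have hc : ∀ w, fst B Z (prodMap π (MulActionHom.id G) w) = π (fst P Z w) := fun _ => rfl
  exact ⟨P, π, e.comp (h.isPB.lift (prodMap π (MulActionHom.id G)) (fst P Z) hc),
    h.of_isPB (isPB_fst_right π Z) _ (h.isPB.lift_snd _ _ hc) (h.isPB.lift_fst _ _ hc)
      fun _ => rfl⟩

end

end FinGSet

section

variable {G : Type} [CommGroup G] [Finite G] {C : Subgroup G}

namespace PreGreen

variable (R : PreGreen.{v + 1} C)

/-- The element of the norm at `B` given by an element at a `G`-set `D` over `G/C` and a map
`D → B` along which there are norms. -/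
noncomputable def nm {D B : FinGSet G} (h : D →[G] B) (c : D →[G] orbit C) (m : R.obj (fib c)) :
    (R.norm G).obj B :=
  R.nmBase (R.prodAlong (fib.map (FinGSet.pair h c) (snd_pair h c)) m)

variable {R} (hR : R.IsSemiMackey)

include hR

/-- Since `k` is a map over `G/C`, both sides are `nmBase` of a product along a map to `B × G/C`,
and products compose. -/
lemma nm_comp {D D' B : FinGSet G} {h : D →[G] B} (hh : HasNorm C h) {c : D →[G] orbit C}
    {c' : D' →[G] orbit C} {k : D' →[G] D} (hk : ∀ d, c (k d) = c' d) (hk' : HasNorm C k)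
    (m : R.obj (fib c')) :
    R.nm (h.comp k) c' m = R.nm h c (R.prodAlong (fib.map k hk) m) := by
  rw [nm, nm, ← prodAlong_comp hR (hk'.isLocTriv_fib hk) ((hasNorm_pair hh c).isLocTriv_fib _)]
  congr 2
  exact FinGSet.hom_ext fun d => Subtype.ext (Prod.ext rfl (hk d.1).symm)

lemma nm_fst {B : FinGSet G} (m : R.obj (fib (snd B (orbit C)))) :
    R.nm (fst B (orbit C)) (snd B (orbit C)) m = R.nmBase m :=
  congrArg R.nmBase (prodAlong_id hR m)

lemma nm_one {D B : FinGSet G} {h : D →[G] B} (hh : HasNorm C h) (c : D →[G] orbit C) :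
    R.nm h c 1 = 1 := by
  rw [nm, prodAlong_one hR ((hasNorm_pair hh c).isLocTriv_fib _), nmBase_one]

lemma nm_mul {D B : FinGSet G} {h : D →[G] B} (hh : HasNorm C h) (c : D →[G] orbit C)
    (m m' : R.obj (fib c)) : R.nm h c (m * m') = R.nm h c m * R.nm h c m' := by
  rw [nm, prodAlong_mul hR ((hasNorm_pair hh c).isLocTriv_fib _), nmBase_mul]
  rfl

lemma res_nm {D D' B B' : FinGSet G} {h : D →[G] B} (hh : HasNorm C h) {c : D →[G] orbit C}
    {c' : D' →[G] orbit C} {p : D' →[G] D} {h' : D' →[G] B'} {g : B' →[G] B}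
    (hp : IsPB p h' h g) (hc : ∀ d, c (p d) = c' d) (m : R.obj (fib c)) :
    (R.norm G).res g (R.nm h c m) = R.nm h' c' (R.res (fib.map p hc) m) := by
  rw [nm, nm, res_nmBase, res_prodAlong hR (fib.isPB (isPB_prodMap hp hc) hc (snd_pair h' c')
    (snd_pair h c) (snd_prodMap g _)) ((hasNorm_pair hh c).isLocTriv_fib _)]

/-- With `IsExponential.exists_iso`, this makes expressions built from an exponential diagram
independent of the diagram. -/
lemma tr_nm_eq_of_iso {X P P₂ D D₂ : FinGSet G} {u : P →[G] P₂} (hu : Function.Bijective u)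
    {w : D →[G] D₂} (hw : Function.Bijective w) {h : D →[G] P} {h₂ : D₂ →[G] P₂}
    (hh : HasNorm C h₂) {c : D →[G] orbit C} {c₂ : D₂ →[G] orbit C} {π : P →[G] X}
    {π₂ : P₂ →[G] X} (h1 : ∀ d, h₂ (w d) = u (h d)) (h2 : ∀ d, c₂ (w d) = c d)
    (h3 : ∀ p, π₂ (u p) = π p) (m : R.obj (fib c₂)) :
    (R.norm G).tr π₂ (R.nm h₂ c₂ m) = (R.norm G).tr π (R.nm h c (R.res (fib.map w h2) m)) := by
  obtain rfl : π₂.comp u = π := FinGSet.hom_ext h3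
  rw [← res_nm hR hh (isPB_of_bijective (fun d => (h1 d).symm) hw hu.1).symm h2]
  exact (((R.norm G).tr_comp _ _ _).trans
    (congrArg _ ((R.norm G).tr_res_of_bijective u hu _))).symm

/-- Transfers distribute over norms in `N_C^G R`. -/
lemma nm_tr {X Y A P E : FinGSet G} {h : X →[G] Y} (hh : HasNorm C h) {c : X →[G] orbit C}
    {q : A →[G] X} {cA : A →[G] orbit C} (hq : ∀ w, c (q w) = cA w) {π : P →[G] Y}
    {f' : E →[G] P} {r : E →[G] X} {e : E →[G] A} {cE : E →[G] orbit C}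
    (he : ∀ w, cA (e w) = cE w) (H : IsExponential h q π f' r e) (m : R.obj (fib cA)) :
    R.nm h c (R.tr (fib.map q hq) m) =
      (R.norm G).tr π (R.nm f' cE (R.res (fib.map e he) m)) := by
  let k : X →[G] prod Y (orbit C) := FinGSet.pair h c
  have hk : HasNorm C k := hasNorm_pair hh c
  -- The map `h` is `k` followed by the projection from `Y × G/C`. The first dependent product takes
  -- care of products in `R`, the second of `nmBase`.
  obtain ⟨P₁, E₁, π₁, f₁, r₁, e₁, H₁⟩ := exists_isExponential k q
  obtain ⟨P₂, π₂, e₂, H₂⟩ := exists_isExponential_fst π₁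
  let c₁ : P₁ →[G] orbit C := (snd Y (orbit C)).comp π₁
  let d₁ : E₁ →[G] orbit C := c₁.comp f₁
  have hr₁ : ∀ w, c (r₁ w) = d₁ w := fun w => congrArg (snd Y (orbit C)) (H₁.isPB.1 w)
  have he₁ : ∀ w, cA (e₁ w) = d₁ w := fun w => by rw [← hr₁, ← hq, H₁.proj_eval]
  have he₂ : ∀ w, c₁ (e₂ w) = snd P₂ (orbit C) w := fun w =>
    congrArg (snd Y (orbit C)) (H₂.proj_eval w)
  have H₃ := isPB_pb f₁ e₂
  let d₃ : pb f₁ e₂ →[G] orbit C := (snd P₂ (orbit C)).comp (pbSnd f₁ e₂)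
  have hd₃ : ∀ w, d₁ (pbFst f₁ e₂ w) = d₃ w := fun w =>
    (congrArg c₁ (H₃.1 w)).trans (he₂ _)
  have hf₁ : HasNorm C f₁ := hk.base_change H₁.isPB
  have hl : HasNorm C (pbSnd f₁ e₂) := hf₁.base_change H₃
  have e1 : R.nm h c (R.tr (fib.map q hq) m) = (R.norm G).tr π₂ (R.nmBase
      (R.prodAlong (fib.map (pbSnd f₁ e₂) (fun _ => rfl : ∀ w, _ = d₃ w))
        (R.res (fib.map (pbFst f₁ e₂) hd₃) (R.res (fib.map e₁ he₁) m)))) := by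
    rw [nm, prodAlong_tr hR ((hasNorm_pair hh c).isLocTriv_fib _)
      (fib.isExponential H₁ (snd_pair h c) hq (fun _ => rfl : ∀ w, _ = c₁ w)
        (fun _ => rfl : ∀ w, _ = d₁ w) hr₁ he₁), R.nmBase_tr _ he₂ H₂,
      res_prodAlong hR (fib.isPB H₃ hd₃ _ _ he₂) (hf₁.isLocTriv_fib _)]
  -- The two dependent products compose to one along `h`, which uniqueness then compares with the
  -- given diagram `H`.
  have H₄ := H₁.comp_right H₂ H₃
  have hn : HasNorm C ((fst P₂ (orbit C)).comp (pbSnd f₁ e₂)) := (hasNorm_fst P₂).comp hl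
  have e2 : (R.norm G).tr π₂ (R.nmBase
      (R.prodAlong (fib.map (pbSnd f₁ e₂) (fun _ => rfl : ∀ w, _ = d₃ w))
        (R.res (fib.map (pbFst f₁ e₂) hd₃) (R.res (fib.map e₁ he₁) m)))) =
      (R.norm G).tr π₂ (R.nm ((fst P₂ (orbit C)).comp (pbSnd f₁ e₂)) d₃
        (R.res (fib.map (e₁.comp (pbFst f₁ e₂)) (fun w => (he₁ _).trans (hd₃ w))) m)) := by
    rw [nm_comp hR (hasNorm_fst P₂)
      (fun _ => rfl : ∀ w, snd P₂ (orbit C) (pbSnd f₁ e₂ w) = d₃ w) hl, nm_fst hR, ← R.res_comp]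
    rfl
  obtain ⟨u, w, hu, hw, h1, h2, h3, h4⟩ := H.exists_iso H₄
  have h5 : ∀ t, d₃ (w t) = cE t := fun t => by
    rw [← hd₃, ← hr₁, ← he, ← hq, H.proj_eval]
    exact congrArg c (h3 t)
  rw [e1, e2, tr_nm_eq_of_iso hR hu hw hn h2 h5 h1, ← R.res_comp]
  congr 4
  exact FinGSet.hom_ext fun t => Subtype.ext (h4 t.1)

end PreGreen

end

/-- An exponential diagram. -/
structure FinGSet.ExponentialDiagram {G : Type} [Group G] {X Y A : FinGSet G} (f : X →[G] Y)
    (q : A →[G] X) where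
  P : FinGSet G
  E : FinGSet G
  π : P →[G] Y
  f' : E →[G] P
  r : E →[G] X
  e : E →[G] A
  isExponential : IsExponential f q π f' r e

/-- A choice of an exponential diagram. -/
noncomputable def FinGSet.exponentialDiagram {G : Type} [Group G] {X Y A : FinGSet G}
    (f : X →[G] Y) (q : A →[G] X) : ExponentialDiagram f q :=
  Classical.choice (by
    obtain ⟨P, E, π, f', r, e, h⟩ := exists_isExponential f q
    exact ⟨⟨P, E, π, f', r, e, h⟩⟩)

/-! ### Norms of elements in normal form. -/

section

variable {G : Type} [CommGroup G] [Finite G] {C : Subgroup G}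

namespace PreGreen

variable {R : PreGreen.{v + 1} C} (hR : R.IsSemiMackey)

/-- The norm along `f` of the element `b_* N(m)` computed by an exponential diagram. -/
noncomputable def normAux (R : PreGreen.{v + 1} C) {X Y : FinGSet G} (f : X →[G] Y) (B : FinGSet G)
    (b : B →[G] X) (m : R.obj (fib (snd B (orbit C)))) : (R.norm G).obj Y :=
  let D := exponentialDiagram f b
  (R.norm G).tr D.π (R.nm (D.f'.comp (fst D.E (orbit C))) (snd D.E (orbit C))
    (R.res (fib.map (prodMap D.e (MulActionHom.id G)) (snd_prodMap D.e _)) m))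

include hR

lemma normAux_eq {X Y B P E : FinGSet G} {f : X →[G] Y} (hf : HasNorm C f)
    {b : B →[G] X} {π : P →[G] Y} {f' : E →[G] P} {r : E →[G] X} {e : E →[G] B}
    (h : IsExponential f b π f' r e) (m : R.obj (fib (snd B (orbit C)))) :
    R.normAux f B b m = (R.norm G).tr π (R.nm (f'.comp (fst E (orbit C))) (snd E (orbit C))
      (R.res (fib.map (prodMap e (MulActionHom.id G)) (snd_prodMap e _)) m)) := by
  have h₂ := (exponentialDiagram f b).isExponential
  obtain ⟨u, w, hu, hw, h1, h2, h3, h4⟩ := h.exists_iso h₂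
  have hw' : Function.Bijective (prodMap w (MulActionHom.id G : orbit C →[G] orbit C)) :=
    Function.Bijective.prodMap hw Function.bijective_id
  refine (tr_nm_eq_of_iso hR hu hw' (h := f'.comp (fst E (orbit C)))
    ((hf.base_change h₂.isPB).comp (hasNorm_fst _))
    (fun d => h2 d.1) (snd_prodMap w _) h1 _).trans ?_
  rw [← R.res_comp]
  congr 4
  exact FinGSet.hom_ext fun t => Subtype.ext (Prod.ext (h4 t.1.1) rfl)

/-- The norm along `f` respects the defining relation. Both sides become transfers along `π₁ ∘ π₂`:
on the right the dependent product of `b ∘ π` along `f` is formed in two stages, on the left the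
norm along `E₁ × G/C → E₁ → P₁` is distributed over the pulled-back transfer. -/
lemma normAux_tr {X Y B A P : FinGSet G} {f : X →[G] Y} (hf : HasNorm C f) (b : B →[G] X)
    {q : A →[G] prod B (orbit C)} {cA : A →[G] orbit C} (hq : ∀ w, snd B (orbit C) (q w) = cA w)
    {π : P →[G] B} {e : prod P (orbit C) →[G] A} (he : ∀ w, cA (e w) = snd P (orbit C) w)
    (h : IsExponential (fst B (orbit C)) q π (fst P (orbit C)) (prodMap π (MulActionHom.id G)) e)
    (m : R.obj (fib cA)) :
    R.normAux f B b (R.tr (fib.map q hq) m) =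
      R.normAux f P (b.comp π) (R.res (fib.map e he) m) := by
  obtain ⟨P₁, E₁, π₁, f₁, r₁, e₁, H⟩ := exists_isExponential f b
  have hB := isPB_pb e₁ π
  obtain ⟨P₂, E₂, π₂, f₂, r₂, e₂, H₂⟩ := exists_isExponential f₁ (pbFst e₁ π)
  have hf₁ : HasNorm C f₁ := hf.base_change H.isPB
  rw [normAux_eq hR hf H, normAux_eq hR hf (H.comp_left hB H₂)]
  have hA := isPB_pb q (prodMap e₁ (MulActionHom.id G))
  let i := prodMap e₁ (MulActionHom.id G : orbit C →[G] orbit C)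
  let cA' : pb q i →[G] orbit C := (snd E₁ (orbit C)).comp (pbSnd q i)
  have hcA' : ∀ w, cA (pbFst q i w) = cA' w := fun w => by
    rw [← hq, hA.1]
    rfl
  rw [R.base_change _ _ _ _ (fib.isPB hA hcA' (fun _ => rfl : ∀ w, _ = cA' w) hq
    (snd_prodMap e₁ _))]
  let gE := prodMap (pbSnd e₁ π) (MulActionHom.id G : orbit C →[G] orbit C)
  let rE := prodMap (pbFst e₁ π) (MulActionHom.id G : orbit C →[G] orbit C)
  have hE : ∀ t, q (e.comp gE t) = i (rE t) := fun t =>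
    (h.proj_eval _).trans (Prod.ext (hB.1 t.1).symm rfl)
  let e' := hA.lift (e.comp gE) rE hE
  have he1 : ∀ t, pbFst q i (e' t) = e (gE t) := hA.lift_fst _ _ hE
  have he2 : ∀ t, pbSnd q i (e' t) = rE t := hA.lift_snd _ _ hE
  have H₃ := h.base_change (isPB_fst_right e₁ (orbit C)) hA hB.symm (isPB_fst_right _ _) he1 he2
    (fun _ => rfl)
  have H₄ := H₃.comp_right H₂ (isPB_fst_right e₂ (orbit C))
  have hs : ∀ w, cA' (e'.comp (prodMap e₂ (MulActionHom.id G)) w) = snd E₂ (orbit C) w := fun w =>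
    congrArg (snd E₁ (orbit C)) (he2 _)
  rw [nm_tr hR (hf₁.comp (hasNorm_fst E₁)) (fun _ => rfl : ∀ w, _ = cA' w) hs H₄, ← R.res_comp,
    ← R.res_comp]
  refine ((R.norm G).tr_comp _ _ _).symm.trans
    (congrArg _ (congrArg _ (congrArg (fun k => R.res k m) ?_)))
  exact FinGSet.hom_ext fun t => Subtype.ext (he1 _)

/-- The norms of `N_C^G R`. -/
noncomputable def normNorm {X Y : FinGSet G} (f : X →[G] Y) (hf : HasNorm C f) :
    (R.norm G).obj X → (R.norm G).obj Y :=
  R.normLift (R.normAux f) (fun _ b _ _ _ hq _ _ _ he h m => normAux_tr hR hf b hq he h m)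

/-- The working formula for norms. It covers every admissible `h` and not just the projection `B ×
G/C → B` of the definition, and its result again has the shape to which it applies. The norm axioms
thereby reduce to statements about exponential diagrams. -/
lemma normNorm_tr_nm {X Y B P E D D' : FinGSet G} {f : X →[G] Y} (hf : HasNorm C f)
    {b : B →[G] X} {π : P →[G] Y} {f' : E →[G] P} {r : E →[G] X} {e : E →[G] B}
    (H : IsExponential f b π f' r e) {h : D →[G] B} (hh : HasNorm C h) {c : D →[G] orbit C}
    {e' : D' →[G] D} {h' : D' →[G] E} {c' : D' →[G] orbit C} (hc : ∀ w, c (e' w) = c' w)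
    (hD : IsPB e' h' h e) (m : R.obj (fib c)) :
    normNorm hR f hf ((R.norm G).tr b (R.nm h c m)) =
      (R.norm G).tr π (R.nm (f'.comp h') c' (R.res (fib.map e' hc) m)) := by
  have hf' : HasNorm C f' := hf.base_change H.isPB
  refine (R.normLift_tr_nmBase _ _ _ _).trans ?_
  rw [normAux_eq hR hf H, res_prodAlong hR (fib.isPB (isPB_prodMap hD hc) hc (snd_pair h' c')
    (snd_pair h c) (snd_prodMap e _)) ((hasNorm_pair hh c).isLocTriv_fib _),
    ← nm_comp hR (hf'.comp (hasNorm_fst E)) (snd_pair h' c')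
      (hasNorm_pair (hh.base_change hD) c')]
  rfl

end PreGreen

end

/-- The exponential diagram computing norms along fold maps. -/
lemma FinGSet.isExponential_fold {G : Type} [Group G] {X B Q Bl Br : FinGSet G}
    {b : B →[G] sum X X} {il : Bl →[G] B} {bl : Bl →[G] X} {ir : Br →[G] B} {br : Br →[G] X}
    (hl : IsPB il bl b (inl X X)) (hr : IsPB ir br b (inr X X)) {ql : Q →[G] Bl} {qr : Q →[G] Br}
    (hQ : IsPB ql qr bl br) : ∃ (r : sum Q Q →[G] sum X X) (e : sum Q Q →[G] B),
      IsExponential (fold X) b (bl.comp ql) (fold Q) r e ∧ (∀ w, e (Sum.inl w) = il (ql w)) ∧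
        ∀ w, e (Sum.inr w) = ir (qr w) := by
  let π := bl.comp ql
  let r : sum Q Q →[G] sum X X := ⟨Sum.map π π, fun c w => by
    rcases w with w | w
    · exact congrArg Sum.inl (map_smul π c w)
    · exact congrArg Sum.inr (map_smul π c w)⟩
  let e : sum Q Q →[G] B := ⟨Sum.elim (il.comp ql) (ir.comp qr), fun c w => by
    rcases w with w | w
    · exact map_smul (il.comp ql) c w
    · exact map_smul (ir.comp qr) c w⟩
  refine ⟨r, e, isExponential_of (isPB_of ?_ ?_ ?_) ?_ ?_ ?_, fun _ => rfl, fun _ => rfl⟩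
  · rintro (w | w) <;> rfl
  · rintro (x | x) w h
    · exact ⟨Sum.inl w, congrArg Sum.inl h.symm, rfl⟩
    · exact ⟨Sum.inr w, congrArg Sum.inr h.symm, rfl⟩
  · rintro (w | w) (w' | w') h1 h2
    · exact congrArg Sum.inl h2
    · cases h1
    · cases h1
    · exact congrArg Sum.inr h2
  · rintro (w | w)
    · exact hl.1 _
    · exact (hr.1 _).trans (congrArg Sum.inr (hQ.1 w).symm)
  · intro x s hs
    obtain ⟨wl, ⟨hl1, hl2⟩, -⟩ := hl.2 (s ⟨Sum.inl x, rfl⟩) x (hs _)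
    obtain ⟨wr, ⟨hr1, hr2⟩, -⟩ := hr.2 (s ⟨Sum.inr x, rfl⟩) x (hs _)
    obtain ⟨w, ⟨h1, h2⟩, -⟩ := hQ.2 wl wr (hl2.trans hr2.symm)
    have hw : π w = x := (congrArg bl h1).trans hl2
    refine ⟨w, hw, ?_⟩
    rintro (t | t) ht h
    · obtain rfl : t = w := ht
      subst hw
      exact (congrArg il h1).trans hl1
    · obtain rfl : t = w := ht
      subst hw
      exact (congrArg ir h2).trans hr1
  · intro w w' h h2
    refine hQ.ext (hl.ext ?_ h) (hr.ext ?_ ?_)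
    · exact h2 (Sum.inl w) (Sum.inl w') rfl rfl (congrArg Sum.inl h)
    · exact h2 (Sum.inr w) (Sum.inr w') rfl rfl (congrArg Sum.inr h)
    · rw [← hQ.1, ← hQ.1]
      exact h

/-- The structure map of a map over `Z`. -/
lemma FinGSet.comp_str {G : Type} [Group G] {D D' Z : FinGSet G} (c : D →[G] Z) (k : D' →[G] D)
    (w : D') : c (k w) = (c.comp k) w := rfl

/-! ### The Tambara axioms for the norms on the norm. -/

section

variable {G : Type} [CommGroup G] [Finite G] {C : Subgroup G}

namespace PreGreen

variable {R : PreGreen.{v + 1} C} (hR : R.IsSemiMackey)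

include hR

lemma exists_eq_tr_nm {X : FinGSet G} (z : (R.norm G).obj X) :
    ∃ (B : FinGSet G) (b : B →[G] X) (m : R.obj (fib (snd B (orbit C)))),
      z = (R.norm G).tr b (R.nm (fst B (orbit C)) (snd B (orbit C)) m) := by
  obtain ⟨B, b, m, rfl⟩ := R.exists_eq_tr_nmBase z
  exact ⟨B, b, m, by rw [nm_fst hR]⟩

lemma normNorm_id {X : FinGSet G} (h : HasNorm C (MulActionHom.id G : X →[G] X))
    (x : (R.norm G).obj X) : normNorm hR (MulActionHom.id G) h x = x := by
  obtain ⟨B, b, m, rfl⟩ := exists_eq_tr_nm hR x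
  refine (normNorm_tr_nm hR h (isExponential_id b) (hasNorm_fst B) (fun _ => rfl)
    (isPB_id _).symm m).trans ?_
  exact congrArg (fun m => (R.norm G).tr b (R.nm (fst B (orbit C)) (snd B (orbit C)) m))
    (R.res_id m)

/-- The dependent product along `g ∘ f` is an iterated one, and `normNorm_tr_nm` applies again to
the element produced by the norm along `f`. -/
lemma normNorm_comp {X Y Z : FinGSet G} (f : X →[G] Y) (g : Y →[G] Z) (hf : HasNorm C f)
    (hg : HasNorm C g) (hgf : HasNorm C (g.comp f)) (x : (R.norm G).obj X) :
    normNorm hR (g.comp f) hgf x = normNorm hR g hg (normNorm hR f hf x) := by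
  obtain ⟨B, b, m, rfl⟩ := exists_eq_tr_nm hR x
  obtain ⟨P, E, π, f', r, e, H⟩ := exists_isExponential f b
  obtain ⟨P₂, E₂, π₂, g', r₂, e₂, H₂⟩ := exists_isExponential g π
  have h₃ := isPB_pb f' e₂
  have h₁ := isPB_pb (fst B (orbit C)) e
  have h₄ := isPB_pb (pbSnd (fst B (orbit C)) e) (pbFst f' e₂)
  have hf' : HasNorm C f' := hf.base_change H.isPB
  have hh := hasNorm_fst (C := C) B
  rw [normNorm_tr_nm hR hgf (H.comp_right H₂ h₃) hh (comp_str _ _) (h₁.paste h₄),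
    normNorm_tr_nm hR hf H hh (comp_str _ _) h₁,
    normNorm_tr_nm hR hg H₂ (hf'.comp (hh.base_change h₁)) (comp_str _ _)
      (h₃.paste' h₄), ← R.res_comp]
  rfl

lemma res_normNorm {P X Y Z : FinGSet G} (p : P →[G] X) (q : P →[G] Y) (f : X →[G] Z)
    (g : Y →[G] Z) (hf : HasNorm C f) (hq : HasNorm C q) (hpb : IsPB p q f g)
    (x : (R.norm G).obj X) :
    (R.norm G).res g (normNorm hR f hf x) = normNorm hR q hq ((R.norm G).res p x) := by
  obtain ⟨B, b, m, rfl⟩ := exists_eq_tr_nm hR x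
  obtain ⟨Q, E, π, f', r, e, H⟩ := exists_isExponential f b
  have hh := hasNorm_fst (C := C) B
  have hf' : HasNorm C f' := hf.base_change H.isPB
  have h₁ := isPB_pb (fst B (orbit C)) e
  have hA := isPB_pb b p
  have hP := isPB_pb π g
  obtain ⟨gE, e₁, H', he, hE⟩ := H.exists_base_change hpb hA hP
  have h₂ := isPB_pb (pbSnd (fst B (orbit C)) e) gE
  have h₃ := isPB_pb (fst B (orbit C)) (pbFst b p)
  have h₅ := h₁.paste h₂
  -- The two composites to `B` agree, so the pullback of `B × G/C` to the new total set may be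
  -- formed through either of them.
  have he' : e.comp gE = (pbFst b p).comp e₁ := FinGSet.hom_ext fun t => (he t).symm
  rw [he'] at h₅
  have hl : ∀ t, fst B (orbit C) (((pbFst (fst B (orbit C)) e).comp (pbFst _ gE)) t) =
      pbFst b p (e₁.comp (pbSnd _ gE) t) := h₅.1
  have h₄ := h₃.of_paste h₅ (h₃.lift_snd _ _ hl) (h₃.lift_fst _ _ hl)
  have hl' : ∀ t, (snd B (orbit C)).comp (pbFst (fst B (orbit C)) (pbFst b p)) (h₃.lift _ _ hl t) =
      ((snd B (orbit C)).comp ((pbFst (fst B (orbit C)) e).comp (pbFst _ gE))) t := fun t =>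
    congrArg (snd B (orbit C)) (h₃.lift_fst _ _ hl t)
  rw [normNorm_tr_nm hR hf H hh (comp_str _ _) h₁, (R.norm G).base_change _ _ _ _ hP,
    res_nm hR (hf'.comp (hh.base_change h₁)) (hE.paste' h₂) (comp_str _ _),
    (R.norm G).base_change _ _ _ _ hA, res_nm hR hh h₃ (comp_str _ _),
    normNorm_tr_nm hR hq H' (hh.base_change h₃)
      hl' h₄, ← R.res_comp, ← R.res_comp]
  refine congrArg _ (congrArg _ (congrArg (fun k => R.res k m) ?_))
  exact FinGSet.hom_ext fun t => Subtype.ext (h₃.lift_fst _ _ hl t.1).symm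

lemma normNorm_tr {X Y A P E : FinGSet G} (f : X →[G] Y) (q : A →[G] X) (π : P →[G] Y)
    (f' : E →[G] P) (r : E →[G] X) (e : E →[G] A) (hf : HasNorm C f) (hf' : HasNorm C f')
    (H : IsExponential f q π f' r e) (a : (R.norm G).obj A) :
    normNorm hR f hf ((R.norm G).tr q a) =
      (R.norm G).tr π (normNorm hR f' hf' ((R.norm G).res e a)) := by
  obtain ⟨B, b, m, rfl⟩ := exists_eq_tr_nm hR a
  have hB := isPB_pb b e
  obtain ⟨P₂, E₂, π₂, f₂, r₂, e₂, H₂⟩ := exists_isExponential f' (pbSnd b e)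
  have hh := hasNorm_fst (C := C) B
  have h₁ := isPB_pb (fst B (orbit C)) (pbFst b e)
  have h₂ := isPB_pb (pbSnd (fst B (orbit C)) (pbFst b e)) e₂
  rw [← (R.norm G).tr_comp, normNorm_tr_nm hR hf (H.comp_left hB.symm H₂) hh (comp_str _ _)
    (h₁.paste h₂), (R.norm G).base_change _ _ _ _ hB, res_nm hR hh h₁ (comp_str _ _),
    normNorm_tr_nm hR hf' H₂ (hh.base_change h₁) (comp_str _ _) h₂, ← (R.norm G).tr_comp,
    ← R.res_comp]
  rfl

lemma normNorm_empty {E X : FinGSet G} (u : E →[G] X) (hu : HasNorm C u) (hE : IsEmpty E)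
    (x : (R.norm G).obj E) : normNorm hR u hu x = 1 := by
  obtain ⟨B, b, m, rfl⟩ := exists_eq_tr_nm hR x
  obtain ⟨P, E', π, f', r, e, H⟩ := exists_isExponential u b
  -- The fibres of `u` are empty and have exactly one section each, so `P` is `X`.
  have hπ : Function.Bijective π :=
    ⟨fun w w' h => H.ext h fun t => (hE.false (r t)).elim, fun y => by
      obtain ⟨w, hw, -⟩ := H.exists_point y (fun x => (hE.false x.1).elim)
        (fun x => (hE.false x.1).elim)
      exact ⟨w, hw⟩⟩
  have hh := hasNorm_fst (C := C) B
  have h₁ := isPB_pb (fst B (orbit C)) e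
  have hm : m = 1 := hR.eq_of_isEmpty (⟨fun w : fib (snd B (orbit C)) => hE.false (b w.1.1)⟩ :
    IsEmpty (fib (snd B (orbit C)))) _ _
  rw [normNorm_tr_nm hR hu H hh (comp_str _ _) h₁, hm, R.res_one,
    nm_one hR ((hu.base_change H.isPB).comp (hh.base_change h₁)),
    (R.norm G).tr_one_of_bijective π hπ]

lemma normNorm_fold {X : FinGSet G} (h : HasNorm C (fold X)) (z : (R.norm G).obj (sum X X)) :
    normNorm hR (fold X) h z = (R.norm G).res (inl X X) z * (R.norm G).res (inr X X) z := by
  obtain ⟨B, b, m, rfl⟩ := R.exists_eq_tr_nmBase z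
  have hl := isPB_pb b (inl X X)
  have hr := isPB_pb b (inr X X)
  have hQ := isPB_pb (pbSnd b (inl X X)) (pbSnd b (inr X X))
  -- A section over a fibre of the fold map is a pair of points of `B` over the two copies of one
  -- point of `X`. So the dependent product is the fibre product that also indexes the product of
  -- the two transfers.
  obtain ⟨r, e, H, he1, he2⟩ := isExponential_fold hl hr hQ
  rw [(R.norm G).base_change _ _ _ _ hl, (R.norm G).base_change _ _ _ _ hr,
    (R.norm G).tr_mul_tr _ _ _ _ hQ, res_nmBase, res_nmBase, res_nmBase, res_nmBase, ← nmBase_mul,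
    ← nm_fst hR m, normNorm_tr_nm hR h H (hasNorm_fst B) (snd_prodMap e _) (isPB_fst_right e _)]
  set Q := pb (pbSnd b (inl X X)) (pbSnd b (inr X X))
  refine congrArg _ ?_
  have hn : HasNorm C ((fold Q).comp (fst (sum Q Q) (orbit C))) :=
    (hasNorm_fold Q).comp (hasNorm_fst _)
  -- The two inclusions of `Q` split the fold map, so the product along it is a product of two
  -- factors.
  let s : Bool → (fib (snd Q (orbit C)) →[C] fib (snd (sum Q Q) (orbit C))) := fun i =>
    bif i then fib.map (prodMap (inl Q Q) (MulActionHom.id G)) (snd_prodMap _ _)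
    else fib.map (prodMap (inr Q Q) (MulActionHom.id G)) (snd_prodMap _ _)
  have hs : IsLifts (fib.map (FinGSet.pair ((fold Q).comp (fst (sum Q Q) (orbit C)))
      (snd (sum Q Q) (orbit C))) (snd_pair _ _)) (MulActionHom.id C) s := by
    refine ⟨by rintro (_ | _) o <;> rfl, ?_⟩
    rintro o ⟨⟨x | x, y⟩, hy⟩ hx
    · refine ⟨true, Subtype.ext (Prod.ext ?_ ?_), ?_⟩
      · exact congrArg (fun u => Sum.inl u.1.1) hx.symm
      · exact congrArg (fun u => u.1.2) hx.symm
      · rintro (_ | _) h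
        · exact (Sum.inr_ne_inl (congrArg (fun u => u.1.1) h)).elim
        · rfl
    · refine ⟨false, Subtype.ext (Prod.ext ?_ ?_), ?_⟩
      · exact congrArg (fun u => Sum.inr u.1.1) hx.symm
      · exact congrArg (fun u => u.1.2) hx.symm
      · rintro (_ | _) h
        · rfl
        · exact (Sum.inl_ne_inr (congrArg (fun u => u.1.1) h)).elim
  rw [nm, prodAlong_eq_prod hR ((hasNorm_pair hn _).isLocTriv_fib _) hs, Fintype.prod_bool]
  dsimp only [s, cond_true, cond_false]
  rw [← R.res_comp, ← R.res_comp, ← R.res_comp, ← R.res_comp]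
  refine congrArg R.nmBase (congrArg₂ (· * ·) (congrArg (fun k => R.res k m) ?_)
    (congrArg (fun k => R.res k m) ?_))
  · exact FinGSet.hom_ext fun t => Subtype.ext (Prod.ext (he1 _) rfl)
  · exact FinGSet.hom_ext fun t => Subtype.ext (Prod.ext (he2 _) rfl)

/-- The norm `N_C^G R` with its norms. -/
noncomputable def preTambNorm : PreTamb.{v + 1} G C :=
  { R.norm G with
    norm := normNorm hR
    norm_id := normNorm_id hR
    norm_comp := normNorm_comp hR
    norm_base_change := res_normNorm hR
    norm_empty := normNorm_empty hR
    norm_fold := normNorm_fold hR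
    norm_tr := normNorm_tr hR }

end PreGreen

end

/-! ### Negatives in the norm -/

/-- Separate the image of a section from its complement. -/
lemma FinGSet.exists_separate {G : Type} [Group G] {X P : FinGSet G} (π : P →[G] X)
    (j : X →[G] P) (h : ∀ x, π (j x) = x) :
    ∃ k : P →[G] sum X X, (fold X).comp k = π ∧ IsPB j (MulActionHom.id G) k (inl X X) := by
  classical
  have hc : ∀ (c : G) (p : P), c • p ∈ Set.range j ↔ p ∈ Set.range j := fun c p =>
    ⟨fun ⟨x, hx⟩ => ⟨c⁻¹ • x, by rw [map_smul, hx, inv_smul_smul]⟩,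
      fun ⟨x, hx⟩ => ⟨c • x, by rw [map_smul, hx]⟩⟩
  let k₀ : P → X ⊕ X := fun p => if p ∈ Set.range j then Sum.inl (π p) else Sum.inr (π p)
  have h1 : ∀ p, p ∈ Set.range j → k₀ p = Sum.inl (π p) := fun p hp => if_pos hp
  have h2 : ∀ p, p ∉ Set.range j → k₀ p = Sum.inr (π p) := fun p hp => if_neg hp
  let k : P →[G] sum X X := ⟨k₀, fun c p => by
    by_cases hp : p ∈ Set.range j
    · rw [h1 _ hp, h1 _ ((hc c p).2 hp), map_smul]
      rfl
    · rw [h2 _ hp, h2 _ (fun h => hp ((hc c p).1 h)), map_smul]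
      rfl⟩
  refine ⟨k, hom_ext fun p => ?_, isPB_of (fun x => ?_) (fun p x hp => ?_) fun _ _ _ h => h⟩
  · change fold X (k₀ p) = π p
    by_cases hp : p ∈ Set.range j
    · rw [h1 _ hp]
      rfl
    · rw [h2 _ hp]
      rfl
  · exact (h1 _ ⟨x, rfl⟩).trans (congrArg Sum.inl (h x))
  · have hp' : k₀ p = Sum.inl x := hp
    by_cases hpj : p ∈ Set.range j
    · rw [h1 _ hpj] at hp'
      obtain ⟨x', rfl⟩ := hpj
      rw [h] at hp'
      exact ⟨x', rfl, Sum.inl.inj hp'⟩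
    · rw [h2 _ hpj] at hp'
      cases hp'

section

variable {G : Type} [CommGroup G] [Finite G] {C : Subgroup G}

lemma fib.extend_fibInd {T : FinGSet C} {D : FinGSet G} {c : D →[G] orbit C} (f : fib c →[C] T) :
    fib.map (fib.extend ((fibInd T).comp f)) (fib.extend_str _) = (fibInd T).comp f :=
  FinGSet.hom_ext fun d => Subtype.ext (by
    refine Eq.trans ?_ ((fib.extend_smul ((fibInd T).comp f) 1 d).trans (one_smul G _))
    rw [one_smul]
    rfl)

namespace PreGreen

/-- The `C`-set `T` over the fibre is replaced by the induced `G`-set over `B × G/C`, which brings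
any transfer into the form to which `nmBase_tr` applies. -/
lemma nmBase_tr_hom (R : PreGreen.{v + 1} C) {B : FinGSet G} {T : FinGSet C}
    (f : T →[C] fib (snd B (orbit C))) (m : R.obj T) :
    ∃ (P : FinGSet G) (π : P →[G] B) (e : prod P (orbit C) →[G] ind C T)
      (he : ∀ w, indStr T (e w) = snd P (orbit C) w),
      IsExponential (fst B (orbit C)) (indDesc f) π (fst P (orbit C))
        (prodMap π (MulActionHom.id G)) e ∧
      R.nmBase (R.tr f m) =
        (R.norm G).tr π (R.nmBase (R.res (fib.map e he) (R.tr (fibInd T) m))) := by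
  obtain ⟨P, π, e, H⟩ := exists_isExponential_fst (indDesc f)
  have he : ∀ w, indStr T (e w) = snd P (orbit C) w := fun w => by
    rw [← indDesc_str f, H.proj_eval]
    rfl
  refine ⟨P, π, e, he, H, ?_⟩
  rw [← R.nmBase_tr (indDesc_str f) he H, ← R.tr_comp, fib_map_indDesc_fibInd]

/-- Expand the norm of `1 + y₀ = 0` by distributivity. The section that chooses the left summand
everywhere gives a copy of `X` in the dependent product and contributes `1`; the remaining points
contribute the negative. The norm of zero is a transfer from sections of a map with empty source,
and there are none because `G/C` is nonempty. -/
lemma exists_neg_one_norm {R : PreGreen.{v + 1} C} (hR : R.IsMackey) (X : FinGSet G) :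
    ∃ y s : (R.norm G).obj X, (R.norm G).IsSum 1 y s ∧ (R.norm G).IsZero s := by
  obtain ⟨y₀, s₀, ⟨z, hz1, -, rfl⟩, E, hE, u, a, hs⟩ := hR.exists_neg (fib (snd X (orbit C))) 1
  suffices hw : ∃ w, (R.norm G).res (inl X X) w = 1 ∧ (R.norm G).tr (fold X) w =
      R.nmBase (R.tr (fold (fib (snd X (orbit C)))) z) by
    obtain ⟨w, hw1, hw2⟩ := hw
    refine ⟨_, _, ⟨w, hw1, rfl, hw2⟩, ?_⟩
    rw [hs]
    obtain ⟨P, π, e, he, H, h⟩ := R.nmBase_tr_hom u a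
    refine ⟨P, ⟨fun w => ?_⟩, π, _, h⟩
    obtain ⟨x, t, -⟩ := ind.exists_rep (e ((w, orbit.base C) : prod P (orbit C)))
    exact hE.false t
  obtain ⟨P, π, e, he, H, h⟩ := R.nmBase_tr_hom (fold (fib (snd X (orbit C)))) z
  let F := fib (snd X (orbit C))
  let eW : prod X (orbit C) →[G] ind C (sum F F) := fib.extend ((fibInd _).comp (inl F F))
  have heW : fib.map eW (fib.extend_str _) = (fibInd _).comp (inl F F) := fib.extend_fibInd _
  have hsec : ∀ t, indDesc (fold F) (eW t) = t := by
    refine fib.hom_ext (f := (indDesc (fold F)).comp eW) (f' := MulActionHom.id G)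
      (snd X (orbit C)) fun d => ?_
    have h1 : eW d.1 = ind.mk 1 (inl F F d) :=
      congrArg Subtype.val (DFunLike.congr_fun heW d)
    change indDesc (fold F) (eW d.1) = d.1
    rw [h1]
    exact one_smul G d.1
  -- `j` classifies the section of the fold map that stays in the left summand.
  obtain ⟨j, hj1, hj2⟩ := H.exists_classifying (isPB_id (fst X (orbit C))).symm hsec
  obtain ⟨k, hk1, hk2⟩ := exists_separate π j hj1
  refine ⟨(R.norm G).tr k (R.nmBase (R.res (fib.map e he) (R.tr (fibInd _) z))), ?_, ?_⟩
  · rw [(R.norm G).base_change _ _ _ _ hk2, (R.norm G).tr_id, res_nmBase, ← R.res_comp]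
    have h2 : (fib.map e he).comp (fib.map (prodMap j (MulActionHom.id G)) (snd_prodMap j _)) =
        (fibInd _).comp (inl F F) := by
      rw [← heW]
      exact FinGSet.hom_ext fun d => Subtype.ext
        (hj2 (prodMap j (MulActionHom.id G) d.1) d.1 rfl (Prod.ext (hj1 _) rfl))
    rw [h2, R.res_comp, R.res_tr_of_bijective _ (fibInd_bijective _).1, hz1, nmBase_one]
  · rw [← (R.norm G).tr_comp, hk1, h]

/-- The norm `N_C^G R` of a Green functor as an incomplete Tambara functor. -/
noncomputable def otambNorm {R : PreGreen.{v + 1} C} (hR : R.IsMackey) : OTamb.{v + 1} G C :=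
  (preTambNorm hR.toIsSemiMackey).toOTamb (exists_neg_one_norm hR)

end PreGreen

end

/-! ### Twisted Hochschild homology and Weyl actions -/

section

variable {G : Type} [CommGroup G]

namespace PreGreen

lemma HHRel.of_tr_mul (g : G) (M : PreGreen.{v + 1} G) {B X : FinGSet G} (b : B →[G] X)
    (m n : M.obj B) :
    M.HHRel g X (M.tr b (m * n)) (M.tr b (M.tr (actHom g B) n * m)) := by
  let i : B →[G] prod B B := FinGSet.pair (MulActionHom.id G) (MulActionHom.id G)
  have h1 : ∀ x : M.obj B, M.res ((fst B B).comp i) x = x := M.res_id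
  have h2 : ∀ x : M.obj B, M.res ((snd B B).comp i) x = x := M.res_id
  refine ⟨BoxRep.cls ⟨B, B, B, i, b, m, n⟩, ?_, ?_⟩
  · rw [M.d₀_cls]
    dsimp only
    rw [h1, h2]
  · rw [M.d₁_cls]
    dsimp only
    rw [h1, h2]

/-- Restricting both factors to the middle of the span replaces `T × U ← B` by the diagonal of `B`.
Together with `HHRel.of_tr_mul` this describes the relation without the box product. -/
lemma HHRel.exists_eq {g : G} {M : PreGreen.{v + 1} G} {X : FinGSet G} {x y : M.obj X}
    (h : M.HHRel g X x y) : ∃ (B : FinGSet G) (b : B →[G] X) (m n : M.obj B),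
      x = M.tr b (m * n) ∧ y = M.tr b (M.tr (actHom g B) n * m) := by
  obtain ⟨⟨ρ⟩, rfl, rfl⟩ := h
  have h3 : M.tr (actHom g ρ.B) (M.res ((snd ρ.T ρ.U).comp ρ.a) ρ.n) =
      M.res ((snd ρ.T ρ.U).comp ρ.a) (M.tr (actHom g ρ.U) ρ.n) :=
    (BurnsideFunctor.act g M.toBurnsideFunctor).app_res _ _
  exact ⟨ρ.B, ρ.b, M.res ((fst ρ.T ρ.U).comp ρ.a) ρ.m, M.res ((snd ρ.T ρ.U).comp ρ.a) ρ.n,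
    M.d₀_cls ρ, (M.d₁_cls g ρ).trans (by rw [h3])⟩

end PreGreen

/-- The elements that act trivially form a subgroup. -/
lemma BurnsideFunctor.tr_actHom_eq_of_mem_zpowers (M : BurnsideFunctor.{v} G) {g : G}
    (h : ∀ (X : FinGSet G) (x : M.obj X), M.tr (actHom g X) x = x) {c : G}
    (hc : c ∈ Subgroup.zpowers g) (X : FinGSet G) (x : M.obj X) : M.tr (actHom c X) x = x := by
  let H : Subgroup G :=
    { carrier := {c | ∀ (X : FinGSet G) (x : M.obj X), M.tr (actHom c X) x = x}
      one_mem' := fun X x => by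
        have h1 : actHom (1 : G) X = MulActionHom.id G := hom_ext fun w => one_smul G w
        rw [h1, M.tr_id]
      mul_mem' := fun {a b} ha hb X x => by
        have h1 : actHom (a * b) X = (actHom a X).comp (actHom b X) :=
          hom_ext fun w => mul_smul a b w
        rw [h1, M.tr_comp, hb, ha]
      inv_mem' := fun {a} ha X x => by
        have h1 : (actHom a⁻¹ X).comp (actHom a X) = MulActionHom.id G :=
          hom_ext fun w => inv_smul_smul a w
        conv_lhs => rw [← ha X x]
        rw [← M.tr_comp, h1, M.tr_id] }
  exact (Subgroup.zpowers_le (H := H)).2 h hc X x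

/-- A transitive `G`-set is isomorphic to `G/H` for a subgroup `H`. -/
lemma FinGSet.IsTransitive.exists_orbit [Finite G] {O : FinGSet G} (hO : IsTransitive O) :
    ∃ (H : Subgroup G) (e : orbit H →[G] O), Function.Bijective e := by
  obtain ⟨o⟩ := hO.nonempty
  refine ⟨MulAction.stabilizer G o, ⟨MulAction.ofQuotientStabilizer G o, fun c x =>
    MulAction.ofQuotientStabilizer_smul G o c x⟩, MulAction.injective_ofQuotientStabilizer G o,
    fun y => ?_⟩
  obtain ⟨c, rfl⟩ := hO.exists_smul o y
  exact ⟨QuotientGroup.mk c, rfl⟩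

variable {C : Subgroup G}

/-- Triviality at the orbits `G/H` extends to all finite `G`-sets, since elements are detected on
transitive sets and the action is natural. -/
lemma IsWeylTrivial.tr_actHom [Finite G] {S : OTamb.{v} G C} (hS : IsWeylTrivial C S) (c : G)
    {X : FinGSet G} (x : S.obj X) : S.tr (actHom c X) x = x := by
  refine S.isMackey.ext_of_transitive fun O t hO => ?_
  have h1 : S.res t (S.tr (actHom c X) x) = S.tr (actHom c O) (S.res t x) :=
    ((BurnsideFunctor.act c S.toBurnsideFunctor).app_res t x).symm
  obtain ⟨H, e, he⟩ := hO.exists_orbit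
  apply S.res_injective_of_bijective e he
  rw [h1]
  exact ((BurnsideFunctor.act c S.toBurnsideFunctor).app_res e _).symm.trans (hS H c _)

/-- A morphism to a functor with trivial Weyl action factors through `HH₀`. -/
lemma PreGreen.HHRel.app_eq [Finite G] {g : G} {M : PreGreen.{v + 1} G} {S : OTamb.{v + 1} G C}
    (hS : IsWeylTrivial C S) (ψ : M ⟶ S.toPreGreen) {X : FinGSet G} {x y : M.obj X}
    (h : M.HHRel g X x y) : ψ.app X x = ψ.app X y := by
  obtain ⟨B, b, m, n, rfl, rfl⟩ := h.exists_eq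
  rw [ψ.app_tr, ψ.app_tr, ψ.app_mul, ψ.app_mul, ψ.app_tr, hS.tr_actHom, mul_comm]

/-- By distributivity and multiplicativity the norm of `tr b (m n)` is a transfer of a product of
two norms, and norms and restrictions commute with the action of `g`. So the relation is preserved,
and norms descend to `HH₀`. -/
lemma PreTamb.hhRel_norm (M : PreTamb.{v + 1} G C) {g : G} {X Y : FinGSet G} (f : X →[G] Y)
    (hf : HasNorm C f) {x y : M.obj X} (h : M.toPreGreen.HHRel g X x y) :
    M.toPreGreen.HHRel g Y (M.norm f hf x) (M.norm f hf y) := by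
  obtain ⟨B, b, m, n, rfl, rfl⟩ := h.exists_eq
  obtain ⟨P, E, π, f', r, e, H⟩ := exists_isExponential f b
  have hf' : HasNorm C f' := hf.base_change H.isPB
  have h1 : M.res e (M.tr (actHom g B) n) = M.tr (actHom g E) (M.res e n) :=
    ((BurnsideFunctor.act g M.toBurnsideFunctor).app_res e n).symm
  rw [M.norm_tr f b π f' r e hf hf' H, M.norm_tr f b π f' r e hf hf' H, M.res_mul, M.res_mul,
    M.norm_mul, M.norm_mul, h1, M.norm_tr_actHom]
  exact PreGreen.HHRel.of_tr_mul g M.toPreGreen π _ _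

/-- The twisted `HH₀` of an incomplete Tambara functor, with its norms. -/
def PreTamb.hh0 (g : G) (M : PreTamb.{v + 1} G C) : PreTamb.{v + 1} G C :=
  { M.toPreGreen.HH0 g with
    norm := fun f hf => Quot.map (M.norm f hf) fun _ _ h => M.hhRel_norm f hf h
    norm_id := by
      rintro X h ⟨x⟩
      exact congrArg (Quot.mk _) (M.norm_id h x)
    norm_comp := by
      rintro X Y Z f f' hf hf' h ⟨x⟩
      exact congrArg (Quot.mk _) (M.norm_comp f f' hf hf' h x)
    norm_base_change := by
      rintro P X Y Z p q f f' hf hq h ⟨x⟩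
      exact congrArg (Quot.mk _) (M.norm_base_change p q f f' hf hq h x)
    norm_empty := by
      rintro E X u hu hE ⟨x⟩
      exact congrArg (Quot.mk _) (M.norm_empty u hu hE x)
    norm_fold := by
      rintro X h ⟨x⟩
      exact congrArg (Quot.mk _) (M.norm_fold h x)
    norm_tr := by
      rintro X Y A P E f q π f' r e hf hf' h ⟨x⟩
      exact congrArg (Quot.mk _) (M.norm_tr f q π f' r e hf hf' h x) }

/-- The twisted `HH₀` of an incomplete Tambara functor. -/
def OTamb.hh0 (g : G) (M : OTamb.{v + 1} G C) : OTamb.{v + 1} G C :=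
  (M.toPreTamb.hh0 g).toOTamb fun X => by
    obtain ⟨y, s, ⟨z, hz1, hz2, hz3⟩, E, hE, u, e, hs⟩ := M.isMackey.exists_neg X 1
    exact ⟨Quot.mk _ y, Quot.mk _ s, ⟨Quot.mk _ z, congrArg (Quot.mk _) hz1,
      congrArg (Quot.mk _) hz2, congrArg (Quot.mk _) hz3⟩, E, hE, u, Quot.mk _ e,
      congrArg (Quot.mk _) hs⟩

/-- With first factor `1` and transfer along an identity, the relation identifies `x` with its
translate by `g`, and `g` generates `G`. -/
lemma OTamb.hh0_isWeylTrivial [Finite G] {g : G} (hg : ∀ x : G, x ∈ Subgroup.zpowers g)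
    (M : OTamb.{v + 1} G C) : IsWeylTrivial C (M.hh0 g) := fun H c x => by
  refine (M.hh0 g).tr_actHom_eq_of_mem_zpowers (fun X => ?_) (hg c) (orbit H) x
  have key : ∀ x : M.obj X, M.toPreGreen.HHRel g X x (M.tr (actHom g X) x) := fun x => by
    have h := PreGreen.HHRel.of_tr_mul g M.toPreGreen (MulActionHom.id G) 1 x
    rwa [M.tr_id, M.tr_id, one_mul, mul_one] at h
  rintro ⟨x⟩
  exact (Quot.sound (key x)).symm

end

/-! ### Morphisms out of the norm -/

section

variable {G : Type} [CommGroup G] [Finite G] {C : Subgroup G}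

lemma FinGSet.IsLifts.ind {O X Y : FinGSet C} {f : X →[C] Y} {t : O →[C] Y} {ι : Type}
    {s : ι → (O →[C] X)} (h : IsLifts f t s) :
    IsLifts (ind.map f) (ind.map t) (fun i => ind.map (s i)) where
  apply_lift i a := by
    obtain ⟨x, o, rfl⟩ := ind.exists_rep a
    exact congrArg (ind.mk x) (h.apply_lift i o)
  existsUnique a b hab := by
    obtain ⟨x, o, rfl⟩ := ind.exists_rep a
    obtain ⟨y, d, rfl⟩ := ind.exists_rep b
    obtain ⟨c, rfl, hc⟩ := ind.mk_eq_iff.1 hab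
    have hd : ind.mk y d = ind.mk (y * (c : G)⁻¹) (c • d) := by
      rw [← ind.mk_mul, inv_mul_cancel_right]
    rw [hd]
    obtain ⟨i, hi, hi'⟩ := h.existsUnique o (c • d) ((map_smul f c d).trans hc.symm)
    exact ⟨i, congrArg (ind.mk _) hi, fun i' h' => hi' i' (ind.mk_injective _ h')⟩

namespace OTamb

variable {R : PreGreen.{v + 1} C} (S : OTamb.{v + 1} G C) (φ : R ⟶ S.toPreGreen.restrict C)

/-- The values of a morphism to the underlying Green functor, as elements at induced `G`-sets. -/
def appInd (T : FinGSet C) (m : R.obj T) : S.obj (ind C T) := φ.app T m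

lemma appInd_res {T U : FinGSet C} (f : T →[C] U) (m : R.obj U) :
    S.appInd φ T (R.res f m) = S.res (ind.map f) (S.appInd φ U m) := φ.app_res f m

lemma appInd_tr {T U : FinGSet C} (f : T →[C] U) (m : R.obj T) :
    S.appInd φ U (R.tr f m) = S.tr (ind.map f) (S.appInd φ T m) := φ.app_tr f m

lemma appInd_one (T : FinGSet C) : S.appInd φ T 1 = 1 := φ.app_one T

lemma appInd_mul {T : FinGSet C} (m m' : R.obj T) :
    S.appInd φ T (m * m') = S.appInd φ T m * S.appInd φ T m' := φ.app_mul T m m'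

/-- The norm of `S` along the induced map has the property that characterizes products along `f`,
because norms along split maps are products; and a morphism of Green functors preserves such
products. So compatibility of `φ` with these norms is automatic. -/
lemma appInd_prodAlong (hR : R.IsSemiMackey) {T U : FinGSet C} {f : T →[C] U} (hf : IsLocTriv f)
    (hf' : HasNorm C (ind.map f)) (m : R.obj T) :
    S.appInd φ U (R.prodAlong f m) = S.norm (ind.map f) hf' (S.appInd φ T m) := by
  have hS := (S.toPreGreen.restrict_isGreen C S.isMackey).toIsSemiMackey
  have h1 := ((PreGreen.isProdAlong_prodAlong hR hf m).map φ).eq hS hf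
  have h2 : (S.toPreGreen.restrict C).IsProdAlong f (φ.app T m)
      (S.norm (ind.map f) hf' (φ.app T m)) := PreGreen.isProdAlong_of hS fun O t hO => by
    obtain ⟨ι, hι, s, hs⟩ := exists_isLifts hf t hO
    exact ⟨ι, hι, s, hs, S.toPreTamb.res_norm_eq_prod (ind.map f) hf' hs.ind _⟩
  exact h1.symm.trans (h2.eq hS hf)

/-- The extension of a morphism to the `G`-sets over `G/C`. -/
def appFib {D : FinGSet G} (c : D →[G] orbit C) (m : R.obj (fib c)) : S.obj D :=
  S.tr (indFib c) (S.appInd φ (fib c) m)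

lemma res_appFib {D D' : FinGSet G} {c : D →[G] orbit C} {c' : D' →[G] orbit C} {k : D' →[G] D}
    (hk : ∀ d, c (k d) = c' d) (m : R.obj (fib c)) :
    S.res k (S.appFib φ c m) = S.appFib φ c' (R.res (fib.map k hk) m) := by
  rw [appFib, appFib, appInd_res, S.base_change _ _ _ _ (isPB_of_bijective (indFib_map k hk)
    (indFib_bijective c') (indFib_bijective c).1)]

lemma tr_appFib {D D' : FinGSet G} {c : D →[G] orbit C} {c' : D' →[G] orbit C} {k : D' →[G] D}
    (hk : ∀ d, c (k d) = c' d) (m : R.obj (fib c')) :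
    S.appFib φ c (R.tr (fib.map k hk) m) = S.tr k (S.appFib φ c' m) := by
  have h : (indFib c).comp (ind.map (fib.map k hk)) = k.comp (indFib c') :=
    FinGSet.hom_ext (indFib_map k hk)
  rw [appFib, appFib, appInd_tr, ← S.tr_comp, ← S.tr_comp, h]

lemma appFib_one {D : FinGSet G} (c : D →[G] orbit C) : S.appFib φ c 1 = 1 := by
  rw [appFib, appInd_one]
  exact S.toPreGreen.tr_one_of_bijective _ (indFib_bijective c)

lemma appFib_mul {D : FinGSet G} (c : D →[G] orbit C) (m m' : R.obj (fib c)) :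
    S.appFib φ c (m * m') = S.appFib φ c m * S.appFib φ c m' := by
  rw [appFib, appInd_mul]
  exact S.toPreGreen.tr_mul_res_of_bijective _ (indFib_bijective c) _ _

lemma norm_appFib (hR : R.IsSemiMackey) {D D' : FinGSet G} {c : D →[G] orbit C}
    {c' : D' →[G] orbit C} {k : D' →[G] D} (hk : ∀ d, c (k d) = c' d) (hk' : HasNorm C k)
    (m : R.obj (fib c')) :
    S.appFib φ c (R.prodAlong (fib.map k hk) m) = S.norm k hk' (S.appFib φ c' m) := by
  have h : (indFib c).comp (ind.map (fib.map k hk)) = k.comp (indFib c') :=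
    FinGSet.hom_ext (indFib_map k hk)
  have h1 : HasNorm C (indFib c) := hasNorm_of_injective (indFib_bijective c).1
  have h2 : HasNorm C (indFib c') := hasNorm_of_injective (indFib_bijective c').1
  have h3 : HasNorm C ((indFib c).comp (ind.map (fib.map k hk))) := h ▸ hk'.comp h2
  rw [appFib, appFib, S.appInd_prodAlong φ hR (hk'.isLocTriv_fib hk) h3.of_comp,
    ← S.norm_eq_tr _ (indFib_bijective c) h1,
    ← S.norm_eq_tr _ (indFib_bijective c') h2, ← S.norm_comp _ _ _ _ h3,
    ← S.norm_comp _ _ _ _ (hk'.comp h2)]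
  exact S.toPreTamb.norm_congr h _ _ _

/-- The map out of the norm determined by a morphism to the underlying Green functor of an
incomplete Tambara functor. -/
def normDescApp (X : FinGSet G) : (R.norm G).obj X → S.obj X :=
  R.normLift (fun B b m => S.tr b (S.norm (fst B (orbit C)) (hasNorm_fst B) (S.appFib φ _ m)))
    (fun B b A q cA hq P π e he H m => by
      -- Compatibility with the defining relation is the distributive law of `S` along `B × G/C →
      -- B`.
      rw [tr_appFib, S.norm_tr _ _ _ _ _ _ _ (hasNorm_fst P) H, S.res_appFib φ he, S.tr_comp])

lemma normDescApp_tr_nmBase {X B : FinGSet G} (b : B →[G] X)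
    (m : R.obj (fib (snd B (orbit C)))) :
    S.normDescApp φ X ((R.norm G).tr b (R.nmBase m)) =
      S.tr b (S.norm (fst B (orbit C)) (hasNorm_fst B) (S.appFib φ _ m)) :=
  R.normLift_tr_nmBase _ _ _ _

/-- By definition `nm` is `nmBase` of a product along `D → B × G/C`; `φ` turns this product into a
norm of `S`, and functoriality merges it with the norm along the projection. -/
lemma normDescApp_tr_nm (hR : R.IsSemiMackey) {X B D : FinGSet G} (b : B →[G] X) {h : D →[G] B}
    (hh : HasNorm C h) (c : D →[G] orbit C) (m : R.obj (fib c)) :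
    S.normDescApp φ X ((R.norm G).tr b (R.nm h c m)) = S.tr b (S.norm h hh (S.appFib φ c m)) := by
  rw [PreGreen.nm, normDescApp_tr_nmBase, S.norm_appFib φ hR _ (hasNorm_pair hh c),
    ← S.norm_comp _ _ _ _ hh]
  rfl

/-- The morphism out of the norm determined by a morphism to the underlying Green functor of an
incomplete Tambara functor. -/
def normDesc : R.norm G ⟶ S.toPreGreen where
  app := S.normDescApp φ
  app_res {X Y} f y := by
    obtain ⟨B, b, m, rfl⟩ := R.exists_eq_tr_nmBase y
    have h := isPB_pb b f
    rw [(R.norm G).base_change _ _ _ _ h, PreGreen.res_nmBase, normDescApp_tr_nmBase,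
      normDescApp_tr_nmBase, S.base_change _ _ _ _ h,
      S.norm_base_change _ _ _ _ _ (hasNorm_fst _) (isPB_fst_right (pbFst b f) (orbit C)),
      S.res_appFib φ (snd_prodMap _ _)]
  app_tr {X Y} f x := by
    obtain ⟨B, b, m, rfl⟩ := R.exists_eq_tr_nmBase x
    rw [← (R.norm G).tr_comp, normDescApp_tr_nmBase, normDescApp_tr_nmBase, S.tr_comp]
  app_one X := by
    have h := S.normDescApp_tr_nmBase φ (MulActionHom.id G : X →[G] X) 1
    rwa [(R.norm G).tr_id, S.tr_id, R.nmBase_one, appFib_one, S.norm_one] at h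
  app_mul X x y := by
    obtain ⟨B, b, m, rfl⟩ := R.exists_eq_tr_nmBase x
    obtain ⟨B', b', m', rfl⟩ := R.exists_eq_tr_nmBase y
    have h := isPB_pb b b'
    have h1 : ∀ {A B : FinGSet G} (k : A →[G] B) (m : R.obj (fib (snd B (orbit C)))),
        S.norm (fst A (orbit C)) (hasNorm_fst A) (S.appFib φ _
          (R.res (fib.map (prodMap k (MulActionHom.id G)) (snd_prodMap k _)) m)) =
        S.res k (S.norm (fst B (orbit C)) (hasNorm_fst B) (S.appFib φ _ m)) := fun k m => by
      rw [S.norm_base_change _ _ _ _ _ (hasNorm_fst _) (isPB_fst_right k (orbit C)),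
        S.res_appFib φ (snd_prodMap k _)]
    rw [(R.norm G).tr_mul_tr _ _ _ _ h, PreGreen.res_nmBase, PreGreen.res_nmBase,
      ← PreGreen.nmBase_mul, normDescApp_tr_nmBase, normDescApp_tr_nmBase, normDescApp_tr_nmBase,
      S.tr_mul_tr _ _ _ _ h, appFib_mul, S.norm_mul, h1, h1]

/-- One exponential diagram computes both norms: through `normNorm_tr_nm` in the source, through the
distributive law in `S`. -/
lemma normDesc_norm (hR : R.IsSemiMackey) {X Y : FinGSet G} (f : X →[G] Y) (hf : HasNorm C f)
    (x : (R.norm G).obj X) : (S.normDesc φ).app Y (PreGreen.normNorm hR f hf x) =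
      S.norm f hf ((S.normDesc φ).app X x) := by
  obtain ⟨B, b, m, rfl⟩ := PreGreen.exists_eq_tr_nm hR x
  obtain ⟨P, E, π, f', r, e, H⟩ := exists_isExponential f b
  have hf' : HasNorm C f' := hf.base_change H.isPB
  have h := isPB_pb (fst B (orbit C)) e
  have hh := (hasNorm_fst (C := C) B).base_change h
  refine (congrArg _ (PreGreen.normNorm_tr_nm hR hf H (hasNorm_fst B) (comp_str _ _) h m)).trans
    ((S.normDescApp_tr_nm φ hR _ (hf'.comp hh) _ _).trans ?_)
  refine Eq.trans ?_ (congrArg _ (S.normDescApp_tr_nm φ hR b (hasNorm_fst B) _ m).symm)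
  rw [S.norm_tr _ _ _ _ _ _ _ hf' H, S.norm_base_change _ _ _ _ _ hh h,
    S.res_appFib φ (comp_str _ _), S.norm_comp _ _ hh hf']

end OTamb

end

/-! ### The adjunction -/

section

variable {G : Type} [CommGroup G] [Finite G] {C : Subgroup G}

lemma fib_map_indFib_fibInd {D : FinGSet G} (c : D →[G] orbit C) :
    (fib.map (indFib c) (indFib_str c)).comp (fibInd (fib c)) = MulActionHom.id C :=
  FinGSet.hom_ext fun d => Subtype.ext (one_smul G d.1)

lemma indFib_map_fibInd (T : FinGSet C) :
    (indFib (indStr T)).comp (ind.map (fibInd T)) = MulActionHom.id G :=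
  FinGSet.hom_ext fun a => by
    obtain ⟨x, t, rfl⟩ := ind.exists_rep a
    exact congrArg (fun y => ind.mk y t) (mul_one x)

lemma fib_map_indMap_fibInd {T U : FinGSet C} (f : T →[C] U) :
    (fib.map (ind.map f) (indStr_map f)).comp (fibInd T) = (fibInd U).comp f := rfl

namespace PreGreen

variable {R : PreGreen.{v + 1} C} (hR : R.IsSemiMackey)

include hR

lemma res_nm_id {D D' : FinGSet G} {c : D →[G] orbit C} {c' : D' →[G] orbit C} {k : D' →[G] D}
    (hk : ∀ d, c (k d) = c' d) (m : R.obj (fib c)) :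
    (R.norm G).res k (R.nm (MulActionHom.id G) c m) =
      R.nm (MulActionHom.id G) c' (R.res (fib.map k hk) m) :=
  res_nm hR (hasNorm_id D) (isPB_id k) hk m

lemma tr_nm_id {D D' : FinGSet G} {c : D →[G] orbit C} {c' : D' →[G] orbit C} {k : D' →[G] D}
    (hk : ∀ d, c (k d) = c' d) (m : R.obj (fib c')) :
    R.nm (MulActionHom.id G) c (R.tr (fib.map k hk) m) =
      (R.norm G).tr k (R.nm (MulActionHom.id G) c' m) := by
  rw [nm_tr hR (hasNorm_id D) hk (fun _ => rfl : ∀ w, c' (MulActionHom.id G w) = c' w)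
    (isExponential_id k)]
  exact congrArg (fun m => (R.norm G).tr k (R.nm (MulActionHom.id G) c' m)) (R.res_id m)

/-- The norm formula for the trivial exponential diagram, with identity transfers. It confirms that
`nm h c m` is the norm along `h` of an element at `D`. -/
lemma nm_eq_normNorm {D B : FinGSet G} {h : D →[G] B} (hh : HasNorm C h) (c : D →[G] orbit C)
    (m : R.obj (fib c)) : R.nm h c m = normNorm hR h hh (R.nm (MulActionHom.id G) c m) := by
  have key := normNorm_tr_nm hR hh (isExponential_id_right h) (hasNorm_id D) (comp_str c _)
    (isPB_id (MulActionHom.id G)) m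
  rw [(R.norm G).tr_id, (R.norm G).tr_id] at key
  exact (congrArg (R.nm h c) (R.res_id m).symm).trans key.symm

/-- The unit `R → i_C^* N_C^G R`. -/
noncomputable def normUnit : R ⟶ (R.norm G).restrict C :=
  PreGreen.Hom.mk (BurnsideFunctor.Hom.mk
      (fun T m => R.nm (MulActionHom.id G) (indStr T) (R.tr (fibInd T) m))
      (fun {T U} f m => by
        refine Eq.trans (congrArg _ ?_) (res_nm_id hR (indStr_map f) _).symm
        have h : IsPB f (fibInd T) (fibInd U) (fib.map (ind.map f) (indStr_map f)) :=
          isPB_of_bijective (fun _ => rfl) (fibInd_bijective T) (fibInd_bijective U).1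
        exact (R.base_change _ _ _ _ h m).symm)
      (fun {T U} f m => by
        refine Eq.trans (congrArg _ ?_) (tr_nm_id hR (indStr_map f) _)
        rw [← R.tr_comp, ← R.tr_comp, fib_map_indMap_fibInd]))
    (fun T => by
      change R.nm (MulActionHom.id G) (indStr T) (R.tr (fibInd T) 1) = 1
      rw [R.tr_one_of_bijective _ (fibInd_bijective T), nm_one hR (hasNorm_id _)])
    (fun T m m' => by
      change R.nm (MulActionHom.id G) (indStr T) (R.tr (fibInd T) (m * m')) =
        R.nm (MulActionHom.id G) (indStr T) (R.tr (fibInd T) m) *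
          R.nm (MulActionHom.id G) (indStr T) (R.tr (fibInd T) m')
      rw [R.tr_mul_res_of_bijective _ (fibInd_bijective T), nm_mul hR (hasNorm_id _)])

lemma nm_id_eq_tr {D : FinGSet G} (c : D →[G] orbit C) (m : R.obj (fib c)) :
    R.nm (MulActionHom.id G) c m = (R.norm G).tr (indFib c)
      (R.nm (MulActionHom.id G) (indStr (fib c)) (R.tr (fibInd (fib c)) m)) := by
  rw [← tr_nm_id hR (indFib_str c), ← R.tr_comp, fib_map_indFib_fibInd, R.tr_id]

/-- With `exists_eq_tr_nmBase` this shows that the image of the unit generates `N_C^G R` under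
transfers and norms along the projections `B × G/C → B`. It is used to compare actions on morphisms.
-/
lemma nmBase_eq_normNorm {B : FinGSet G} (m : R.obj (fib (snd B (orbit C)))) :
    normNorm hR (fst B (orbit C)) (hasNorm_fst B) ((R.norm G).tr (indFib (snd B (orbit C)))
      (R.nm (MulActionHom.id G) (indStr _) (R.tr (fibInd _) m))) = R.nmBase m := by
  rw [← nm_id_eq_tr hR, ← nm_eq_normNorm hR, nm_fst hR]

end PreGreen

namespace OTamb

variable {R : PreGreen.{v + 1} C} (hR : R.IsSemiMackey) (S : OTamb.{v + 1} G C)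

/-- On the image of the unit only the norm along an identity occurs, and the identifications of `T`
with a fibre and of that fibre's induced `G`-set with `ind C T` cancel. -/
lemma normDesc_normUnit (φ : R ⟶ S.toPreGreen.restrict C) {T : FinGSet C} (m : R.obj T) :
    (S.normDesc φ).app (ind C T) ((PreGreen.normUnit (G := G) hR).app T m) = φ.app T m := by
  have h := S.normDescApp_tr_nm φ hR (MulActionHom.id G) (hasNorm_id (ind C T)) (indStr T)
    (R.tr (fibInd T) m)
  rw [(R.norm G).tr_id, S.tr_id, S.norm_id, appFib, appInd_tr, ← S.tr_comp, indFib_map_fibInd,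
    S.tr_id] at h
  exact h

/-- A morphism out of the norm which commutes with norms is determined by its composite with the
unit. -/
lemma normDesc_eq (ψ : R.norm G ⟶ S.toPreGreen) (hψ : ∀ {X Y : FinGSet G} (f : X →[G] Y)
    (hf : HasNorm C f) (x : (R.norm G).obj X),
    ψ.app Y (PreGreen.normNorm hR f hf x) = S.norm f hf (ψ.app X x))
    (φ : R ⟶ S.toPreGreen.restrict C)
    (hφ : ∀ {T : FinGSet C} (m : R.obj T), S.appInd φ T m =
      ψ.app (ind C T) (R.nm (MulActionHom.id G) (indStr T) (R.tr (fibInd T) m)))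
    {X : FinGSet G} (x : (R.norm G).obj X) : (S.normDesc φ).app X x = ψ.app X x := by
  obtain ⟨B, b, m, rfl⟩ := PreGreen.exists_eq_tr_nm hR x
  refine (S.normDescApp_tr_nm φ hR b (hasNorm_fst B) _ m).trans ?_
  rw [ψ.app_tr, PreGreen.nm_eq_normNorm hR (hasNorm_fst B), hψ,
    PreGreen.nm_id_eq_tr hR, ψ.app_tr, appFib, hφ]

end OTamb

/-- The Green Witt vectors of a Green functor, as an incomplete Tambara functor. -/
noncomputable def wittOTamb {g : G} (hg : ∀ x : G, x ∈ Subgroup.zpowers g) (R : Green.{v + 1} C) :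
    OTambTriv.{v + 1} G C :=
  ⟨(PreGreen.otambNorm R.property).hh0 g, OTamb.hh0_isWeylTrivial hg _⟩

/-- The unit of the adjunction between Green Witt vectors and the underlying Green functor. -/
noncomputable def wittUnit {g : G} (hg : ∀ x : G, x ∈ Subgroup.zpowers g) (R : Green.{v + 1} C) :
    R ⟶ (underlyingGreen G C).obj (wittOTamb hg R) :=
  ObjectProperty.homMk (PreGreen.Hom.mk (BurnsideFunctor.Hom.mk
      (fun T m => Quot.mk _ ((PreGreen.normUnit (G := G) R.property.toIsSemiMackey).app T m))
      (fun f m => congrArg (Quot.mk _) (BurnsideFunctor.Hom.app_res _ f m))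
      (fun f m => congrArg (Quot.mk _) (BurnsideFunctor.Hom.app_tr _ f m)))
    (fun T => congrArg (Quot.mk _) (PreGreen.Hom.app_one _ T))
    (fun T m m' => congrArg (Quot.mk _) (PreGreen.Hom.app_mul _ T m m')))

/-- The morphism from the Green Witt vectors determined by a morphism to an underlying Green
functor. -/
noncomputable def wittDesc {g : G} {R : PreGreen.{v + 1} C} (hR : R.IsMackey)
    {S : OTamb.{v + 1} G C} (hS : IsWeylTrivial C S) (φ : R ⟶ S.toPreGreen.restrict C) :
    (PreGreen.otambNorm hR).hh0 g ⟶ S :=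
  OTamb.Hom.mk (PreGreen.Hom.mk (BurnsideFunctor.Hom.mk
      (fun X => Quot.lift ((S.normDesc φ).app X)
        fun _ _ h => PreGreen.HHRel.app_eq hS (S.normDesc φ) h)
      (fun f => by
        rintro ⟨x⟩
        exact (S.normDesc φ).app_res f x)
      (fun f => by
        rintro ⟨x⟩
        exact (S.normDesc φ).app_tr f x))
    (fun X => (S.normDesc φ).app_one X)
    (fun X => by
      rintro ⟨x⟩ ⟨y⟩
      exact (S.normDesc φ).app_mul X x y))
    (fun f hf => by
      rintro ⟨x⟩
      exact S.normDesc_norm φ hR.toIsSemiMackey f hf x)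

/-- The quotient map from the norm to its twisted `HH₀`. -/
def PreGreen.toHH0 (g : G) (M : PreGreen.{v + 1} G) : M ⟶ M.HH0 g :=
  PreGreen.Hom.mk (BurnsideFunctor.Hom.mk (fun X => Quot.mk (M.HHRel g X)) (fun _ _ => rfl)
    (fun _ _ => rfl)) (fun _ => rfl) (fun _ _ _ => rfl)

/-- The universal property of the Green Witt vectors. -/
noncomputable def wittHomEquiv {g : G} (hg : ∀ x : G, x ∈ Subgroup.zpowers g) (R : Green.{v + 1} C)
    (S : OTambTriv.{v + 1} G C) :
    (wittOTamb hg R ⟶ S) ≃ (R ⟶ (underlyingGreen G C).obj S) where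
  toFun ψ := wittUnit hg R ≫ (underlyingGreen G C).map ψ
  invFun φ := ObjectProperty.homMk (wittDesc R.property S.property φ.hom)
  left_inv ψ := by
    refine ObjectProperty.hom_ext _ (OTamb.Hom.ext (funext fun X => funext fun x => ?_))
    rcases x with ⟨x⟩
    -- Composed with the quotient map, `ψ` becomes a morphism out of the norm that commutes with
    -- norms, hence is determined by its composite with the unit.
    exact S.obj.normDesc_eq R.property.toIsSemiMackey
      ((R.obj.norm G).toHH0 g ≫ ψ.hom.toPreGreenHom)
      (fun f hf x => ψ.hom.app_norm f hf (Quot.mk _ x)) _ (fun _ => rfl) x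
  right_inv φ := by
    refine ObjectProperty.hom_ext _ (PreGreen.Hom.ext (funext fun T => funext fun m => ?_))
    exact S.obj.normDesc_normUnit R.property.toIsSemiMackey φ.hom m

/-- The left adjoint of the underlying Green functor is given by the Green Witt vectors. -/
noncomputable def wittFunctor {g : G} (hg : ∀ x : G, x ∈ Subgroup.zpowers g) (C : Subgroup G) :
    Green.{v + 1} C ⥤ OTambTriv.{v + 1} G C :=
  Adjunction.leftAdjointOfEquiv (G := underlyingGreen G C) (wittHomEquiv hg)
    fun _ _ _ _ _ => by
      simp only [wittHomEquiv, Equiv.coe_fn_mk, Functor.map_comp, Category.assoc]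

/-- The underlying functor of the left adjoint is the Green Witt vectors functor. -/
noncomputable def wittFunctorIso {g : G} (hg : ∀ x : G, x ∈ Subgroup.zpowers g) (C : Subgroup G) :
    wittFunctor.{v} hg C ⋙ (IsWeylTrivial C).ι ⋙ OTamb.toGreen G C ⋙ (isGreen G).ι ≅
      greenWitt g C :=
  -- On objects the two functors agree by construction. On morphisms the left adjoint is defined by
  -- transposition, so naturality has to be checked, and generators `tr b (nmBase m)` suffice.
  NatIso.ofComponents (fun R => Iso.refl ((R.obj.norm G).HH0 g)) (fun {R R'} f => by
    refine PreGreen.Hom.ext (funext fun X => funext fun x => ?_)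
    rcases x with ⟨x⟩
    obtain ⟨B, b, m, rfl⟩ := R.obj.exists_eq_tr_nmBase x
    refine ((wittOTamb hg R').obj.normDescApp_tr_nmBase
      (f ≫ wittUnit hg R' ≫ (underlyingGreen G C).map (𝟙 _)).hom b m).trans ?_
    exact congrArg (fun y => Quot.mk _ ((R'.obj.norm G).tr b y))
      (PreGreen.nmBase_eq_normNorm R'.property.toIsSemiMackey (f.hom.app _ m)))

end

theorem mainTheorem9 {G : Type} [CommGroup G] [Finite G] (g : G)
    (hg : ∀ x : G, x ∈ Subgroup.zpowers g) (C : Subgroup G) (n p k : ℕ) (hp : p.Prime)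
    (hC : Nat.card C = n) (hG : Nat.card G = n * p ^ k) :
    ∃ W : Green.{v + 1} C ⥤ OTambTriv.{v + 1} G C,
      Nonempty (W ⋙ (IsWeylTrivial C).ι ⋙ OTamb.toGreen G C ⋙ (isGreen G).ι ≅ greenWitt g C) ∧
      Nonempty (W ⊣ underlyingGreen G C) :=
  ⟨wittFunctor hg C, ⟨wittFunctorIso hg C⟩, ⟨Adjunction.adjunctionOfEquivLeft _ _⟩⟩
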